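/- Let $N\ge 2$, $\ell>0$, $g,\sigma>0$, $r\ge \tfrac12$, $\Sigma=\mathbb T^{N-1}=(\mathbb R/\mathbb Z)^{N-1}$ and $\Omega=\Sigma\times(0,\ell)$, with points $(x,y)$, $x\in\Sigma$. Hats denote Fourier coefficients in $x$ and $\|f\|_{H^s(\Sigma)}^2=\sum_{\xi\in\mathbb Z^{N-1}}(1+|\xi|^2)^s|\hat f(\xi)|^2$. Let $\mu(\xi)=g+\sigma(2\pi|\xi|)^{2r}$ for $\xi\in\mathbb Z^{N-1}$ and let $M$ be the Fourier multiplication operator $\widehat{M(h)}(\xi)=\mu(\xi)\hat h(\xi)$. Let ${}_0H^1_\sigma(\Omega)$ be the space of $v\in H^1(\Omega;\mathbb R^N)$ with $v=0$ on $\{y=0\}$ and $\operatorname{div}v=0$, embedded in its dual by the $L^2(\Omega)$ inner product, and let $(\mathbb Dv)_{ij}=\partial_iv_j+\partial_jv_i$. A pair $(u,h)$ of real-valued functions is a weak solution with data $(u_0,h_0)\in L^2(\Omega;\mathbb R^N)\times L^2(\Sigma)$ if $u\in L^2_{loc}([0,\infty);{}_0H^1_\sigma(\Omega))$, $\partial_tu\in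 L^2_{loc}([0,\infty);({}_0H^1_\sigma(\Omega))^*)$, $h,M(h)\in L^2_{loc}([0,\infty);L^2(\Sigma))$, $\partial_th\in L^2_{loc}([0,\infty);H^{1/2}(\Sigma))$ (time derivatives in the weak sense), if for every $T>0$ and every $v\in L^2(0,T;{}_0H^1_\sigma(\Omega))$ $$\langle\partial_tu,v\rangle+\tfrac12(\mathbb Du,\mathbb Dv)_{L^2(\Omega)}+\int_{\{y=\ell\}}M(h)\,v_N\,dx=0\quad\text{for a.e. }t\in(0,T),$$ and if $\partial_th=u_N$ on $\{y=\ell\}$ and $\int_\Sigma h\,dx=0$ for a.e. $t$, and $u=u_0$, $h=h_0$ at $t=0$ (as limits in $L^2$ as $t\to0^+$ outside a null set of times). Then there are constants $c,K>0$, depending only on $N,\ell,g,\sigma,r$, such that for every weak solution $(u,h)$ with $u_0\in L^2(\Omega;\mathbb R^N)$ and $h_0\in H^r(\Sigma)$ the following holds: $u$ and $h$ have representatives that are continuous on $[0,\infty)$ with values in $L^2(\Omega;\mathbb R^N)$ and $L^2(\Sigma)$ and equal $u_0$, $h_0$ at $t=0$, and for these the total energy $$\mathcal E(t)=\frac12\int_\Omega|u(\cdot,t)|^2+\frac12\int_\Sigma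 M(h)h=\frac12\int_\Omega|u(\cdot,t)|^2+\frac12\sum_{\xi\in\mathbb Z^{N-1}}\mu(\xi)|\hat h(\xi,t)|^2$$ satisfies $\mathcal E(0)<\infty$ and $$\mathcal E(t)\le K\,\mathcal E(0)\,e^{-ct}\qquad\text{for all }t\ge0 .$$ -/

import Mathlib

open MeasureTheory Set Filter Topology
open scoped ENNReal ContDiff

noncomputable section

namespace ViscousSlab

/-! ### The horizontal torus and the slab

Horizontal dimension `d = N - 1`.  A velocity has `d + 1 = N` components; the index `Fin.last d`
is the vertical direction.  The torus is `(ℝ/ℤ)^d` with its Lebesgue measure of total mass one. -/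

/-- Normalised Lebesgue (Haar) measure on the torus `(ℝ/ℤ)^d`. -/
abbrev torusMeasure (d : ℕ) : Measure (UnitAddTorus (Fin d)) :=
  Measure.pi fun _ => AddCircle.haarAddCircle

/-- Lebesgue measure on the slab `Ω = (ℝ/ℤ)^d × (0, ℓ)`, as a measure on `(ℝ/ℤ)^d × ℝ`. -/
abbrev slabMeasure (d : ℕ) (ℓ : ℝ) : Measure (UnitAddTorus (Fin d) × ℝ) :=
  (torusMeasure d).prod (volume.restrict (Ioo 0 ℓ))

/-- `L²(Ω; ℝ^N)`. -/
abbrev VelocityL2 (d : ℕ) (ℓ : ℝ) : Type :=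
  Lp (EuclideanSpace ℝ (Fin (d + 1))) 2 (slabMeasure d ℓ)

/-- `L²(Ω; ℝ^{N × N})`; the entry `(i, j)` of a gradient is `∂ᵢ uⱼ`. -/
abbrev GradientL2 (d : ℕ) (ℓ : ℝ) : Type :=
  Lp (EuclideanSpace ℝ (Fin (d + 1) × Fin (d + 1))) 2 (slabMeasure d ℓ)

/-- `L²(Σ)`, real valued. -/
abbrev SurfaceL2 (d : ℕ) : Type := Lp ℝ 2 (torusMeasure d)

/-- The covering map `ℝ^{d+1} → (ℝ/ℤ)^d × ℝ`. -/
def cover (d : ℕ) (z : Fin (d + 1) → ℝ) : UnitAddTorus (Fin d) × ℝ :=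
  (fun j => (z j.castSucc : UnitAddCircle), z (Fin.last d))

/-- Smooth functions on `(ℝ/ℤ)^d × ℝ`. -/
def IsSmooth {d : ℕ} (φ : UnitAddTorus (Fin d) × ℝ → ℝ) : Prop :=
  ContDiff ℝ ∞ (φ ∘ cover d)

/-- The (classical) partial derivative `∂ᵢ φ` on `(ℝ/ℤ)^d × ℝ`. -/
def pd {d : ℕ} (i : Fin (d + 1)) (φ : UnitAddTorus (Fin d) × ℝ → ℝ)
    (p : UnitAddTorus (Fin d) × ℝ) : ℝ :=
  deriv (fun s : ℝ => φ (p + cover d (Pi.single i s))) 0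

/-! ### Weak gradients and traces -/

/-- `G` is the weak gradient of `u` on `Ω`. -/
def IsWeakGradient {d : ℕ} (ℓ : ℝ)
    (u : UnitAddTorus (Fin d) × ℝ → EuclideanSpace ℝ (Fin (d + 1)))
    (G : UnitAddTorus (Fin d) × ℝ → EuclideanSpace ℝ (Fin (d + 1) × Fin (d + 1))) : Prop :=
  ∀ φ : UnitAddTorus (Fin d) × ℝ → ℝ, IsSmooth φ → tsupport φ ⊆ univ ×ˢ Ioo 0 ℓ →
    ∀ i j, ∫ p, u p j * pd i φ p ∂slabMeasure d ℓ = -∫ p, G p (i, j) * φ p ∂slabMeasure d ℓ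

/-- `b` is the trace on `{y = 0}` of a function `f` on `Ω` with `∂_y f = fy`: the integration by
parts formula holds against all smooth functions vanishing on `{y = ℓ}`. -/
def HasBottomTrace {d : ℕ} (ℓ : ℝ) (f fy : UnitAddTorus (Fin d) × ℝ → ℝ)
    (b : UnitAddTorus (Fin d) → ℝ) : Prop :=
  ∀ φ : UnitAddTorus (Fin d) × ℝ → ℝ, IsSmooth φ → (∀ x, φ (x, ℓ) = 0) →
    (∫ p, fy p * φ p ∂slabMeasure d ℓ) + ∫ p, f p * pd (Fin.last d) φ p ∂slabMeasure d ℓ =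
      -∫ x, b x * φ (x, 0) ∂torusMeasure d

/-- `g` is the trace on `{y = ℓ}` of a function `f` on `Ω` with `∂_y f = fy`: the integration by
parts formula holds against all smooth functions vanishing on `{y = 0}`. -/
def HasTopTrace {d : ℕ} (ℓ : ℝ) (f fy : UnitAddTorus (Fin d) × ℝ → ℝ)
    (g : UnitAddTorus (Fin d) → ℝ) : Prop :=
  ∀ φ : UnitAddTorus (Fin d) × ℝ → ℝ, IsSmooth φ → (∀ x, φ (x, 0) = 0) →
    (∫ p, fy p * φ p ∂slabMeasure d ℓ) + ∫ p, f p * pd (Fin.last d) φ p ∂slabMeasure d ℓ =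
      ∫ x, g x * φ (x, ℓ) ∂torusMeasure d

/-! ### Facts needed to see that the velocity space is a linear space -/

theorem cover_add {d : ℕ} (z w : Fin (d + 1) → ℝ) : cover d (z + w) = cover d z + cover d w := by
  ext <;> simp [cover]

theorem isOpenQuotientMap_cover (d : ℕ) : IsOpenQuotientMap (cover d) := by
  have h1 : IsOpenQuotientMap (Pi.map fun (_ : Fin d) (s : ℝ) => (s : UnitAddCircle)) :=
    IsOpenQuotientMap.piMap fun _ => QuotientAddGroup.isOpenQuotientMap_mk
  have h2 := h1.prodMap (IsOpenQuotientMap.id (X := ℝ))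
  let e : (Fin (d + 1) → ℝ) ≃ₜ (Fin d → ℝ) × ℝ :=
    { toFun := fun z => (fun j => z j.castSucc, z (Fin.last d))
      invFun := fun q => Fin.snoc q.1 q.2
      left_inv := fun z => by
        ext i
        refine Fin.lastCases ?_ (fun j => ?_) i <;> simp
      right_inv := fun q => by ext <;> simp
      continuous_toFun := by fun_prop
      continuous_invFun := by fun_prop }
  exact h2.comp e.isOpenQuotientMap

theorem IsSmooth.continuous {d : ℕ} {φ : UnitAddTorus (Fin d) × ℝ → ℝ} (h : IsSmooth φ) :
    Continuous φ :=
  (isOpenQuotientMap_cover d).isQuotientMap.continuous_iff.2 (ContDiff.continuous h)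

theorem IsSmooth.pd {d : ℕ} {φ : UnitAddTorus (Fin d) × ℝ → ℝ} (h : IsSmooth φ)
    (i : Fin (d + 1)) : IsSmooth (pd i φ) := by
  have key : ViscousSlab.pd i φ ∘ cover d =
      fun z => fderiv ℝ (φ ∘ cover d) z (Pi.single i 1) := by
    ext z
    have hd : DifferentiableAt ℝ (φ ∘ cover d) z := (ContDiff.differentiable h (by simp)) z
    have h3 := hd.hasFDerivAt.hasLineDerivAt (Pi.single i 1)
    have h4 : (fun s : ℝ => φ (cover d z + cover d (Pi.single i s))) =
        fun s : ℝ => (φ ∘ cover d) (z + s • Pi.single i (1 : ℝ)) := by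
      ext s
      rw [Function.comp_apply, cover_add, ← Pi.single_smul]
      simp
    simp only [Function.comp_apply, ViscousSlab.pd, h4]
    exact h3.deriv
  unfold IsSmooth
  rw [key]
  exact (ContDiff.fderiv_right h (m := ∞) (by simp)).clm_apply contDiff_const

theorem integrable_coord_mul {d : ℕ} {ℓ : ℝ} {ι : Type} [Fintype ι]
    (f : Lp (EuclideanSpace ℝ ι) 2 (slabMeasure d ℓ)) (i : ι)
    {ψ : UnitAddTorus (Fin d) × ℝ → ℝ} (hψ : Continuous ψ) :
    Integrable (fun p => f p i * ψ p) (slabMeasure d ℓ) := by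
  have hK : IsCompact ((univ : Set (UnitAddTorus (Fin d))) ×ˢ Icc (0 : ℝ) ℓ) :=
    isCompact_univ.prod isCompact_Icc
  obtain ⟨C, hC⟩ := hK.exists_bound_of_continuousOn hψ.continuousOn
  have hf : MemLp (fun p => f p i) 2 (slabMeasure d ℓ) := by
    refine (Lp.memLp f).of_le ?_ (Eventually.of_forall fun p => ?_)
    · exact ((EuclideanSpace.proj (𝕜 := ℝ) i).continuous.comp_aestronglyMeasurable
        (Lp.aestronglyMeasurable f))
    · exact PiLp.norm_apply_le (f p) i
  have hi : Integrable (fun p => f p i) (slabMeasure d ℓ) := hf.integrable (by norm_num)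
  refine hi.mul_bdd (c := C) hψ.aestronglyMeasurable ?_
  have hm : slabMeasure d ℓ = ((torusMeasure d).prod volume).restrict (univ ×ˢ Ioo 0 ℓ) := by
    rw [← Measure.prod_restrict, Measure.restrict_univ]
  rw [hm]
  filter_upwards [ae_restrict_mem (MeasurableSet.univ.prod measurableSet_Ioo)] with p hp
  exact hC p ⟨hp.1, Ioo_subset_Icc_self hp.2⟩

theorem integral_coord_add {d : ℕ} {ℓ : ℝ} {ι : Type} [Fintype ι]
    (f g : Lp (EuclideanSpace ℝ ι) 2 (slabMeasure d ℓ)) (i : ι)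
    {ψ : UnitAddTorus (Fin d) × ℝ → ℝ} (hψ : Continuous ψ) :
    ∫ p, (f + g) p i * ψ p ∂slabMeasure d ℓ =
      (∫ p, f p i * ψ p ∂slabMeasure d ℓ) + ∫ p, g p i * ψ p ∂slabMeasure d ℓ := by
  rw [← integral_add (integrable_coord_mul f i hψ) (integrable_coord_mul g i hψ)]
  refine integral_congr_ae ?_
  filter_upwards [Lp.coeFn_add f g] with p hp
  rw [hp, Pi.add_apply, PiLp.add_apply, add_mul]

theorem integral_coord_smul {d : ℕ} {ℓ : ℝ} {ι : Type} [Fintype ι] (c : ℝ)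
    (f : Lp (EuclideanSpace ℝ ι) 2 (slabMeasure d ℓ)) (i : ι)
    (ψ : UnitAddTorus (Fin d) × ℝ → ℝ) :
    ∫ p, (c • f) p i * ψ p ∂slabMeasure d ℓ = c * ∫ p, f p i * ψ p ∂slabMeasure d ℓ := by
  rw [← integral_const_mul]
  refine integral_congr_ae ?_
  filter_upwards [Lp.coeFn_smul c f] with p hp
  rw [hp, Pi.smul_apply, PiLp.smul_apply, smul_eq_mul, mul_assoc]

/-! ### The solenoidal space with the no-slip condition -/

/-- The space of `u ∈ H¹(Ω; ℝ^N)` with `u = 0` on `{y = 0}` and `div u = 0`, realised as the set of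
pairs `(u, ∇u)`; its norm `(‖u‖² + ‖∇u‖²)^{1/2}` is the standard norm of `H¹`. -/
def Solenoidal (d : ℕ) (ℓ : ℝ) : Submodule ℝ (WithLp 2 (VelocityL2 d ℓ × GradientL2 d ℓ)) where
  carrier := {v | IsWeakGradient ℓ v.fst v.snd ∧
    (∀ j, HasBottomTrace ℓ (fun p => v.fst p j) (fun p => v.snd p (Fin.last d, j)) 0) ∧
    ∀ᵐ p ∂slabMeasure d ℓ, ∑ i, v.snd p (i, i) = 0}
  zero_mem' := by
    have h1 := Lp.coeFn_zero (EuclideanSpace ℝ (Fin (d + 1))) 2 (slabMeasure d ℓ)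
    have h2 := Lp.coeFn_zero (EuclideanSpace ℝ (Fin (d + 1) × Fin (d + 1))) 2 (slabMeasure d ℓ)
    have e1 : ∀ j (ψ : UnitAddTorus (Fin d) × ℝ → ℝ),
        ∫ p, (0 : VelocityL2 d ℓ) p j * ψ p ∂slabMeasure d ℓ = 0 := fun j ψ =>
      integral_eq_zero_of_ae (by filter_upwards [h1] with p hp; rw [hp]; simp)
    have e2 : ∀ j (ψ : UnitAddTorus (Fin d) × ℝ → ℝ),
        ∫ p, (0 : GradientL2 d ℓ) p j * ψ p ∂slabMeasure d ℓ = 0 := fun j ψ =>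
      integral_eq_zero_of_ae (by filter_upwards [h2] with p hp; rw [hp]; simp)
    refine ⟨fun φ _ _ i j => ?_, fun j φ _ _ => ?_, ?_⟩
    · simp only [WithLp.zero_fst, WithLp.zero_snd, e1, e2, neg_zero]
    · simp only [WithLp.zero_fst, WithLp.zero_snd, e1, e2]
      simp
    · filter_upwards [h2] with p hp
      rw [WithLp.zero_snd, hp]
      simp
  add_mem' := by
    rintro v w ⟨hv1, hv2, hv3⟩ ⟨hw1, hw2, hw3⟩
    refine ⟨fun φ hφ hs i j => ?_, fun j φ hφ h0 => ?_, ?_⟩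
    · rw [WithLp.add_fst, WithLp.add_snd, integral_coord_add _ _ _ (hφ.pd i).continuous,
        integral_coord_add _ _ _ hφ.continuous, hv1 φ hφ hs i j, hw1 φ hφ hs i j]
      ring
    · have a := hv2 j φ hφ h0
      have b := hw2 j φ hφ h0
      rw [WithLp.add_fst, WithLp.add_snd, integral_coord_add _ _ _ (hφ.pd _).continuous,
        integral_coord_add _ _ _ hφ.continuous]
      simp only [Pi.zero_apply, zero_mul, integral_zero, neg_zero] at a b ⊢
      linarith
    · filter_upwards [hv3, hw3, Lp.coeFn_add v.snd w.snd] with p h1 h2 h3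
      rw [WithLp.add_snd, h3]
      simp only [Pi.add_apply, PiLp.add_apply, Finset.sum_add_distrib, h1, h2, add_zero]
  smul_mem' := by
    rintro c v ⟨hv1, hv2, hv3⟩
    refine ⟨fun φ hφ hs i j => ?_, fun j φ hφ h0 => ?_, ?_⟩
    · rw [WithLp.smul_fst, WithLp.smul_snd, integral_coord_smul, integral_coord_smul,
        hv1 φ hφ hs i j]
      ring
    · have a := hv2 j φ hφ h0
      rw [WithLp.smul_fst, WithLp.smul_snd, integral_coord_smul, integral_coord_smul]
      simp only [Pi.zero_apply, zero_mul, integral_zero, neg_zero] at a ⊢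
      rw [← mul_add, a, mul_zero]
    · filter_upwards [hv3, Lp.coeFn_smul c v.snd] with p h1 h3
      rw [WithLp.smul_snd, h3]
      simp only [Pi.smul_apply, PiLp.smul_apply, smul_eq_mul, ← Finset.mul_sum, h1, mul_zero]

/-- The velocity field underlying an element of the solenoidal space. -/
def velocity {d : ℕ} {ℓ : ℝ} (v : Solenoidal d ℓ) : VelocityL2 d ℓ := v.1.fst

/-- The gradient of an element of the solenoidal space. -/
def velocityGradient {d : ℕ} {ℓ : ℝ} (v : Solenoidal d ℓ) : GradientL2 d ℓ := v.1.snd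

/-- `g` is the trace on `{y = ℓ}` of the vertical component `v_N`. -/
def IsTopNormalTrace {d : ℕ} {ℓ : ℝ} (v : Solenoidal d ℓ) (g : SurfaceL2 d) : Prop :=
  HasTopTrace ℓ (fun p => velocity v p (Fin.last d))
    (fun p => velocityGradient v p (Fin.last d, Fin.last d)) g

/-- The `L²(Ω)` inner product `(𝔻u, 𝔻v)` of symmetrised gradients,
`(𝔻u)ᵢⱼ = ∂ᵢ uⱼ + ∂ⱼ uᵢ`. -/
def symGradInner {d : ℕ} {ℓ : ℝ} (u v : Solenoidal d ℓ) : ℝ :=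
  ∫ p, ∑ i, ∑ j, (velocityGradient u p (i, j) + velocityGradient u p (j, i)) * (velocityGradient v p (i, j) + velocityGradient v p (j, i))
    ∂slabMeasure d ℓ

/-! ### Fourier multipliers, Sobolev spaces and the energy -/

/-- Fourier coefficients of a real function on the torus. -/
def surfaceCoeff {d : ℕ} (f : UnitAddTorus (Fin d) → ℝ) (ξ : Fin d → ℤ) : ℂ :=
  UnitAddTorus.mFourierCoeff (fun x => (f x : ℂ)) ξ

/-- Euclidean length `|ξ|` of a frequency. -/
def freqNorm {d : ℕ} (ξ : Fin d → ℤ) : ℝ := √(∑ i, (ξ i : ℝ) ^ 2)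

/-- The symbol `μ(ξ) = g + σ (2π|ξ|)^{2r}`. -/
def symbol {d : ℕ} (g σ r : ℝ) (ξ : Fin d → ℤ) : ℝ :=
  g + σ * (2 * Real.pi * freqNorm ξ) ^ (2 * r)

/-- `m = M(h)`, where `M` is the Fourier multiplication operator with symbol `μ`. -/
def IsMultiplier {d : ℕ} (μ : (Fin d → ℤ) → ℝ) (h m : SurfaceL2 d) : Prop :=
  ∀ ξ, surfaceCoeff m ξ = μ ξ * surfaceCoeff h ξ

/-- `‖f‖²` in `H^s(Σ)`, infinite if `f ∉ H^s(Σ)`. -/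
def sobolevSq {d : ℕ} (s : ℝ) (f : SurfaceL2 d) : ℝ≥0∞ :=
  ∑' ξ, ENNReal.ofReal ((1 + freqNorm ξ ^ 2) ^ s * ‖surfaceCoeff f ξ‖ ^ 2)

/-- The total energy `½ ∫_Ω |u|² + ½ ∫_Σ M(h) h`.  The second term is the duality pairing, computed
on the Fourier side as `½ ∑ μ(ξ) |ĥ(ξ)|²`. -/
def energy {d : ℕ} {ℓ : ℝ} (μ : (Fin d → ℤ) → ℝ) (u : VelocityL2 d ℓ) (h : SurfaceL2 d) : ℝ≥0∞ :=
  (1 / 2) * (∫⁻ p, ENNReal.ofReal (‖u p‖ ^ 2) ∂slabMeasure d ℓ) +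
    (1 / 2) * ∑' ξ, ENNReal.ofReal (μ ξ * ‖surfaceCoeff h ξ‖ ^ 2)

/-- If `M(h) ∈ L²(Σ)`, the surface term of `energy` is the integral `∫_Σ M(h) h`. -/
theorem surface_energy_eq {d : ℕ} {μ : (Fin d → ℤ) → ℝ} (hμ : ∀ ξ, 0 ≤ μ ξ) {h m : SurfaceL2 d}
    (hm : IsMultiplier μ h m) :
    ∑' ξ, ENNReal.ofReal (μ ξ * ‖surfaceCoeff h ξ‖ ^ 2) =
      ENNReal.ofReal (∫ x, m x * h x ∂torusMeasure d) := by
  have hc : ∀ f : SurfaceL2 d, MemLp (fun x => (f x : ℂ)) 2 (torusMeasure d) := fun f =>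
    (Lp.memLp f).ofReal
  let c : SurfaceL2 d → Lp ℂ 2 (torusMeasure d) := fun f => (hc f).toLp _
  have hcoe : ∀ f, c f =ᵐ[torusMeasure d] fun x => (f x : ℂ) := fun f => (hc f).coeFn_toLp
  have hco : ∀ f ξ, UnitAddTorus.mFourierCoeff (c f) ξ = surfaceCoeff f ξ := fun f ξ =>
    integral_congr_ae (by
      filter_upwards [hcoe f] with x hx
      rw [hx])
  have key := UnitAddTorus.hasSum_prod_mFourierCoeff (c h) (c m)
  have e : ∫ x, (starRingEnd ℂ) (c h x) * c m x ∂torusMeasure d =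
      ((∫ x, m x * h x ∂torusMeasure d : ℝ) : ℂ) := by
    rw [← integral_complex_ofReal]
    refine integral_congr_ae ?_
    filter_upwards [hcoe h, hcoe m] with x h1 h2
    rw [h1, h2, Complex.conj_ofReal]
    push_cast
    ring
  have key2 : HasSum (fun ξ => ((μ ξ * ‖surfaceCoeff h ξ‖ ^ 2 : ℝ) : ℂ))
      ((∫ x, m x * h x ∂torusMeasure d : ℝ) : ℂ) := by
    rw [← e]
    refine key.congr_fun fun ξ => ?_
    rw [hco, hco, hm ξ]
    push_cast
    rw [← Complex.conj_mul']
    ring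
  have key3 := Complex.hasSum_ofReal.1 key2
  rw [← key3.tsum_eq, ENNReal.ofReal_tsum_of_nonneg _ key3.summable]
  intro ξ
  have := hμ ξ
  positivity

/-! ### Time-dependent functions and weak solutions -/

/-- `f ∈ L²_loc([0, ∞); X)`. -/
def L2Loc {X : Type} [NormedAddCommGroup X] (f : ℝ → X) : Prop :=
  ∀ T > 0, MemLp f 2 (volume.restrict (Ioo 0 T))

/-- Test functions of time: smooth with compact support in `(0, ∞)`. -/
def IsTimeTest (η : ℝ → ℝ) : Prop :=
  ContDiff ℝ ∞ η ∧ HasCompactSupport η ∧ tsupport η ⊆ Ioi 0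

/-- `w = ∂ₜ u` in the weak sense, where `u` takes values in the solenoidal space, `w` in its dual,
and the former is embedded in the latter by the `L²(Ω)` inner product. -/
def IsWeakTimeDerivDual {d : ℕ} {ℓ : ℝ} (u : ℝ → Solenoidal d ℓ)
    (w : ℝ → StrongDual ℝ (Solenoidal d ℓ)) : Prop :=
  ∀ η, IsTimeTest η → ∀ v : Solenoidal d ℓ,
    ∫ t in Ioi 0, deriv η t * inner ℝ (velocity (u t)) (velocity v) = -∫ t in Ioi 0, η t * w t v

/-- `k = ∂ₜ h` in the weak sense, for functions with values in `L²(Σ)`. -/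
def IsWeakTimeDeriv {d : ℕ} (h k : ℝ → SurfaceL2 d) : Prop :=
  ∀ η, IsTimeTest η → ∫ t in Ioi 0, deriv η t • h t = -∫ t in Ioi 0, η t • k t

/-- `f(t) → a` as `t → 0⁺` up to a null set of times; for the class of a curve that has a continuous
representative on `[0, ∞)` this says that the representative equals `a` at `t = 0`. -/
def HasInitialValue {X : Type} [TopologicalSpace X] (f : ℝ → X) (a : X) : Prop :=
  Tendsto f (𝓝[>] 0 ⊓ ae volume) (𝓝 a)

/-- `(u, h)` is a weak solution on `Ω = (ℝ/ℤ)^d × (0, ℓ)` with data `(u₀, h₀)`.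
Incompressibility and the no-slip condition are part of `u(t) ∈ Solenoidal d ℓ`. -/
def IsWeakSolution {d : ℕ} {ℓ : ℝ} (μ : (Fin d → ℤ) → ℝ) (u : ℝ → Solenoidal d ℓ)
    (h : ℝ → SurfaceL2 d) (u₀ : VelocityL2 d ℓ) (h₀ : SurfaceL2 d) : Prop :=
  L2Loc u ∧ L2Loc h ∧
  ∃ (w : ℝ → StrongDual ℝ (Solenoidal d ℓ)) (m k : ℝ → SurfaceL2 d),
    -- `w = ∂ₜ u` belongs to `L²_loc` with values in the dual space
    L2Loc w ∧ IsWeakTimeDerivDual u w ∧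
    -- `m = M(h)` belongs to `L²_loc` with values in `L²(Σ)`
    L2Loc m ∧ (∀ᵐ t ∂volume.restrict (Ioi 0), IsMultiplier μ (h t) (m t)) ∧
    -- `k = ∂ₜ h` belongs to `L²_loc` with values in `H^{1/2}(Σ)`
    L2Loc k ∧ (∀ T > 0, ∫⁻ t in Ioo 0 T, sobolevSq (1 / 2) (k t) < ⊤) ∧ IsWeakTimeDeriv h k ∧
    -- the weak form of the momentum equation, for all `v ∈ L²(0, T; Solenoidal d ℓ)`;
    -- `τ` is the trace of `v_N` on the top
    (∀ T > 0, ∀ v : ℝ → Solenoidal d ℓ, MemLp v 2 (volume.restrict (Ioo 0 T)) →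
      ∀ τ : ℝ → SurfaceL2 d,
        (∀ᵐ t ∂volume.restrict (Ioo 0 T), IsTopNormalTrace (v t) (τ t)) →
        ∀ᵐ t ∂volume.restrict (Ioo 0 T),
          w t (v t) + (1 / 2) * symGradInner (u t) (v t) +
            ∫ x, m t x * τ t x ∂torusMeasure d = 0) ∧
    -- `∂ₜ h = u_N` on the top
    (∀ᵐ t ∂volume.restrict (Ioi 0), IsTopNormalTrace (u t) (k t)) ∧
    -- the surface function has zero average
    (∀ᵐ t ∂volume.restrict (Ioi 0), ∫ x, h t x ∂torusMeasure d = 0) ∧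
    -- initial conditions
    HasInitialValue (fun t => velocity (u t)) u₀ ∧ HasInitialValue h h₀

end ViscousSlab

end

/-! Testing the momentum equation with `u` and using `∂ₜh = u_N` gives `E' = -½‖𝔻u‖²`: the boundary
work `∫ M(h) u_N` cancels the rate of change of the surface energy. The dissipation controls the
kinetic energy (Korn, `norm_velocity_sq_le`) and the trace of `u_N` (`norm_topTrace_sq_le`), but it
does not see `h`. The surface energy is recovered by a second test field, a solenoidal lift `B h`
whose vertical component on the top is `h`. Such a lift exists because `h` has zero average. It
gives `d/dt (u, B h) = (u, B ∂ₜh) - ½ (𝔻u, 𝔻 B h) - ∫ M(h) h`. Since `B` is bounded from `L²(Σ)` to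
`L²(Ω)`, the first term is at most a multiple of `‖𝔻u‖²`. Since `‖𝔻 B h‖²` costs one horizontal half
derivative of `h` squared, and `μ(ξ)` dominates `|ξ|` when `r ≥ ½`, the second term is absorbed by
the dissipation and half of `∫ M(h) h` (`IsDecayFrame.cross_le`). The cross term itself is bounded
by the energy. Integration in time yields `∫ₛᵗ E ≤ C E(s)`, and for a nonincreasing `E` this forces
exponential decay (`exp_decay_of_antitone`).

Two points need care at this regularity. The derivative `∂ₜu` lives only in the dual space, so
continuity into `L²` and the energy identity are obtained through forward Steklov averages
(`exists_continuousOn_energy_identity`). The surface terms are treated mode by mode: each real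
Fourier coefficient of `h` is absolutely continuous, the surface energy is summed by Parseval
(`hasSum_surface`), and the cross term is used only for finitely many modes, with bounds independent
of the truncation.

The argument is carried out for an abstract frame (`IsDecayFrame`, `IsEvolution`,
`IsEvolution.decay`). The slab enters through explicit lifts with profile `(y/ℓ)ⁿ`, `n` comparable
to `|2πξ|`, and through Korn and trace inequalities proved on the horizontal Fourier side. -/

noncomputable section

namespace ViscousSlab

/-! ### Primitives of integrable curves -/

section Primitives

variable {E F G : Type*} [NormedAddCommGroup E] [NormedSpace ℝ E]
  [NormedAddCommGroup F] [NormedSpace ℝ F]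
  [NormedAddCommGroup G] [NormedSpace ℝ G]

/-- `f` is a primitive of the integrable curve `p` on `[s, t]`. -/
structure IsPrimitiveOn (f p : ℝ → E) (s t : ℝ) : Prop where
  integrable : IntervalIntegrable p volume s t
  eq_add : ∀ x ∈ Icc s t, f x = f s + ∫ y in s..x, p y

theorem IsPrimitiveOn.continuousOn {f p : ℝ → E} {s t : ℝ} (hst : s ≤ t)
    (h : IsPrimitiveOn f p s t) : ContinuousOn f (Icc s t) := by
  have h1 := intervalIntegral.continuousOn_primitive_interval' h.integrable left_mem_uIcc
  rw [uIcc_of_le hst] at h1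
  exact (continuousOn_const.add h1).congr h.eq_add

theorem intervalIntegrable_bilin_left (b : E →L[ℝ] F →L[ℝ] G) {p : ℝ → E} {g : ℝ → F} {s t : ℝ}
    (hst : s ≤ t) (hp : IntervalIntegrable p volume s t) (hg : ContinuousOn g (Icc s t)) :
    IntervalIntegrable (fun x => b (p x) (g x)) volume s t := by
  obtain ⟨C, hC⟩ := isCompact_Icc.exists_bound_of_continuousOn hg
  rw [intervalIntegrable_iff_integrableOn_Ioc_of_le hst] at hp ⊢
  have hg' := (hg.mono Ioc_subset_Icc_self).aestronglyMeasurable (μ := volume) measurableSet_Ioc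
  refine Integrable.mono' (hp.norm.const_mul (‖b‖ * C)) ?_ ?_
  · exact (ContinuousLinearMap.aestronglyMeasurable_comp₂ b hp.aestronglyMeasurable hg')
  · filter_upwards [ae_restrict_mem measurableSet_Ioc] with x hx
    calc ‖b (p x) (g x)‖ ≤ ‖b‖ * ‖p x‖ * ‖g x‖ := b.le_opNorm₂ _ _
      _ ≤ ‖b‖ * ‖p x‖ * C := by gcongr; exact hC x (Ioc_subset_Icc_self hx)
      _ = _ := by ring

variable [CompleteSpace E] [CompleteSpace F] [CompleteSpace G]

/-- Both sides are iterated integrals of `b (p x) (q y)` over the triangle `x < y` in the square, so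
this is Fubini. -/
theorem integral_bilin_primitive_swap (b : E →L[ℝ] F →L[ℝ] G) {p : ℝ → E} {q : ℝ → F} {s t : ℝ}
    (hst : s ≤ t) (hp : IntervalIntegrable p volume s t) (hq : IntervalIntegrable q volume s t) :
    ∫ x in s..t, b (p x) (∫ y in x..t, q y) = ∫ y in s..t, b (∫ x in s..y, p x) (q y) := by
  rw [intervalIntegrable_iff_integrableOn_Ioc_of_le hst] at hp hq
  have h1 : Integrable (fun z : ℝ × ℝ => b (p z.1) (q z.2))
      ((volume.restrict (Ioc s t)).prod (volume.restrict (Ioc s t))) :=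
    hp.op_fst_snd (op := fun x y => b x y) (by fun_prop) ⟨‖b‖, b.le_opNorm₂⟩ hq
  have hm : MeasurableSet {z : ℝ × ℝ | z.1 < z.2} := measurableSet_lt measurable_fst measurable_snd
  have h2 := h1.indicator hm
  have h3 := integral_integral_swap (f := fun x y => indicator {z : ℝ × ℝ | z.1 < z.2}
    (fun z : ℝ × ℝ => b (p z.1) (q z.2)) (x, y)) h2
  rw [intervalIntegral.integral_of_le hst, intervalIntegral.integral_of_le hst]
  refine Eq.trans ?_ (h3.trans ?_)
  · refine setIntegral_congr_fun measurableSet_Ioc fun x hx => ?_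
    have e : (fun y => indicator {z : ℝ × ℝ | z.1 < z.2} (fun z : ℝ × ℝ => b (p z.1) (q z.2)) (x, y))
        = indicator (Ioi x) fun y => b (p x) (q y) := by
      ext y; simp [indicator_apply]
    simp only [e]
    rw [integral_indicator measurableSet_Ioi, Measure.restrict_restrict measurableSet_Ioi,
      intervalIntegral.integral_of_le hx.2]
    have e2 : Ioi x ∩ Ioc s t = Ioc x t := by
      ext y; simp only [mem_inter_iff, mem_Ioi, mem_Ioc]; exact ⟨fun h => ⟨h.1, h.2.2⟩,
        fun h => ⟨h.1, hx.1.trans h.1, h.2⟩⟩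
    rw [e2, ContinuousLinearMap.integral_comp_comm]
    exact hq.mono_set (Ioc_subset_Ioc_left hx.1.le)
  · refine setIntegral_congr_fun measurableSet_Ioc fun y hy => ?_
    have e : (fun x => indicator {z : ℝ × ℝ | z.1 < z.2} (fun z : ℝ × ℝ => b (p z.1) (q z.2)) (x, y))
        = indicator (Iio y) fun x => b.flip (q y) (p x) := by
      ext x; simp [indicator_apply]
    simp only [e]
    rw [integral_indicator measurableSet_Iio, Measure.restrict_restrict measurableSet_Iio,
      intervalIntegral.integral_of_le hy.1.le, integral_Ioc_eq_integral_Ioo]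
    have e2 : Iio y ∩ Ioc s t = Ioo s y := by
      ext x; simp only [mem_inter_iff, mem_Iio, mem_Ioc, mem_Ioo]; exact ⟨fun h => ⟨h.2.1, h.1⟩,
        fun h => ⟨h.2, h.1, h.2.le.trans hy.2⟩⟩
    rw [e2, ContinuousLinearMap.integral_comp_comm, ContinuousLinearMap.flip_apply]
    exact hp.mono_set (Ioo_subset_Ioc_self.trans (Ioc_subset_Ioc_right hy.2))

/-- The product rule for absolutely continuous curves, for a general bilinear map so that it serves
scalar weights, the pairing `gram`, and products of real coefficients alike. -/
theorem IsPrimitiveOn.bilin (b : E →L[ℝ] F →L[ℝ] G) {f p : ℝ → E} {g q : ℝ → F} {s t : ℝ}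
    (hst : s ≤ t) (hf : IsPrimitiveOn f p s t) (hg : IsPrimitiveOn g q s t) :
    b (f t) (g t) = b (f s) (g s) + ∫ x in s..t, (b (p x) (g x) + b (f x) (q x)) := by
  have hp := hf.integrable
  have hq := hg.integrable
  have hfc := hf.continuousOn hst
  have hgc := hg.continuousOn hst
  have hQ : ContinuousOn (fun x => ∫ y in x..t, q y) (Icc s t) := by
    have h1 := intervalIntegral.continuousOn_primitive_interval' hq right_mem_uIcc
    rw [uIcc_of_le hst] at h1
    refine h1.neg.congr fun x _ => ?_
    exact intervalIntegral.integral_symm _ _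
  have hi1 := intervalIntegrable_bilin_left b hst hp hgc
  have hi2 : IntervalIntegrable (fun x => b (f x) (q x)) volume s t :=
    intervalIntegrable_bilin_left b.flip hst hq hfc
  rw [intervalIntegral.integral_add hi1 hi2]
  -- Here `g` is expanded backwards from `t`, and in `e2` `f` is expanded forwards from `s`; the two
  -- double integrals left over are then exactly those identified by Fubini.
  have e1 : ∫ x in s..t, b (p x) (g x) =
      b (∫ x in s..t, p x) (g t) - ∫ x in s..t, b (p x) (∫ y in x..t, q y) := by
    rw [show b (∫ x in s..t, p x) (g t) = ∫ x in s..t, b (p x) (g t) from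
      ((b.flip (g t)).intervalIntegral_comp_comm hp).symm,
      ← intervalIntegral.integral_sub]
    · refine intervalIntegral.integral_congr fun x hx => ?_
      rw [uIcc_of_le hst] at hx
      have : IntervalIntegrable q volume s x :=
        hq.mono_set (by rw [uIcc_of_le hst, uIcc_of_le hx.1]; exact Icc_subset_Icc_right hx.2)
      have h2 : IntervalIntegrable q volume x t :=
        hq.mono_set (by rw [uIcc_of_le hst, uIcc_of_le hx.2]; exact Icc_subset_Icc_left hx.1)
      rw [← map_sub, hg.eq_add t ⟨hst, le_rfl⟩, hg.eq_add x hx,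
        ← intervalIntegral.integral_add_adjacent_intervals this h2]
      congr 1; abel
    · exact intervalIntegrable_bilin_left b hst hp continuousOn_const
    · exact intervalIntegrable_bilin_left b hst hp hQ
  have e2 : ∫ x in s..t, b (f x) (q x) =
      b (f s) (∫ x in s..t, q x) + ∫ y in s..t, b (∫ x in s..y, p x) (q y) := by
    rw [← (b (f s)).intervalIntegral_comp_comm hq, ← intervalIntegral.integral_add]
    · refine intervalIntegral.integral_congr fun x hx => ?_
      rw [uIcc_of_le hst] at hx
      rw [hf.eq_add x hx]; simp
    · exact intervalIntegrable_bilin_left b.flip hst hq continuousOn_const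
    · have h1 := intervalIntegral.continuousOn_primitive_interval' hp left_mem_uIcc
      rw [uIcc_of_le hst] at h1
      exact intervalIntegrable_bilin_left b.flip hst hq h1
  rw [e1, e2, integral_bilin_primitive_swap b hst hp hq]
  conv_lhs => rw [hf.eq_add t ⟨hst, le_rfl⟩]
  rw [map_add, add_apply]
  conv_lhs => rw [hg.eq_add t ⟨hst, le_rfl⟩]
  conv_rhs => rw [hg.eq_add t ⟨hst, le_rfl⟩]
  simp only [map_add]
  abel

end Primitives

/-! ### Weak derivatives of curves on the half line -/

section WeakDerivative

theorem deriv_integral_of_contDiff {ζ : ℝ → ℝ} (hζ : ContDiff ℝ ∞ ζ) (a : ℝ) :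
    deriv (fun t => ∫ s in a..t, ζ s) = ζ :=
  funext fun t => hζ.continuous.deriv_integral ζ a t

theorem contDiff_integral {ζ : ℝ → ℝ} (hζ : ContDiff ℝ ∞ ζ) (a : ℝ) :
    ContDiff ℝ ∞ (fun t => ∫ s in a..t, ζ s) := by
  rw [contDiff_infty_iff_deriv, deriv_integral_of_contDiff hζ]
  exact ⟨fun t => (hζ.continuous.integral_hasStrictDerivAt a t).hasDerivAt.differentiableAt, hζ⟩

theorem exists_tsupport_subset_Ioo {η : ℝ → ℝ} (hη : IsTimeTest η) :
    ∃ a b, 0 < a ∧ a < b ∧ tsupport η ⊆ Icc a b := by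
  obtain ⟨-, hc, hs⟩ := hη
  rcases (tsupport η).eq_empty_or_nonempty with h | h
  · exact ⟨1, 2, one_pos, one_lt_two, by simp [h]⟩
  · obtain ⟨a, ha, ha'⟩ := hc.isCompact.exists_isLeast h
    obtain ⟨b, hb, hb'⟩ := hc.isCompact.exists_isGreatest h
    exact ⟨a, b + 1, hs ha, by linarith [ha' hb], fun x hx => ⟨ha' hx, by linarith [hb' hx]⟩⟩

theorem exists_isTimeTest_integral_eq_one : ∃ ζ : ℝ → ℝ, IsTimeTest ζ ∧ ∫ t, ζ t = 1 := by
  let φ : ContDiffBump (1 : ℝ) := ⟨1 / 4, 1 / 2, by norm_num, by norm_num⟩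
  refine ⟨φ.normed volume, ⟨φ.contDiff_normed, φ.hasCompactSupport_normed, ?_⟩, φ.integral_normed⟩
  rw [φ.tsupport_normed_eq]
  intro x hx
  rw [Metric.mem_closedBall, Real.dist_eq] at hx
  have h2 : |x - 1| ≤ 1 / 2 := hx
  rw [abs_le] at h2
  rw [mem_Ioi]
  linarith

/-- Before the support of `ζ` the primitive is zero because it starts at `0`; after it, because the
mean vanishes. Hence test functions of mean zero are the derivatives of test functions. -/
theorem IsTimeTest.integral_of_integral_eq_zero {ζ : ℝ → ℝ} (hζ : IsTimeTest ζ)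
    (h0 : ∫ t, ζ t = 0) : IsTimeTest (fun t => ∫ s in (0 : ℝ)..t, ζ s) := by
  obtain ⟨a, b, ha, hab, hs⟩ := exists_tsupport_subset_Ioo hζ
  have hz : ∀ x, x ∉ Icc a b → ζ x = 0 := fun x hx =>
    image_eq_zero_of_notMem_tsupport fun h => hx (hs h)
  have hsub : tsupport (fun t => ∫ s in (0 : ℝ)..t, ζ s) ⊆ Icc a b := by
    refine closure_minimal ?_ isClosed_Icc
    intro t ht
    by_contra hn
    apply ht
    simp only [mem_Icc, not_and_or, not_le] at hn
    rcases hn with hn | hn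
    · refine intervalIntegral.integral_zero_ae (Eventually.of_forall fun s hs => hz s fun h => ?_)
      rw [mem_uIoc] at hs
      rcases hs with hs | hs <;> linarith [h.1]
    · simp only
      rw [intervalIntegral.integral_of_le (by linarith), ← h0]
      refine setIntegral_eq_integral_of_forall_compl_eq_zero fun s hs => hz s fun h => hs ?_
      exact ⟨by linarith [h.1], by linarith [h.2]⟩
  exact ⟨contDiff_integral hζ.1 0, isCompact_Icc.of_isClosed_subset (isClosed_tsupport _) hsub,
    hsub.trans fun x hx => lt_of_lt_of_le ha hx.1⟩

theorem IsTimeTest.sub_const_mul {ζ ξ : ℝ → ℝ} (hζ : IsTimeTest ζ) (hξ : IsTimeTest ξ) (a : ℝ) :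
    IsTimeTest (fun t => ζ t - a * ξ t) := by
  have h : tsupport (fun t => ζ t - a * ξ t) ⊆ tsupport ζ ∪ tsupport ξ := by
    refine closure_minimal ?_ ((isClosed_tsupport _).union (isClosed_tsupport _))
    intro t ht
    by_contra hn
    rw [mem_union, not_or] at hn
    apply ht
    simp only [image_eq_zero_of_notMem_tsupport hn.1, image_eq_zero_of_notMem_tsupport hn.2]
    ring
  exact ⟨hζ.1.sub (contDiff_const.mul hξ.1), (hζ.2.1.isCompact.union
    hξ.2.1.isCompact).of_isClosed_subset (isClosed_tsupport _) h,
    h.trans (union_subset hζ.2.2 hξ.2.2)⟩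

variable {E : Type*} [NormedAddCommGroup E]

/-- Integrability on bounded subintervals of the half line. -/
def LocInt (f : ℝ → E) : Prop := ∀ T > 0, IntegrableOn f (Ioo 0 T)

theorem LocInt.intervalIntegrable {f : ℝ → E} (hf : LocInt f) {s t : ℝ} (hs : 0 ≤ s)
    (ht : 0 ≤ t) : IntervalIntegrable f volume s t := by
  have h : IntegrableOn f (Ioc 0 (max s t)) := by
    rw [integrableOn_Ioc_iff_integrableOn_Ioo]
    rcases le_or_gt (max s t) 0 with h | h
    · rw [Ioo_eq_empty (not_lt.2 h)]; exact integrableOn_empty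
    · exact hf _ h
  rw [intervalIntegrable_iff]
  refine h.mono_set ?_
  rw [uIoc]
  exact Ioc_subset_Ioc_left (le_min hs ht)

variable [NormedSpace ℝ E]

theorem integrableOn_smul_of_tsupport {f : ℝ → E} (hf : LocInt f) {η : ℝ → ℝ} (hη : Continuous η)
    (hc : HasCompactSupport η) : IntegrableOn (fun t => η t • f t) (Ioi 0) := by
  obtain ⟨M, hM⟩ := hc.isCompact.isBounded.subset_closedBall 0
  have hz : ∀ x, x ∉ Ioo 0 (|M| + 1) → 0 < x → η x = 0 := fun x hx hx0 =>
    image_eq_zero_of_notMem_tsupport fun h => hx ⟨hx0, by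
      have := hM h
      rw [mem_closedBall_zero_iff, Real.norm_eq_abs, abs_of_pos hx0] at this
      linarith [le_abs_self M]⟩
  obtain ⟨C, hC⟩ := hη.bounded_above_of_compact_support hc
  have h1 : IntegrableOn (fun t => η t • f t) (Ioo 0 (|M| + 1)) :=
    Integrable.bdd_smul (hf (|M| + 1) (by positivity)) C hη.aestronglyMeasurable
      (Eventually.of_forall hC)
  refine (h1.of_forall_sdiff_eq_zero (t := Ioi 0) measurableSet_Ioi fun x hx => ?_)
  rw [hz x hx.2 hx.1, zero_smul]

theorem IsTimeTest.deriv {η : ℝ → ℝ} (hη : IsTimeTest η) : IsTimeTest (deriv η) :=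
  ⟨(contDiff_infty_iff_deriv.1 hη.1).2, hη.2.1.deriv,
    (closure_minimal support_deriv_subset (isClosed_tsupport η)).trans hη.2.2⟩

theorem LocInt.isPrimitiveOn {g : ℝ → E} (hg : LocInt g) (c : E) {s t : ℝ} (hs : 0 ≤ s)
    (hst : s ≤ t) : IsPrimitiveOn (fun x => c + ∫ y in (0 : ℝ)..x, g y) g s t := by
  refine ⟨hg.intervalIntegrable hs (hs.trans hst), fun x hx => ?_⟩
  rw [add_assoc, intervalIntegral.integral_add_adjacent_intervals
    (hg.intervalIntegrable le_rfl hs) (hg.intervalIntegrable hs (hs.trans hx.1))]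

variable [CompleteSpace E]

/-- The product rule on an interval at whose ends `η` vanishes. -/
theorem integral_deriv_smul_primitive {g : ℝ → E} (hg : LocInt g) {η : ℝ → ℝ}
    (hη : IsTimeTest η) :
    ∫ t in Ioi 0, deriv η t • (∫ s in (0 : ℝ)..t, g s) = -∫ t in Ioi 0, η t • g t := by
  obtain ⟨a, b, ha, hab, hs⟩ := exists_tsupport_subset_Ioo hη
  have hz : ∀ x, x ∉ Icc a b → η x = 0 := fun x hx =>
    image_eq_zero_of_notMem_tsupport fun h => hx (hs h)
  have hz' : ∀ x, x ∉ Icc a b → deriv η x = 0 := fun x hx =>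
    image_eq_zero_of_notMem_tsupport fun h =>
      hx (hs (closure_minimal support_deriv_subset (isClosed_tsupport η) h))
  -- The right end is `b + 1` because it lies outside `[a, b]`, where `η` is known to vanish.
  have hb : 0 ≤ b + 1 := by linarith
  have red : ∀ F : ℝ → E, (∀ x, x ∉ Icc a b → F x = 0) →
      ∫ t in Ioi 0, F t = ∫ t in (0 : ℝ)..(b + 1), F t := fun F hF => by
    rw [intervalIntegral.integral_of_le hb]
    refine (setIntegral_eq_of_subset_of_forall_sdiff_eq_zero measurableSet_Ioi
      (fun x hx => hx.1) fun x hx => hF x fun h => hx.2 ⟨hx.1, by linarith [h.2]⟩)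
  have hg0 := hg.isPrimitiveOn 0 le_rfl hb
  have hηp : IsPrimitiveOn η (deriv η) 0 (b + 1) := by
    have hd : Continuous (_root_.deriv η) := hη.deriv.1.continuous
    refine ⟨hd.intervalIntegrable _ _, fun x _ => ?_⟩
    rw [intervalIntegral.integral_deriv_eq_sub (fun y _ => (hη.1.differentiable (by simp)) y)
      (hd.intervalIntegrable _ _)]
    ring
  have key := hηp.bilin (ContinuousLinearMap.lsmul ℝ ℝ : ℝ →L[ℝ] E →L[ℝ] E) hb hg0
  simp only [ContinuousLinearMap.lsmul_apply, zero_add] at key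
  rw [hz 0 (fun h => by linarith [h.1]), hz (b + 1) (fun h => by linarith [h.2]), zero_smul,
    zero_smul, zero_add, intervalIntegral.integral_add] at key
  · rw [red _ fun x hx => by rw [hz' x hx, zero_smul], red _ fun x hx => by rw [hz x hx, zero_smul]]
    exact eq_neg_of_add_eq_zero_left key.symm
  · have := intervalIntegrable_bilin_left (ContinuousLinearMap.lsmul ℝ ℝ : ℝ →L[ℝ] E →L[ℝ] E)
      hb hηp.integrable (hg0.continuousOn hb)
    simpa using this
  · have := intervalIntegrable_bilin_left
      (ContinuousLinearMap.lsmul ℝ ℝ : ℝ →L[ℝ] E →L[ℝ] E).flip hb hg0.integrable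
      (hηp.continuousOn hb)
    simpa using this

/-- A curve with locally integrable weak derivative `g` is a primitive of `g` almost everywhere. -/
theorem exists_ae_eq_add_integral {f g : ℝ → E} (hf : LocInt f) (hg : LocInt g)
    (h : ∀ η, IsTimeTest η → ∫ t in Ioi 0, deriv η t • f t = -∫ t in Ioi 0, η t • g t) :
    ∃ c, ∀ᵐ t ∂volume.restrict (Ioi 0), f t = c + ∫ s in (0 : ℝ)..t, g s := by
  have hP : LocInt (fun t => ∫ s in (0 : ℝ)..t, g s) := fun T hT => by
    have := ((hg.isPrimitiveOn 0 le_rfl hT.le).continuousOn hT.le)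
    simp only [zero_add] at this
    exact (this.integrableOn_Icc).mono_set Ioo_subset_Icc_self
  -- The du Bois-Reymond argument: the remainder `R` has zero weak derivative, so it should be
  -- constant.
  set R : ℝ → E := fun t => f t - ∫ s in (0 : ℝ)..t, g s with hR
  have hRi : LocInt R := fun T hT => (hf T hT).sub (hP T hT)
  have h1 : ∀ η, IsTimeTest η → ∫ t in Ioi 0, deriv η t • R t = 0 := fun η hη => by
    simp only [hR, smul_sub]
    rw [integral_sub (integrableOn_smul_of_tsupport hf hη.deriv.1.continuous hη.deriv.2.1)
      (integrableOn_smul_of_tsupport hP hη.deriv.1.continuous hη.deriv.2.1), h η hη,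
      integral_deriv_smul_primitive hg hη, sub_self]
  obtain ⟨ζ₀, hζ₀, hI⟩ := exists_isTimeTest_integral_eq_one
  set c := ∫ t in Ioi 0, ζ₀ t • R t with hc
  refine ⟨c, ?_⟩
  have h2 : ∀ ζ, IsTimeTest ζ → ∫ t in Ioi 0, ζ t • R t = (∫ t, ζ t) • c := fun ζ hζ => by
    -- Removing the mean of `ζ` with the fixed bump `ζ₀` leaves a derivative of a test function,
    -- which `R` annihilates; so `R` acts on `ζ` as the constant `c` does.
    have h3 : IsTimeTest (fun t => ζ t - (∫ t, ζ t) * ζ₀ t) := hζ.sub_const_mul hζ₀ _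
    have i1 : Integrable ζ := hζ.1.continuous.integrable_of_hasCompactSupport hζ.2.1
    have i2 : Integrable ζ₀ := hζ₀.1.continuous.integrable_of_hasCompactSupport hζ₀.2.1
    have h4 : ∫ t, (ζ t - (∫ t, ζ t) * ζ₀ t) = 0 := by
      rw [integral_sub i1 (i2.const_mul _), integral_const_mul, hI, mul_one, sub_self]
    have i3 : IntegrableOn (fun t => (∫ t, ζ t) • ζ₀ t • R t) (Ioi 0) :=
      (integrableOn_smul_of_tsupport hRi hζ₀.1.continuous hζ₀.2.1).smul (∫ t, ζ t)
    have h5 := h1 _ (h3.integral_of_integral_eq_zero h4)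
    rw [deriv_integral_of_contDiff h3.1] at h5
    simp only [sub_smul, mul_smul] at h5
    rw [integral_sub (integrableOn_smul_of_tsupport hRi hζ.1.continuous hζ.2.1)
      i3, integral_smul] at h5
    exact sub_eq_zero.1 h5
  have h6 : ∀ᵐ t, t ∈ Ioi (0 : ℝ) → R t - c = 0 := by
    have hcI : LocInt (fun _ : ℝ => c) := fun T _ => integrableOn_const (by simp)
    refine isOpen_Ioi.ae_eq_zero_of_integral_contDiff_smul_eq_zero ?_ fun ζ hζ hcs hs => ?_
    · refine (locallyIntegrableOn_iff isOpen_Ioi.isLocallyClosed).2 fun K hK hKc => ?_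
      obtain ⟨M, hM⟩ := hKc.isBounded.subset_closedBall 0
      refine ((hRi (|M| + 1) (by positivity)).sub (hcI _ (by positivity))).mono_set fun x hx => ?_
      have := hM hx
      rw [mem_closedBall_zero_iff, Real.norm_eq_abs, abs_of_pos (hK hx)] at this
      exact ⟨hK hx, by linarith [le_abs_self M]⟩
    · have e : ∫ x, ζ x • (R x - c) = ∫ x in Ioi 0, ζ x • (R x - c) := by
        refine (setIntegral_eq_integral_of_forall_compl_eq_zero fun x hx => ?_).symm
        rw [image_eq_zero_of_notMem_tsupport fun h => hx (hs h), zero_smul]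
      have e2 : ∫ x in Ioi 0, ζ x = ∫ x, ζ x :=
        setIntegral_eq_integral_of_forall_compl_eq_zero fun x hx =>
          image_eq_zero_of_notMem_tsupport fun h => hx (hs h)
      rw [e]
      simp only [smul_sub]
      rw [integral_sub (integrableOn_smul_of_tsupport hRi hζ.continuous hcs)
        (integrableOn_smul_of_tsupport hcI hζ.continuous hcs), h2 ζ ⟨hζ, hcs, hs⟩,
        integral_smul_const, e2, sub_self]
  rw [ae_restrict_iff' measurableSet_Ioi]
  filter_upwards [h6] with t ht h0
  have := ht h0
  simp only [hR] at this
  rw [sub_eq_zero, sub_eq_iff_eq_add] at this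
  exact this

end WeakDerivative

/-! ### Steklov averages -/

section Steklov

variable {E : Type*} [NormedAddCommGroup E]

theorem sq_lintegral_le {α : Type*} [MeasurableSpace α] {μ : Measure α} {f : α → ℝ≥0∞}
    (hf : AEMeasurable f μ) : (∫⁻ x, f x ∂μ) ^ 2 ≤ μ univ * ∫⁻ x, f x ^ 2 ∂μ := by
  have h := ENNReal.lintegral_mul_le_Lp_mul_Lq μ Real.HolderConjugate.two_two
    (aemeasurable_const (b := (1 : ℝ≥0∞))) hf
  simp only [Pi.mul_apply, one_mul, lintegral_const, ENNReal.rpow_two, one_pow] at h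
  calc (∫⁻ x, f x ∂μ) ^ 2
      ≤ ((μ univ) ^ (1 / 2 : ℝ) * (∫⁻ x, f x ^ 2 ∂μ) ^ (1 / 2 : ℝ)) ^ 2 := by gcongr
    _ = μ univ * ∫⁻ x, f x ^ 2 ∂μ := by
      rw [mul_pow, ← ENNReal.rpow_two, ← ENNReal.rpow_two, ← ENNReal.rpow_mul,
        ← ENNReal.rpow_mul]
      norm_num

theorem eLpNorm_two_sq {α : Type*} [MeasurableSpace α] {μ : Measure α} (f : α → E) :
    eLpNorm f 2 μ ^ 2 = ∫⁻ x, ‖f x‖ₑ ^ 2 ∂μ := by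
  rw [eLpNorm_eq_lintegral_rpow_enorm_toReal (by norm_num) (by norm_num), ← ENNReal.rpow_two,
    ← ENNReal.rpow_mul]
  simp

/-- Continuity of translations in `L²`, from continuity of composition with measure preserving maps.
-/
theorem tendsto_eLpNorm_translate_sub {f : ℝ → E} (hf : MemLp f 2 volume) :
    Tendsto (fun s : ℝ => eLpNorm (fun t => f (t + s) - f t) 2 volume) (𝓝 0) (𝓝 0) := by
  have hmp : ∀ s : ℝ, MeasurePreserving (fun t : ℝ => t + s) volume volume := fun s =>
    measurePreserving_add_right volume s
  let g : ℝ → C(ℝ, ℝ) := fun s => ⟨fun t => t + s, by fun_prop⟩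
  have hg : Continuous g :=
    ContinuousMap.continuous_of_continuous_uncurry _ (by fun_prop : Continuous fun p : ℝ × ℝ => p.2 + p.1)
  have h1 : Continuous fun s => Lp.compMeasurePreserving (g s) (hmp s) hf.toLp :=
    Continuous.compMeasurePreservingLp continuous_const hg hmp (by simp)
  have h2 := (h1.tendsto 0).sub (tendsto_const_nhds (x := hf.toLp))
  have h0 : Lp.compMeasurePreserving (g 0) (hmp 0) hf.toLp = hf.toLp := by
    rw [Lp.toLp_compMeasurePreserving hf]
    congr 1
    ext t
    simp [g]
  rw [h0, sub_self] at h2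
  have h3 := (continuous_enorm.tendsto _).comp h2
  rw [enorm_zero] at h3
  refine h3.congr fun s => ?_
  rw [Function.comp_apply, Lp.toLp_compMeasurePreserving hf, ← MemLp.toLp_sub, Lp.enorm_toLp]
  rfl

variable [NormedSpace ℝ E]

theorem enorm_integral_sq_le {α : Type*} [MeasurableSpace α] {μ : Measure α} {f : α → E}
    (hf : AEStronglyMeasurable f μ) : ‖∫ x, f x ∂μ‖ₑ ^ 2 ≤ μ univ * ∫⁻ x, ‖f x‖ₑ ^ 2 ∂μ :=
  (pow_le_pow_left' (enorm_integral_le_lintegral_enorm f) 2).trans (sq_lintegral_le hf.enorm)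

/-- The forward average of `f` over an interval of length `h`. -/
def steklov (h : ℝ) (f : ℝ → E) (t : ℝ) : E := h⁻¹ • ∫ s in t..(t + h), f s

theorem steklov_congr_ae {f g : ℝ → E} (h : f =ᵐ[volume] g) (δ t : ℝ) :
    steklov δ f t = steklov δ g t := by
  rw [steklov, steklov, intervalIntegral.integral_congr_ae (h.mono fun x hx _ => hx)]

variable [CompleteSpace E]

/-- The error of averaging is the average over `s ∈ (0, h]` of the translation errors;
Cauchy–Schwarz in `s` and Tonelli transfer this to squared norms. -/
theorem eLpNorm_steklov_sub_sq_le {f : ℝ → E} (hf : MemLp f 2 volume) {h : ℝ} (hh : 0 < h) :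
    eLpNorm (fun t => steklov h f t - f t) 2 volume ^ 2 ≤
      ENNReal.ofReal h⁻¹ *
        ∫⁻ s in Ioc 0 h, eLpNorm (fun t => f (t + s) - f t) 2 volume ^ 2 := by
  -- A strongly measurable representative makes `(t, s) ↦ f (t + s) - f t` jointly measurable, as
  -- Tonelli requires.
  wlog hs : StronglyMeasurable f generalizing f
  · obtain ⟨g, hg, hfg⟩ := hf.1
    have hg2 : MemLp g 2 volume := hf.ae_eq hfg
    have e1 : (fun t => steklov h f t - f t) =ᵐ[volume] fun t => steklov h g t - g t := by
      filter_upwards [hfg] with t ht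
      rw [steklov_congr_ae hfg, ht]
    have e2 : ∀ s : ℝ, (fun t => f (t + s) - f t) =ᵐ[volume] fun t => g (t + s) - g t := fun s => by
      filter_upwards [hfg, (measurePreserving_add_right volume s).quasiMeasurePreserving.ae hfg]
        with t h1 h2
      rw [h1, h2]
    rw [eLpNorm_congr_ae e1]
    simp_rw [fun s => eLpNorm_congr_ae (p := 2) (e2 s)]
    exact this hg2 hg
  have hloc : ∀ a b : ℝ, IntervalIntegrable f volume a b := fun a b =>
    intervalIntegrable_iff.2
      (((hf.locallyIntegrable (by norm_num)).integrableOn_isCompact isCompact_uIcc).mono_set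
        uIoc_subset_uIcc)
  simp_rw [eLpNorm_two_sq]
  have hmeas : StronglyMeasurable (fun z : ℝ × ℝ => f (z.1 + z.2) - f z.1) :=
    (hs.comp_measurable (measurable_fst.add measurable_snd)).sub (hs.comp_measurable measurable_fst)
  rw [lintegral_lintegral_swap]
  swap
  · exact ((hmeas.comp_measurable measurable_swap).enorm.pow_const 2).aemeasurable
  rw [← lintegral_const_mul']
  swap
  · simp
  refine lintegral_mono fun t => ?_
  have e : steklov h f t - f t = h⁻¹ • ∫ s in Ioc 0 h, (f (t + s) - f t) := by
    rw [← intervalIntegral.integral_of_le hh.le, intervalIntegral.integral_sub,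
      intervalIntegral.integral_comp_add_left, smul_sub, intervalIntegral.integral_const, smul_smul]
    · simp [steklov, hh.ne']
    · have := (hloc t (t + h)).comp_add_left t
      simpa using this
    · exact intervalIntegrable_const
  rw [e, enorm_smul, mul_pow]
  have hm : AEStronglyMeasurable (fun s => f (t + s) - f t) (volume.restrict (Ioc 0 h)) :=
    ((hs.comp_measurable (measurable_const.add measurable_id)).sub
      stronglyMeasurable_const).aestronglyMeasurable
  calc ‖h⁻¹‖ₑ ^ 2 * ‖∫ s in Ioc 0 h, (f (t + s) - f t)‖ₑ ^ 2
      ≤ ‖h⁻¹‖ₑ ^ 2 * (volume.restrict (Ioc 0 h) univ * ∫⁻ s in Ioc 0 h, ‖f (t + s) - f t‖ₑ ^ 2) := by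
        gcongr; exact enorm_integral_sq_le hm
    _ = ENNReal.ofReal h⁻¹ * ∫⁻ s in Ioc 0 h, ‖f (t + s) - f t‖ₑ ^ 2 := by
      rw [← mul_assoc]
      congr 1
      rw [Real.enorm_of_nonneg (by positivity), ← ENNReal.ofReal_pow (by positivity)]
      simp only [Measure.restrict_apply, MeasurableSet.univ, univ_inter, Real.volume_Ioc, sub_zero]
      rw [← ENNReal.ofReal_mul (by positivity)]
      congr 1
      field_simp

theorem tendsto_eLpNorm_steklov_sub {f : ℝ → E} (hf : MemLp f 2 volume) :
    Tendsto (fun h : ℝ => eLpNorm (fun t => steklov h f t - f t) 2 volume) (𝓝[>] 0) (𝓝 0) := by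
  rw [ENNReal.tendsto_nhds_zero]
  intro ε hε
  have h1 := (ENNReal.tendsto_nhds_zero.1 (tendsto_eLpNorm_translate_sub hf)) ε hε
  obtain ⟨δ, hδ, h2⟩ := Metric.eventually_nhds_iff.1 h1
  filter_upwards [Ioo_mem_nhdsGT hδ] with h hh
  have h3 : eLpNorm (fun t => steklov h f t - f t) 2 volume ^ 2 ≤ ε ^ 2 := by
    refine (eLpNorm_steklov_sub_sq_le hf hh.1).trans ?_
    calc ENNReal.ofReal h⁻¹ * ∫⁻ s in Ioc 0 h, eLpNorm (fun t => f (t + s) - f t) 2 volume ^ 2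
        ≤ ENNReal.ofReal h⁻¹ * ∫⁻ s in Ioc 0 h, ε ^ 2 := by
          gcongr ENNReal.ofReal h⁻¹ * ?_
          refine setLIntegral_mono measurable_const fun s hs => ?_
          gcongr
          refine h2 ?_
          rw [Real.dist_eq, sub_zero, abs_of_pos hs.1]
          exact hs.2.trans_lt hh.2
      _ = ε ^ 2 := by
          rw [setLIntegral_const, Real.volume_Ioc, sub_zero, mul_comm (ε ^ 2), ← mul_assoc,
            ← ENNReal.ofReal_mul (inv_nonneg.2 hh.1.le), inv_mul_cancel₀ hh.1.ne',
            ENNReal.ofReal_one, one_mul]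
  exact (ENNReal.pow_le_pow_left_iff two_ne_zero).1 h3

end Steklov

/-! ### Absolute continuity of Steklov averages -/

section SteklovPrimitive

variable {E : Type*} [NormedAddCommGroup E]

theorem memLp_two_of_continuousOn {f : ℝ → E} {s t : ℝ} (hf : ContinuousOn f (Icc s t)) :
    MemLp f 2 (volume.restrict (Ioo s t)) := by
  obtain ⟨C, hC⟩ := isCompact_Icc.exists_bound_of_continuousOn hf
  refine MemLp.of_bound ((hf.mono Ioo_subset_Icc_self).aestronglyMeasurable measurableSet_Ioo) C ?_
  filter_upwards [ae_restrict_mem measurableSet_Ioo] with x hx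
  exact hC x (Ioo_subset_Icc_self hx)

theorem LocInt.translate_intervalIntegrable {u : ℝ → E} (hu : LocInt u) {h s t : ℝ} (hh : 0 ≤ h)
    (hs : 0 ≤ s) (ht : 0 ≤ t) : IntervalIntegrable (fun x => u (x + h)) volume s t := by
  have := (hu.intervalIntegrable (add_nonneg hs hh) (add_nonneg ht hh)).comp_add_right h
  simpa using this

variable [NormedSpace ℝ E]

theorem IsPrimitiveOn.sub {f p g q : ℝ → E} {s t : ℝ} (hf : IsPrimitiveOn f p s t)
    (hg : IsPrimitiveOn g q s t) : IsPrimitiveOn (fun x => f x - g x) (fun x => p x - q x) s t := by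
  refine ⟨hf.integrable.sub hg.integrable, fun x hx => ?_⟩
  have hst : s ≤ t := hx.1.trans hx.2
  have hsub : uIcc s x ⊆ uIcc s t := by
    rw [uIcc_of_le hst, uIcc_of_le hx.1]; exact Icc_subset_Icc_right hx.2
  rw [hf.eq_add x hx, hg.eq_add x hx, intervalIntegral.integral_sub (hf.integrable.mono_set hsub)
    (hg.integrable.mono_set hsub)]
  abel

/-- The regularising effect of averaging: the derivative is a difference quotient with values in the
same space as `u`, even when `u` itself is only locally integrable. Forward averages never leave the
half line. -/
theorem LocInt.steklov_isPrimitiveOn {u : ℝ → E} (hu : LocInt u) {h s t : ℝ} (hh : 0 < h)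
    (hs : 0 ≤ s) (hst : s ≤ t) :
    IsPrimitiveOn (steklov h u) (fun x => h⁻¹ • (u (x + h) - u x)) s t := by
  have hii : ∀ {a b : ℝ}, 0 ≤ a → 0 ≤ b → IntervalIntegrable u volume a b :=
    fun ha hb => hu.intervalIntegrable ha hb
  refine ⟨((hu.translate_intervalIntegrable hh.le hs (hs.trans hst)).sub
    (hii hs (hs.trans hst))).smul h⁻¹, fun x hx => ?_⟩
  have hx0 : 0 ≤ x := hs.trans hx.1
  rw [intervalIntegral.integral_smul, intervalIntegral.integral_sub
    (hu.translate_intervalIntegrable hh.le hs hx0) (hii hs hx0),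
    intervalIntegral.integral_comp_add_right, steklov, steklov, ← smul_add]
  congr 1
  rw [← sub_eq_iff_eq_add', intervalIntegral.integral_interval_sub_interval_comm'
    (hii hx0 (by positivity)) (hii hs (by positivity)) (hii hx0 hs)]

theorem LocInt.memLp_steklov {u : ℝ → E} (hu : LocInt u) {h s t : ℝ} (hh : 0 < h)
    (hs : 0 ≤ s) (hst : s ≤ t) : MemLp (steklov h u) 2 (volume.restrict (Ioo s t)) :=
  memLp_two_of_continuousOn ((hu.steklov_isPrimitiveOn hh hs hst).continuousOn hst)

end SteklovPrimitive

theorem L2Loc.locInt {E : Type} [NormedAddCommGroup E] {f : ℝ → E} (hf : L2Loc f) : LocInt f :=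
  fun T hT => (hf T hT).integrable (by norm_num)

theorem L2Loc.mono {E : Type} [NormedAddCommGroup E] {f : ℝ → E} (hf : L2Loc f) {s t : ℝ}
    (hs : 0 ≤ s) : MemLp f 2 (volume.restrict (Ioo s t)) := by
  refine (hf (|t| + 1) (by positivity)).mono_measure (Measure.restrict_mono (fun x hx => ?_) le_rfl)
  exact ⟨hs.trans_lt hx.1, by linarith [hx.2, le_abs_self t]⟩

/-! ### Convergence of Steklov averages in `L²` and almost everywhere -/

section SteklovConvergence

variable {E : Type} [NormedAddCommGroup E] [NormedSpace ℝ E] [CompleteSpace E]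

theorem L2Loc.tendsto_eLpNorm_steklov_sub {u : ℝ → E} (hu : L2Loc u) {s t : ℝ} (hs : 0 ≤ s) :
    Tendsto (fun h => eLpNorm (steklov h u - u) 2 (volume.restrict (Ioo s t))) (𝓝[>] 0) (𝓝 0) := by
  -- For `h < 1`, averages taken at points of `(s, t)` only see `u` on `(s, t + 1)`, so the cut-off
  -- does not change them.
  have hi : MemLp (indicator (Ioo s (t + 1)) u) 2 volume :=
    (memLp_indicator_iff_restrict measurableSet_Ioo).2 (hu.mono hs)
  refine tendsto_of_tendsto_of_tendsto_of_le_of_le' tendsto_const_nhds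
    (ViscousSlab.tendsto_eLpNorm_steklov_sub hi) (Eventually.of_forall fun _ => zero_le) ?_
  filter_upwards [Ioo_mem_nhdsGT one_pos] with h hh
  refine le_trans (le_of_eq ?_) (eLpNorm_mono_measure _ (Measure.restrict_le_self (s := Ioo s t)))
  refine eLpNorm_congr_ae ?_
  filter_upwards [ae_restrict_mem measurableSet_Ioo] with x hx
  rw [Pi.sub_apply, indicator_of_mem (s := Ioo s (t + 1)) ⟨hx.1, by linarith [hx.2]⟩, steklov,
    steklov]
  congr 2
  refine intervalIntegral.integral_congr fun y hy => ?_
  rw [uIcc_of_le (by linarith [hh.1])] at hy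
  rw [indicator_of_mem (s := Ioo s (t + 1)) ⟨hx.1.trans_le hy.1, by linarith [hx.2, hy.2, hh.2]⟩]

/-- Lebesgue differentiation: the average is the right difference quotient of the primitive of `u`.
-/
theorem LocInt.ae_tendsto_steklov {u : ℝ → E} (hu : LocInt u) :
    ∀ᵐ t ∂volume.restrict (Ioi 0), Tendsto (fun h => steklov h u t) (𝓝[>] 0) (𝓝 (u t)) := by
  rw [ae_restrict_iff' measurableSet_Ioi]
  have h1 : ∀ n : ℕ, ∀ᵐ x, x ∈ uIcc (0 : ℝ) n → ∀ c ∈ uIcc (0 : ℝ) n,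
      HasDerivAt (fun x => ∫ (t : ℝ) in c..x, u t) (u x) x := fun n =>
    (hu.intervalIntegrable le_rfl n.cast_nonneg).ae_hasDerivAt_integral
  filter_upwards [ae_all_iff.2 h1] with x hx hx0
  rw [mem_Ioi] at hx0
  obtain ⟨n, hn⟩ := exists_nat_ge x
  have h2 := hx n (by rw [uIcc_of_le n.cast_nonneg]; exact ⟨hx0.le, hn⟩) 0 left_mem_uIcc
  rw [hasDerivAt_iff_tendsto_slope_zero] at h2
  refine (h2.mono_left (nhdsWithin_mono _ fun y (hy : 0 < y) => hy.ne')).congr' ?_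
  filter_upwards [self_mem_nhdsWithin] with h (hh : 0 < h)
  rw [steklov, intervalIntegral.integral_interval_sub_left
    (hu.intervalIntegrable le_rfl (by positivity)) (hu.intervalIntegrable le_rfl hx0.le)]

end SteklovConvergence

/-! ### The energy identity for curves with a weak derivative in the dual space -/

section LionsMagenes

variable {V H : Type} [NormedAddCommGroup V] [InnerProductSpace ℝ V]
  [NormedAddCommGroup H] [InnerProductSpace ℝ H]

/-- The embedding `V → V*` induced by a map `ι : V → H` into a Hilbert space. -/
def gram (ι : V →L[ℝ] H) : V →L[ℝ] StrongDual ℝ V :=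
  ContinuousLinearMap.bilinearComp (innerSL ℝ (E := H)) ι ι

theorem gram_apply (ι : V →L[ℝ] H) (a b : V) : gram ι a b = inner ℝ (ι a) (ι b) := rfl

/-- Derivatives tested against fixed elements of `V` assemble into a weak derivative of a curve in
`V*`, to which the du Bois-Reymond lemma applies. -/
theorem exists_gram_ae_eq (ι : V →L[ℝ] H) {u : ℝ → V} {w : ℝ → StrongDual ℝ V} (hu : LocInt u)
    (hw : LocInt w) (h : ∀ η, IsTimeTest η → ∀ v : V,
      ∫ t in Ioi 0, deriv η t * inner ℝ (ι (u t)) (ι v) = -∫ t in Ioi 0, η t * w t v) :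
    ∃ c, ∀ᵐ t ∂volume.restrict (Ioi 0), gram ι (u t) = c + ∫ s in (0 : ℝ)..t, w s := by
  have hg : LocInt (fun t => gram ι (u t)) := fun T hT => (gram ι).integrable_comp (hu T hT)
  refine exists_ae_eq_add_integral hg hw fun η hη => ?_
  ext v
  have i1 := integrableOn_smul_of_tsupport hg hη.deriv.1.continuous hη.deriv.2.1
  have i2 := integrableOn_smul_of_tsupport hw hη.1.continuous hη.2.1
  rw [neg_apply, ContinuousLinearMap.integral_apply i1,
    ContinuousLinearMap.integral_apply i2]
  simpa [gram_apply] using h η hη v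

/-- Averaging commutes with the weak derivative. The `V`-valued derivative of the averaged curve is
thus identified, inside `V*`, with an object that converges as the averaging length tends to zero.
-/
theorem gram_steklov_deriv (ι : V →L[ℝ] H) {u : ℝ → V} {w : ℝ → StrongDual ℝ V} (hw : LocInt w)
    {c : StrongDual ℝ V} (hc : ∀ᵐ t ∂volume.restrict (Ioi 0),
      gram ι (u t) = c + ∫ s in (0 : ℝ)..t, w s) {h : ℝ} (hh : 0 < h) :
    ∀ᵐ t ∂volume.restrict (Ioi 0), gram ι (h⁻¹ • (u (t + h) - u t)) = steklov h w t := by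
  rw [ae_restrict_iff' measurableSet_Ioi] at hc ⊢
  filter_upwards [hc, (measurePreserving_add_right volume h).quasiMeasurePreserving.ae hc]
    with t h1 h2 ht
  rw [mem_Ioi] at h1 h2 ht
  rw [map_smul, map_sub, h1 ht, h2 (by positivity), steklov, add_sub_add_left_eq_sub,
    intervalIntegral.integral_interval_sub_left (hw.intervalIntegrable le_rfl (by positivity))
    (hw.intervalIntegrable le_rfl ht.le)]

variable [CompleteSpace V]

theorem norm_sq_eq_of_primitive (ι : V →L[ℝ] H) {f p : ℝ → V} {θ : ℝ → StrongDual ℝ V} {s t : ℝ}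
    (hst : s ≤ t) (hf : IsPrimitiveOn f p s t)
    (hθ : ∀ᵐ x ∂volume.restrict (Ioi 0), gram ι (p x) = θ x) (hs : 0 ≤ s) :
    ‖ι (f t)‖ ^ 2 = ‖ι (f s)‖ ^ 2 + 2 * ∫ x in s..t, θ x (f x) := by
  have key := hf.bilin (gram ι) hst hf
  simp only [gram_apply, real_inner_self_eq_norm_sq] at key
  rw [key, ← intervalIntegral.integral_const_mul]
  congr 1
  refine intervalIntegral.integral_congr_ae ?_
  rw [ae_restrict_iff' measurableSet_Ioi] at hθ
  filter_upwards [hθ] with x hx hx2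
  rw [uIoc_of_le hst] at hx2
  rw [← hx (hs.trans_lt hx2.1), gram_apply, real_inner_comm (ι (p x)), two_mul]

theorem tendsto_integral_pairing {E F : Type} [NormedAddCommGroup E] [NormedSpace ℝ E]
    [NormedAddCommGroup F] [NormedSpace ℝ F] (b : E →L[ℝ] F →L[ℝ] ℝ) {α : Type*}
    [MeasurableSpace α] {μ : Measure α} {f : ℕ → α → E} {f₀ : α → E} {g : ℕ → α → F} {g₀ : α → F}
    (hf : ∀ n, MemLp (f n) 2 μ) (hf₀ : MemLp f₀ 2 μ) (hg : ∀ n, MemLp (g n) 2 μ)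
    (hg₀ : MemLp g₀ 2 μ) (h1 : Tendsto (fun n => eLpNorm (f n - f₀) 2 μ) atTop (𝓝 0))
    (h2 : Tendsto (fun n => eLpNorm (g n - g₀) 2 μ) atTop (𝓝 0)) :
    Tendsto (fun n => ∫ x, b (f n x) (g n x) ∂μ) atTop (𝓝 (∫ x, b (f₀ x) (g₀ x) ∂μ)) := by
  have e : ∀ {f : α → E} {g : α → F} (hf : MemLp f 2 μ) (hg : MemLp g 2 μ),
      ∫ x, b (f x) (g x) ∂μ = b.lpPairing μ 2 2 hf.toLp hg.toLp := fun hf hg => by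
    rw [ContinuousLinearMap.lpPairing_eq_integral]
    refine integral_congr_ae ?_
    filter_upwards [hf.coeFn_toLp, hg.coeFn_toLp] with x h1 h2
    rw [h1, h2]
  simp_rw [fun n => e (hf n) (hg n), e hf₀ hg₀]
  have t1 := (Lp.tendsto_Lp_iff_tendsto_eLpNorm'' f hf f₀ hf₀).2 h1
  have t2 := (Lp.tendsto_Lp_iff_tendsto_eLpNorm'' g hg g₀ hg₀).2 h2
  have t3 := ((b.lpPairing μ 2 2).continuous.tendsto _).comp t1
  have t4 : Continuous fun z : (Lp F 2 μ →L[ℝ] ℝ) × Lp F 2 μ => z.1 z.2 :=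
    isBoundedBilinearMap_apply.continuous
  exact (t4.tendsto _).comp (t3.prodMk_nhds t2)

theorem abs_integral_pairing_le {E F : Type} [NormedAddCommGroup E] [NormedSpace ℝ E]
    [NormedAddCommGroup F] [NormedSpace ℝ F] (b : E →L[ℝ] F →L[ℝ] ℝ) (hb : ‖b‖ ≤ 1) {α : Type*}
    [MeasurableSpace α] {μ : Measure α} {f : α → E} {g : α → F}
    (hf : MemLp f 2 μ) (hg : MemLp g 2 μ) :
    |∫ x, b (f x) (g x) ∂μ| ≤ (eLpNorm f 2 μ).toReal * (eLpNorm g 2 μ).toReal := by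
  have e : ∫ x, b (f x) (g x) ∂μ = b.lpPairing μ 2 2 hf.toLp hg.toLp := by
    rw [ContinuousLinearMap.lpPairing_eq_integral]
    refine integral_congr_ae ?_
    filter_upwards [hf.coeFn_toLp, hg.coeFn_toLp] with x h1 h2
    rw [h1, h2]
  have h1 := ENNReal.toReal_mono
    (ENNReal.mul_ne_top (ENNReal.mul_ne_top ENNReal.coe_ne_top hf.eLpNorm_ne_top) hg.eLpNorm_ne_top)
    (eLpNorm_le_eLpNorm_mul_eLpNorm'_of_norm (r := 1) hf.1 hg.1 (fun x y => b x y) 1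
      (Eventually.of_forall fun x => by
        refine (b.le_opNorm₂ _ _).trans ?_
        gcongr
        exact_mod_cast hb))
  rw [ENNReal.toReal_mul, ENNReal.toReal_mul, ENNReal.coe_one, ENNReal.toReal_one, one_mul] at h1
  refine le_trans ?_ h1
  rw [eLpNorm_one_eq_lintegral_enorm, ← Real.norm_eq_abs]
  refine (norm_integral_le_lintegral_norm _).trans (le_of_eq ?_)
  simp only [ofReal_norm]

end LionsMagenes

/-! ### Uniform convergence of the averages and the limit of the energy identity -/

section LionsMagenes

variable {V H : Type} [NormedAddCommGroup V] [InnerProductSpace ℝ V] [CompleteSpace V]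
  [NormedAddCommGroup H] [InnerProductSpace ℝ H]

theorem intervalIntegral_eq_integral_Ioo {E : Type*} [NormedAddCommGroup E] [NormedSpace ℝ E]
    (f : ℝ → E) {s t : ℝ} (hst : s ≤ t) : ∫ x in s..t, f x = ∫ x in Ioo s t, f x := by
  rw [intervalIntegral.integral_of_le hst, integral_Ioc_eq_integral_Ioo]

/-- The energy identity for the difference of two averages bounds its `H`-norm at any time by its
value at one good time plus a pairing of two `L²`-small differences, uniformly in time. -/
theorem uniformCauchySeqOn_steklov (ι : V →L[ℝ] H) {u : ℝ → V} {w : ℝ → StrongDual ℝ V}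
    (hu : L2Loc u) (hw : L2Loc w) {c : StrongDual ℝ V} (hc : ∀ᵐ t ∂volume.restrict (Ioi 0),
      gram ι (u t) = c + ∫ s in (0 : ℝ)..t, w s) {δ : ℕ → ℝ} (hδ : ∀ n, 0 < δ n)
    (hδ0 : Tendsto δ atTop (𝓝[>] 0)) {T : ℝ} (hT : 0 < T) :
    UniformCauchySeqOn (fun n t => ι (steklov (δ n) u t)) atTop (Icc 0 T) := by
  have hu' := hu.locInt
  have hw' := hw.locInt
  set μ := volume.restrict (Ioo 0 T) with hμ
  -- The good time is a point where the averages of `u` converge in `V`; almost every time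
  -- qualifies.
  obtain ⟨s, hs, hs0⟩ : ∃ s, s ∈ Ioo 0 T ∧
      Tendsto (fun h => steklov h u s) (𝓝[>] 0) (𝓝 (u s)) := by
    have h1 : ∀ᵐ t ∂volume.restrict (Ioo 0 T), Tendsto (fun h => steklov h u t) (𝓝[>] 0)
        (𝓝 (u t)) := ae_mono (Measure.restrict_mono (fun x hx => hx.1) le_rfl)
          hu'.ae_tendsto_steklov
    have : NeBot (ae (volume.restrict (Ioo 0 T))) := by
      rw [ae_neBot, Ne, Measure.restrict_eq_zero]; simp [hT]
    obtain ⟨s, h2, h3⟩ := (h1.and (ae_restrict_mem measurableSet_Ioo)).exists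
    exact ⟨s, h3, h2⟩
  have hcs : CauchySeq fun n => ι (steklov (δ n) u s) :=
    ((ι.continuous.tendsto _).comp (hs0.comp hδ0)).cauchySeq
  have hα := ((hu.tendsto_eLpNorm_steklov_sub le_rfl (t := T)).comp hδ0)
  have hβ := ((hw.tendsto_eLpNorm_steklov_sub le_rfl (t := T)).comp hδ0)
  rw [Metric.uniformCauchySeqOn_iff]
  intro ε hε
  have hη : 0 < ENNReal.ofReal (ε / 4) := by positivity
  obtain ⟨N₁, hN₁⟩ := Metric.cauchySeq_iff.1 hcs (ε / 2) (by positivity)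
  obtain ⟨N₂, hN₂⟩ := eventually_atTop.1 ((ENNReal.tendsto_nhds_zero.1 hα) _ hη)
  obtain ⟨N₃, hN₃⟩ := eventually_atTop.1 ((ENNReal.tendsto_nhds_zero.1 hβ) _ hη)
  have mf : ∀ n, MemLp (steklov (δ n) u) 2 μ := fun n => hu'.memLp_steklov (hδ n) le_rfl hT.le
  have mg : ∀ n, MemLp (steklov (δ n) w) 2 μ := fun n => hw'.memLp_steklov (hδ n) le_rfl hT.le
  have tri : ∀ {X : Type} [NormedAddCommGroup X] (f : ℕ → ℝ → X) (f₀ : ℝ → X) (m n : ℕ),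
      MemLp (f m) 2 μ → MemLp (f n) 2 μ → MemLp f₀ 2 μ →
      eLpNorm (f m - f₀) 2 μ ≤ ENNReal.ofReal (ε / 4) →
      eLpNorm (f n - f₀) 2 μ ≤ ENNReal.ofReal (ε / 4) →
      (eLpNorm (f m - f n) 2 μ).toReal ≤ ε / 2 := by
    intro X _ f f₀ m n h1 h2 h0 h3 h4
    have e : f m - f n = (f m - f₀) - (f n - f₀) := by abel
    refine ENNReal.toReal_le_of_le_ofReal (by positivity) ?_
    rw [e]
    refine (eLpNorm_sub_le (h1.sub h0).1 (h2.sub h0).1 (by norm_num)).trans ?_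
    refine (add_le_add h3 h4).trans (le_of_eq ?_)
    rw [← ENNReal.ofReal_add (by positivity) (by positivity)]
    congr 1; ring
  refine ⟨max N₁ (max N₂ N₃), fun m hm n hn t ht => ?_⟩
  simp only [max_le_iff, ge_iff_le] at hm hn
  have ha := tri (fun n => steklov (δ n) u) u m n (mf m) (mf n) (hu _ hT) (hN₂ m hm.2.1)
    (hN₂ n hn.2.1)
  have hb := tri (fun n => steklov (δ n) w) w m n (mg m) (mg n) (hw _ hT) (hN₃ m hm.2.2)
    (hN₃ n hn.2.2)
  have hd := hN₁ m hm.1 n hn.1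
  set f : ℝ → V := fun x => steklov (δ m) u x - steklov (δ n) u x with hf
  set θ : ℝ → StrongDual ℝ V := fun x => steklov (δ m) w x - steklov (δ n) w x with hθ
  have hprim : ∀ {x y : ℝ}, 0 ≤ x → x ≤ y →
      ‖ι (f y)‖ ^ 2 = ‖ι (f x)‖ ^ 2 + 2 * ∫ z in x..y, θ z (f z) := fun hx hxy => by
    refine norm_sq_eq_of_primitive ι hxy ((hu'.steklov_isPrimitiveOn (hδ m) hx hxy).sub
      (hu'.steklov_isPrimitiveOn (hδ n) hx hxy)) ?_ hx
    filter_upwards [gram_steklov_deriv ι hw' hc (hδ m), gram_steklov_deriv ι hw' hc (hδ n)]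
      with z h1 h2
    rw [map_sub, h1, h2]
  have hint : ∀ {x y : ℝ}, 0 ≤ x → x ≤ y → y ≤ T → |∫ z in x..y, θ z (f z)| ≤ (ε / 2) * (ε / 2) := by
    intro x y hx hxy hy
    rw [intervalIntegral_eq_integral_Ioo _ hxy]
    have hsub : volume.restrict (Ioo x y) ≤ μ :=
      Measure.restrict_mono (Ioo_subset_Ioo hx hy) le_rfl
    have h1 := abs_integral_pairing_le (ContinuousLinearMap.id ℝ (StrongDual ℝ V))
      ContinuousLinearMap.norm_id_le (((mg m).sub (mg n)).mono_measure hsub)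
      (((mf m).sub (mf n)).mono_measure hsub)
    refine h1.trans (mul_le_mul ?_ ?_ ENNReal.toReal_nonneg (by positivity))
    · exact (ENNReal.toReal_mono ((mg m).sub (mg n)).eLpNorm_ne_top
        (eLpNorm_mono_measure _ hsub)).trans hb
    · exact (ENNReal.toReal_mono ((mf m).sub (mf n)).eLpNorm_ne_top
        (eLpNorm_mono_measure _ hsub)).trans ha
  have hfin : ‖ι (f t)‖ ^ 2 ≤ ‖ι (f s)‖ ^ 2 + 2 * ((ε / 2) * (ε / 2)) := by
    rcases le_total s t with h | h
    · have := hint hs.1.le h ht.2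
      rw [hprim hs.1.le h]
      linarith [le_abs_self (∫ z in s..t, θ z (f z))]
    · have := hint ht.1 h hs.2.le
      have h2 := hprim ht.1 h
      linarith [neg_abs_le (∫ z in t..s, θ z (f z))]
  rw [dist_eq_norm, ← map_sub] at hd ⊢
  have h3 : ‖ι (f s)‖ ^ 2 < (ε / 2) ^ 2 := by
    exact pow_lt_pow_left₀ hd (norm_nonneg _) two_ne_zero
  -- The starting value contributes less than `ε²/4` and the pairing at most `ε²/2`, together less
  -- than `ε²`.
  refine lt_of_pow_lt_pow_left₀ 2 hε.le ?_
  change ‖ι (f t)‖ ^ 2 < ε ^ 2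
  nlinarith

/-- A curve in `L²(V)` with weak derivative in `L²(V*)` is continuous with values in `H` and
satisfies the energy identity. -/
theorem exists_continuousOn_energy_identity [CompleteSpace H] (ι : V →L[ℝ] H) {u : ℝ → V}
    {w : ℝ → StrongDual ℝ V} (hu : L2Loc u) (hw : L2Loc w)
    (h : ∀ η, IsTimeTest η → ∀ v : V,
      ∫ t in Ioi 0, deriv η t * inner ℝ (ι (u t)) (ι v) = -∫ t in Ioi 0, η t * w t v) :
    ∃ U : ℝ → H, ContinuousOn U (Ici 0) ∧ (∀ᵐ t ∂volume.restrict (Ioi 0), U t = ι (u t)) ∧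
      (∀ s t, 0 ≤ s → s ≤ t → ‖U t‖ ^ 2 = ‖U s‖ ^ 2 + 2 * ∫ x in s..t, w x (u x)) ∧
      ∀ v s t, 0 ≤ s → s ≤ t →
        (inner ℝ (U t) (ι v) : ℝ) = inner ℝ (U s) (ι v) + ∫ x in s..t, w x v := by
  have hu' := hu.locInt
  have hw' := hw.locInt
  obtain ⟨c, hc⟩ := exists_gram_ae_eq ι hu' hw' h
  let δ : ℕ → ℝ := fun n => 1 / ((n : ℝ) + 1)
  have hδ : ∀ n, 0 < δ n := fun n => by positivity
  have hδ0 : Tendsto δ atTop (𝓝[>] 0) :=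
    tendsto_nhdsWithin_iff.2 ⟨tendsto_one_div_add_atTop_nhds_zero_nat, Eventually.of_forall hδ⟩
  have hunif := fun {T : ℝ} (hT : 0 < T) => uniformCauchySeqOn_steklov ι hu hw hc hδ hδ0 hT
  have hlim : ∀ t : ℝ, ∃ L : H, 0 ≤ t → Tendsto (fun n => ι (steklov (δ n) u t)) atTop (𝓝 L) := by
    intro t
    by_cases ht : 0 ≤ t
    · obtain ⟨L, hL⟩ := cauchySeq_tendsto_of_complete
        ((hunif (T := t + 1) (by positivity)).cauchySeq (x := t) ⟨ht, by linarith⟩)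
      exact ⟨L, fun _ => hL⟩
    · exact ⟨0, fun h => absurd h ht⟩
  choose U hU using hlim
  have hprim := fun (n : ℕ) {s t : ℝ} (hs : 0 ≤ s) (hst : s ≤ t) =>
    hu'.steklov_isPrimitiveOn (hδ n) hs hst
  have mf : ∀ n {s t : ℝ}, 0 ≤ s → s ≤ t → MemLp (steklov (δ n) u) 2 (volume.restrict (Ioo s t)) :=
    fun n _ _ hs hst => hu'.memLp_steklov (hδ n) hs hst
  have mg : ∀ n {s t : ℝ}, 0 ≤ s → s ≤ t → MemLp (steklov (δ n) w) 2 (volume.restrict (Ioo s t)) :=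
    fun n _ _ hs hst => hw'.memLp_steklov (hδ n) hs hst
  refine ⟨U, ?_, ?_, fun s t hs hst => ?_, fun v s t hs hst => ?_⟩
  · have hT : ∀ T > 0, ContinuousOn U (Icc 0 T) := fun T hT => by
      have h1 := (hunif hT).tendstoUniformlyOn_of_tendsto (f := U) fun t ht => hU t ht.1
      exact h1.continuousOn (Frequently.of_forall fun n =>
        ι.continuous.comp_continuousOn ((hprim n le_rfl hT.le).continuousOn hT.le))
    intro t ht
    have ht0 : (0 : ℝ) ≤ t := ht
    refine ((hT (t + 1) (by positivity)) t ⟨ht0, by linarith⟩).mono_of_mem_nhdsWithin ?_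
    filter_upwards [self_mem_nhdsWithin, mem_nhdsWithin_of_mem_nhds (Iio_mem_nhds (lt_add_one t))]
      with x (h1 : 0 ≤ x) (h2 : x < t + 1)
    exact ⟨h1, h2.le⟩
  · filter_upwards [hu'.ae_tendsto_steklov, ae_restrict_mem measurableSet_Ioi] with t h1 h2
    exact tendsto_nhds_unique (hU t (le_of_lt h2)) ((ι.continuous.tendsto _).comp (h1.comp hδ0))
  · have h1 : ∀ n, ‖ι (steklov (δ n) u t)‖ ^ 2 = ‖ι (steklov (δ n) u s)‖ ^ 2 +
        2 * ∫ x in s..t, steklov (δ n) w x (steklov (δ n) u x) := fun n =>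
      norm_sq_eq_of_primitive ι hst (hprim n hs hst) (gram_steklov_deriv ι hw' hc (hδ n)) hs
    have h2 : Tendsto (fun n => ∫ x in s..t, steklov (δ n) w x (steklov (δ n) u x)) atTop
        (𝓝 (∫ x in s..t, w x (u x))) := by
      simp_rw [intervalIntegral_eq_integral_Ioo _ hst]
      exact tendsto_integral_pairing (ContinuousLinearMap.id ℝ (StrongDual ℝ V))
        (fun n => mg n hs hst) (hw.mono hs) (fun n => mf n hs hst) (hu.mono hs)
        ((hw.tendsto_eLpNorm_steklov_sub hs).comp hδ0)
        ((hu.tendsto_eLpNorm_steklov_sub hs).comp hδ0)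
    refine tendsto_nhds_unique (((hU t (hs.trans hst)).norm).pow 2) ?_
    simp_rw [h1]
    exact (((hU s hs).norm).pow 2).add (h2.const_mul 2)
  · have h1 : ∀ n, (inner ℝ (ι (steklov (δ n) u t)) (ι v) : ℝ) =
        inner ℝ (ι (steklov (δ n) u s)) (ι v) + ∫ x in s..t, steklov (δ n) w x v := fun n => by
      have hp := hprim n hs hst
      rw [hp.eq_add t ⟨hst, le_rfl⟩, map_add, inner_add_left]
      congr 1
      have h3 := ((gram ι).flip v).intervalIntegral_comp_comm hp.integrable
      simp only [ContinuousLinearMap.flip_apply] at h3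
      rw [← gram_apply, ← h3]
      refine intervalIntegral.integral_congr_ae ?_
      have h4 := gram_steklov_deriv ι hw' hc (hδ n)
      rw [ae_restrict_iff' measurableSet_Ioi] at h4
      filter_upwards [h4] with x hx hx2
      rw [uIoc_of_le hst] at hx2
      rw [hx (hs.trans_lt hx2.1)]
    have h2 : Tendsto (fun n => ∫ x in s..t, steklov (δ n) w x v) atTop
        (𝓝 (∫ x in s..t, w x v)) := by
      simp_rw [intervalIntegral_eq_integral_Ioo _ hst]
      exact tendsto_integral_pairing (ContinuousLinearMap.id ℝ (StrongDual ℝ V))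
        (g := fun _ _ => v) (g₀ := fun _ => v)
        (fun n => mg n hs hst) (hw.mono hs) (fun n => memLp_const v) (memLp_const v)
        ((hw.tendsto_eLpNorm_steklov_sub hs).comp hδ0) (by simp)
    refine tendsto_nhds_unique ((hU t (hs.trans hst)).inner tendsto_const_nhds) ?_
    simp_rw [h1]
    exact ((hU s hs).inner tendsto_const_nhds).add h2

end LionsMagenes

/-! ### An abstract decay principle -/

/-- A waiting time `2C` halves `E`. Iterating gives geometric decay along multiples of `2C`, and
monotonicity fills the gaps. -/
theorem exp_decay_of_antitone {E : ℝ → ℝ} {C : ℝ} (hC : 0 < C) (h0 : ∀ t, 0 ≤ t → 0 ≤ E t)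
    (hanti : ∀ s t, 0 ≤ s → s ≤ t → E t ≤ E s)
    (hint : ∀ s t, 0 ≤ s → s ≤ t → (t - s) * E t ≤ C * E s) {t : ℝ} (ht : 0 ≤ t) :
    E t ≤ 2 * Real.exp (-(Real.log 2 / (2 * C)) * t) * E 0 := by
  have hhalf : ∀ s, 0 ≤ s → E (s + 2 * C) ≤ E s / 2 := fun s hs => by
    have h1 := hint s (s + 2 * C) hs (by linarith)
    rw [add_sub_cancel_left, mul_comm 2 C, mul_assoc] at h1
    have := le_of_mul_le_mul_left h1 hC
    rw [mul_comm C 2] at this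
    linarith
  have hpow : ∀ n : ℕ, E (n * (2 * C)) ≤ (1 / 2) ^ n * E 0 := fun n => by
    induction n with
    | zero => simp
    | succ n ih =>
      have h1 := hhalf (n * (2 * C)) (by positivity)
      rw [show ((n + 1 : ℕ) : ℝ) * (2 * C) = n * (2 * C) + 2 * C by push_cast; ring, pow_succ]
      linarith
  -- The number of complete halving periods before `t`; the incomplete last one costs the factor
  -- `2`.
  set n := ⌊t / (2 * C)⌋₊ with hn
  have hn1 : (n : ℝ) * (2 * C) ≤ t := by
    rw [← le_div_iff₀ (by positivity)]; exact Nat.floor_le (by positivity)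
  have hn2 : t / (2 * C) < n + 1 := Nat.lt_floor_add_one _
  refine (hanti _ _ (by positivity) hn1).trans ((hpow n).trans ?_)
  refine mul_le_mul_of_nonneg_right ?_ (h0 0 le_rfl)
  have e1 : ((1 : ℝ) / 2) ^ n = Real.exp (-(Real.log 2 * n)) := by
    rw [Real.exp_neg, mul_comm, Real.exp_nat_mul, Real.exp_log two_pos]; simp
  have e2 : 2 * Real.exp (-(Real.log 2 / (2 * C)) * t) =
      Real.exp (Real.log 2 + -(Real.log 2 / (2 * C)) * t) := by
    rw [Real.exp_add, Real.exp_log two_pos]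
  rw [e1, e2, Real.exp_le_exp]
  have h3 : Real.log 2 * (t / (2 * C)) ≤ Real.log 2 * (n + 1) := by
    have := Real.log_nonneg one_le_two
    gcongr
  rw [show -(Real.log 2 / (2 * C)) * t = -(Real.log 2 * (t / (2 * C))) by ring]
  linarith

/-! ### Parseval families and termwise integration -/

section Parseval

variable {S J : Type} [NormedAddCommGroup S] [InnerProductSpace ℝ S]

/-- A family of functionals that computes the norm by Parseval's identity. -/
def IsParseval (e : J → S →L[ℝ] ℝ) : Prop := ∀ f, HasSum (fun j => e j f ^ 2) (‖f‖ ^ 2)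

variable {e : J → S →L[ℝ] ℝ}

/-- Polarisation of Parseval's identity. No orthogonality of the family is assumed, since the one
used later is redundant. -/
theorem IsParseval.hasSum_mul (he : IsParseval e) (f g : S) :
    HasSum (fun j => e j f * e j g) (inner ℝ f g) := by
  have h := (((he (f + g)).sub (he f)).sub (he g)).mul_left (1 / 2)
  have e1 : 1 / 2 * (‖f + g‖ ^ 2 - ‖f‖ ^ 2 - ‖g‖ ^ 2) = inner ℝ f g := by
    rw [norm_add_sq_real]; ring
  rw [e1] at h
  refine h.congr_fun fun j => ?_
  rw [map_add]; ring

theorem IsParseval.sum_le (he : IsParseval e) (f : S) (F : Finset J) :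
    ∑ j ∈ F, e j f ^ 2 ≤ ‖f‖ ^ 2 :=
  sum_le_hasSum F (fun _ _ => sq_nonneg _) (he f)

variable {α : Type*} [MeasurableSpace α] {ν : Measure α}

theorem IsParseval.summable_integral_sq (he : IsParseval e) {f : α → S} (hf : MemLp f 2 ν) :
    Summable fun j => ∫ x, e j (f x) ^ 2 ∂ν := by
  have hi : ∀ j, Integrable (fun x => e j (f x) ^ 2) ν := fun j =>
    ((e j).comp_memLp' hf).integrable_sq
  refine summable_of_sum_le (c := ∫ x, ‖f x‖ ^ 2 ∂ν)
    (fun j => integral_nonneg fun x => sq_nonneg _) fun F => ?_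
  rw [← integral_finsetSum _ fun j _ => hi j]
  exact integral_mono (integrable_finsetSum _ fun j _ => hi j) hf.norm.integrable_sq
    fun x => he.sum_le (f x) F

/-- Sum and integral may be exchanged because `|ab| ≤ a² + b²` and the squares are summable after
integration. -/
theorem IsParseval.hasSum_integral_mul [Countable J] (he : IsParseval e) {f g : α → S}
    (hf : MemLp f 2 ν) (hg : MemLp g 2 ν) :
    HasSum (fun j => ∫ x, e j (f x) * e j (g x) ∂ν) (∫ x, inner ℝ (f x) (g x) ∂ν) := by
  have hfj : ∀ j, MemLp (fun x => e j (f x)) 2 ν := fun j => (e j).comp_memLp' hf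
  have hgj : ∀ j, MemLp (fun x => e j (g x)) 2 ν := fun j => (e j).comp_memLp' hg
  have h1 := hasSum_integral_of_summable_integral_norm (μ := ν)
    (F := fun j x => e j (f x) * e j (g x)) (fun j => (hfj j).integrable_mul (hgj j)) ?_
  · rw [integral_congr_ae (Eventually.of_forall fun x => (he.hasSum_mul (f x) (g x)).tsum_eq)] at h1
    exact h1
  · refine Summable.of_nonneg_of_le (fun j => integral_nonneg fun x => norm_nonneg _) (fun j => ?_)
      ((he.summable_integral_sq hf).add (he.summable_integral_sq hg))
    rw [← integral_add (hfj j).integrable_sq (hgj j).integrable_sq]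
    refine integral_mono ((hfj j).integrable_mul (hgj j)).norm
      ((hfj j).integrable_sq.add (hgj j).integrable_sq) fun x => ?_
    simp only [norm_mul, Real.norm_eq_abs]
    nlinarith [sq_abs (e j (f x)), sq_abs (e j (g x)), sq_nonneg (|e j (f x)| - |e j (g x)|),
      sq_nonneg (|e j (f x)|), sq_nonneg (|e j (g x)|)]

end Parseval

/-! ### The abstract frame and the cross-term estimate -/

section Decay

variable {V H S Z J : Type} [NormedAddCommGroup V] [InnerProductSpace ℝ V]
  [NormedAddCommGroup H] [InnerProductSpace ℝ H]
  [NormedAddCommGroup S] [InnerProductSpace ℝ S]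
  [NormedAddCommGroup Z] [InnerProductSpace ℝ Z]

/-- The spatial estimates behind the decay: `ι` is the embedding into the energy space, `A` the
dissipation, `e` a Parseval family on the boundary space, `μ` the symbol, and `B j` lifts the `j`-th
boundary mode into the interior. -/
structure IsDecayFrame (ι : V →L[ℝ] H) (A : V →L[ℝ] Z) (e : J → S →L[ℝ] ℝ) (μ : J → ℝ) (B : J → V)
    (C : ℝ) : Prop where
  parseval : IsParseval e
  pos : 0 < C
  one_le : ∀ j, 1 ≤ C * μ j
  korn : ∀ v, ‖ι v‖ ^ 2 ≤ C * ‖A v‖ ^ 2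
  lift_energy : ∀ (F : Finset J) (c : J → ℝ), ‖ι (∑ j ∈ F, c j • B j)‖ ^ 2 ≤ C * ∑ j ∈ F, c j ^ 2
  lift_dissipation : ∀ (F : Finset J) (c : J → ℝ),
    ‖A (∑ j ∈ F, c j • B j)‖ ^ 2 ≤ C * ∑ j ∈ F, μ j * c j ^ 2

/-- The evolution equations in terms of an `IsDecayFrame`. -/
structure IsEvolution (ι : V →L[ℝ] H) (A : V →L[ℝ] Z) (e : J → S →L[ℝ] ℝ) (μ : J → ℝ) (B : J → V)
    (C : ℝ) (u : ℝ → V) (h : ℝ → S) (w : ℝ → StrongDual ℝ V) (m k : ℝ → S) : Prop where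
  memU : L2Loc u
  memH : L2Loc h
  memW : L2Loc w
  memM : L2Loc m
  memK : L2Loc k
  derivU : ∀ η, IsTimeTest η → ∀ v : V,
    ∫ t in Ioi 0, deriv η t * inner ℝ (ι (u t)) (ι v) = -∫ t in Ioi 0, η t * w t v
  derivH : ∀ η, IsTimeTest η → ∫ t in Ioi 0, deriv η t • h t = -∫ t in Ioi 0, η t • k t
  multiplier : ∀ᵐ t ∂volume.restrict (Ioi 0), ∀ j, e j (m t) = μ j * e j (h t)
  energy_eq : ∀ᵐ t ∂volume.restrict (Ioi 0),
    w t (u t) + 1 / 2 * ‖A (u t)‖ ^ 2 + inner ℝ (m t) (k t) = 0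
  lift_eq : ∀ᵐ t ∂volume.restrict (Ioi 0), ∀ j,
    w t (B j) + 1 / 2 * inner ℝ (A (u t)) (A (B j)) + e j (m t) = 0
  trace_le : ∀ᵐ t ∂volume.restrict (Ioi 0), ‖k t‖ ^ 2 ≤ C * ‖A (u t)‖ ^ 2

/-- The decay constant in terms of the constant of an `IsDecayFrame`. -/
def decayConst (C : ℝ) : ℝ := 2 * (1 + C ^ 2) + 2 * (1 / 2 * (C + C ^ 2) + C / 8) + C

theorem ae_restrict_Ioo_of_Ioi {p : ℝ → Prop} (h : ∀ᵐ t ∂volume.restrict (Ioi 0), p t) {s t : ℝ}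
    (hs : 0 ≤ s) : ∀ᵐ t ∂volume.restrict (Ioo s t), p t :=
  ae_mono (Measure.restrict_mono (fun _ hx => hs.trans_lt hx.1) le_rfl) h

variable {ι : V →L[ℝ] H} {A : V →L[ℝ] Z} {e : J → S →L[ℝ] ℝ} {μ : J → ℝ} {B : J → V} {C : ℝ}
  {u : ℝ → V} {h : ℝ → S} {w : ℝ → StrongDual ℝ V} {m k : ℝ → S}

/-- A pointwise estimate of the time derivative of the cross term `⟪u, B h⟫`. -/
theorem IsDecayFrame.cross_le (hf : IsDecayFrame ι A e μ B C) {x : V} {y : S} {z : S}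
    {ω₀ : StrongDual ℝ V} {n : S} (hm : ∀ j, e j n = μ j * e j y)
    (hl : ∀ j, ω₀ (B j) + 1 / 2 * inner ℝ (A x) (A (B j)) + e j n = 0)
    (hk : ‖z‖ ^ 2 ≤ C * ‖A x‖ ^ 2) (F : Finset J) :
    ∑ j ∈ F, (e j z * inner ℝ (ι x) (ι (B j)) + e j y * ω₀ (B j)) ≤
      (1 / 2 * (C + C ^ 2) + C / 8) * ‖A x‖ ^ 2 - 1 / 2 * ∑ j ∈ F, e j n * e j y := by
  have e1 : ∑ j ∈ F, (e j z * inner ℝ (ι x) (ι (B j)) + e j y * ω₀ (B j)) =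
      inner ℝ (ι x) (ι (∑ j ∈ F, e j z • B j)) -
        1 / 2 * inner ℝ (A x) (A (∑ j ∈ F, e j y • B j)) - ∑ j ∈ F, e j n * e j y := by
    simp only [map_sum, map_smul, inner_sum, inner_smul_right, Finset.mul_sum,
      ← Finset.sum_sub_distrib]
    refine Finset.sum_congr rfl fun j _ => ?_
    have := hl j
    rw [show ω₀ (B j) = -(1 / 2 * inner ℝ (A x) (A (B j))) - e j n by linarith]
    ring
  have hC := hf.pos
  have h1 := hf.lift_energy F (fun j => e j z)
  have h2 := hf.lift_dissipation F (fun j => e j y)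
  have h3 := hf.parseval.sum_le z F
  have h4 := hf.korn x
  have e2 : ∑ j ∈ F, μ j * e j y ^ 2 = ∑ j ∈ F, e j n * e j y :=
    Finset.sum_congr rfl fun j _ => by rw [hm j]; ring
  rw [e2] at h2
  rw [e1]
  set P := ∑ j ∈ F, e j n * e j y
  set a := ‖A x‖
  set b := ‖A (∑ j ∈ F, e j y • B j)‖
  have h5 : |inner ℝ (ι x) (ι (∑ j ∈ F, e j z • B j))| ≤ _ := abs_real_inner_le_norm _ _
  have h6 : |inner ℝ (A x) (A (∑ j ∈ F, e j y • B j))| ≤ a * b := abs_real_inner_le_norm _ _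
  -- Korn bounds the first factor squared by `C a²`; the lift bound, Bessel and the trace inequality
  -- bound the second squared by `C² a²`.
  have h7 : ‖ι x‖ * ‖ι (∑ j ∈ F, e j z • B j)‖ ≤ 1 / 2 * (C + C ^ 2) * a ^ 2 := by
    have h8 : ‖ι (∑ j ∈ F, e j z • B j)‖ ^ 2 ≤ C * (C * a ^ 2) :=
      h1.trans (mul_le_mul_of_nonneg_left (h3.trans hk) hC.le)
    nlinarith [sq_nonneg (‖ι x‖ - ‖ι (∑ j ∈ F, e j z • B j)‖)]
  -- Young's inequality weighted so that `b²` appears as `b² / C ≤ P`. The product enters with a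
  -- factor `½`, so half of the good term `-P` survives.
  have h9 : a * b ≤ C / 4 * a ^ 2 + P := by
    have : b ^ 2 / C ≤ P := by rw [div_le_iff₀ hC]; linarith
    have h10 : 0 ≤ (C / 2 * a - b) ^ 2 / C := by positivity
    have h11 : (C / 2 * a - b) ^ 2 / C = C / 4 * a ^ 2 - a * b + b ^ 2 / C := by
      field_simp; ring
    linarith
  have h12 := le_abs_self (inner ℝ (ι x) (ι (∑ j ∈ F, e j z • B j)))
  have h13 := neg_abs_le (inner ℝ (A x) (A (∑ j ∈ F, e j y • B j)))
  linarith

end Decay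

/-! ### Integration in time and decay in the abstract frame -/

section Decay

variable {V H S Z J : Type} [NormedAddCommGroup V] [InnerProductSpace ℝ V]
  [NormedAddCommGroup H] [InnerProductSpace ℝ H]
  [NormedAddCommGroup S] [InnerProductSpace ℝ S]
  [NormedAddCommGroup Z] [InnerProductSpace ℝ Z]
  {ι : V →L[ℝ] H} {A : V →L[ℝ] Z} {e : J → S →L[ℝ] ℝ} {μ : J → ℝ} {B : J → V} {C : ℝ}
  {u : ℝ → V} {h : ℝ → S} {w : ℝ → StrongDual ℝ V} {m k : ℝ → S}

theorem ae_uIoc_of_ae_Ioi {p : ℝ → Prop} (hp : ∀ᵐ t ∂volume.restrict (Ioi 0), p t) {s t : ℝ}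
    (hs : 0 ≤ s) (hst : s ≤ t) : ∀ᵐ x, x ∈ uIoc s t → p x := by
  rw [ae_restrict_iff' measurableSet_Ioi] at hp
  filter_upwards [hp] with x hx hx2
  rw [uIoc_of_le hst] at hx2
  exact hx (hs.trans_lt hx2.1)

theorem IsDecayFrame.symbol_nonneg (hf : IsDecayFrame ι A e μ B C) (j : J) : 0 ≤ μ j := by
  have := hf.one_le j
  by_contra hn
  nlinarith [hf.pos, mul_pos hf.pos (neg_pos.2 (not_le.1 hn))]

theorem L2Loc.comp_clm {E F : Type} [NormedAddCommGroup E] [NormedSpace ℝ E]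
    [NormedAddCommGroup F] [NormedSpace ℝ F] (L : E →L[ℝ] F) {f : ℝ → E} (hf : L2Loc f) :
    L2Loc fun t => L (f t) := fun T hT => L.comp_memLp' (hf T hT)

theorem L2Loc.inner {E : Type} [NormedAddCommGroup E] [InnerProductSpace ℝ E] {f g : ℝ → E}
    (hf : L2Loc f) (hg : L2Loc g) : LocInt fun t => (inner ℝ (f t) (g t) : ℝ) := fun T hT =>
  memLp_one_iff_integrable.1
    ((gram (ContinuousLinearMap.id ℝ E)).memLp_of_bilin 1 (hf T hT) (hg T hT))

theorem intervalIntegrable_finset_sum {F : Finset J} {f : J → ℝ → ℝ} {s t : ℝ}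
    (hf : ∀ j, IntervalIntegrable (f j) volume s t) :
    IntervalIntegrable (fun x => ∑ j ∈ F, f j x) volume s t := by
  convert! IntervalIntegrable.sum F fun j _ => hf j using 1
  ext x
  rw [Finset.sum_apply]

/-- The surface energy is a primitive of twice the pairing of `M h` with `∂ₜ h`. -/
theorem hasSum_surface [Countable J] [CompleteSpace S] (he : IsParseval e) (hm : L2Loc m)
    (hk : L2Loc k) {c : S}
    (hmul : ∀ᵐ t ∂volume.restrict (Ioi 0), ∀ j,
      e j (m t) = μ j * e j (c + ∫ y in (0 : ℝ)..t, k y)) {s t : ℝ}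
    (hs : 0 ≤ s) (hst : s ≤ t) {a : ℝ}
    (hsum : HasSum (fun j => μ j * e j (c + ∫ y in (0 : ℝ)..s, k y) ^ 2) a) :
    HasSum (fun j => μ j * e j (c + ∫ y in (0 : ℝ)..t, k y) ^ 2)
      (a + 2 * ∫ x in s..t, inner ℝ (m x) (k x)) := by
  have h1 := he.hasSum_integral_mul (hm.mono hs (t := t)) (hk.mono hs (t := t))
  rw [← intervalIntegral_eq_integral_Ioo _ hst] at h1
  refine (hsum.add (h1.mul_left 2)).congr_fun fun j => ?_
  rw [← intervalIntegral_eq_integral_Ioo _ hst]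
  have hp := hk.locInt.isPrimitiveOn c hs hst
  have hp' : IsPrimitiveOn (fun x => e j (c + ∫ y in (0 : ℝ)..x, k y)) (fun x => e j (k x)) s t := by
    refine ⟨(hk.comp_clm (e j)).locInt.intervalIntegrable hs (hs.trans hst), fun x hx => ?_⟩
    rw [hp.eq_add x hx, map_add, (e j).intervalIntegral_comp_comm
      (hk.locInt.intervalIntegrable hs (hs.trans hx.1))]
  have key := hp'.bilin (ContinuousLinearMap.mul ℝ ℝ) hst hp'
  simp only [ContinuousLinearMap.mul_apply'] at key
  rw [sq, sq, key, mul_add, ← intervalIntegral.integral_const_mul,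
    ← intervalIntegral.integral_const_mul]
  congr 1
  refine intervalIntegral.integral_congr_ae ?_
  filter_upwards [ae_uIoc_of_ae_Ioi hmul hs hst] with x hx hx2
  rw [hx hx2 j]; ring

/-- The cross term `⟪U, B h⟫`, truncated to finitely many modes. -/
theorem cross_identity [CompleteSpace S] (ι : V →L[ℝ] H) (B : J → V) (e : J → S →L[ℝ] ℝ)
    (hw : L2Loc w) (hk : L2Loc k)
    {U : ℝ → H} {c : S} (hU : ∀ v s t, 0 ≤ s → s ≤ t →
        (inner ℝ (U t) (ι v) : ℝ) = inner ℝ (U s) (ι v) + ∫ x in s..t, w x v)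
    {s t : ℝ} (hs : 0 ≤ s) (hst : s ≤ t) (F : Finset J) :
    IntervalIntegrable (fun x => ∑ j ∈ F, (e j (k x) * inner ℝ (U x) (ι (B j)) +
        e j (c + ∫ y in (0 : ℝ)..x, k y) * w x (B j))) volume s t ∧
    ∑ j ∈ F, e j (c + ∫ y in (0 : ℝ)..t, k y) * inner ℝ (U t) (ι (B j)) =
      ∑ j ∈ F, e j (c + ∫ y in (0 : ℝ)..s, k y) * inner ℝ (U s) (ι (B j)) +
      ∫ x in s..t, ∑ j ∈ F, (e j (k x) * inner ℝ (U x) (ι (B j)) +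
        e j (c + ∫ y in (0 : ℝ)..x, k y) * w x (B j)) := by
  have hp := hk.locInt.isPrimitiveOn c hs hst
  have hp1 : ∀ j, IsPrimitiveOn (fun x => e j (c + ∫ y in (0 : ℝ)..x, k y))
      (fun x => e j (k x)) s t := fun j => by
    refine ⟨(hk.comp_clm (e j)).locInt.intervalIntegrable hs (hs.trans hst), fun x hx => ?_⟩
    rw [hp.eq_add x hx, map_add, (e j).intervalIntegral_comp_comm
      (hk.locInt.intervalIntegrable hs (hs.trans hx.1))]
  have hp2 : ∀ j, IsPrimitiveOn (fun x => (inner ℝ (U x) (ι (B j)) : ℝ)) (fun x => w x (B j)) s t :=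
    fun j => ⟨(hw.comp_clm (ContinuousLinearMap.apply ℝ ℝ (B j))).locInt.intervalIntegrable hs
      (hs.trans hst), fun x hx => hU _ s x hs hx.1⟩
  have hi : ∀ j, IntervalIntegrable (fun x => e j (k x) * inner ℝ (U x) (ι (B j)) +
        e j (c + ∫ y in (0 : ℝ)..x, k y) * w x (B j)) volume s t := fun j => by
    have i1 := intervalIntegrable_bilin_left (ContinuousLinearMap.mul ℝ ℝ) hst (hp1 j).integrable
      ((hp2 j).continuousOn hst)
    have i2 := intervalIntegrable_bilin_left (ContinuousLinearMap.mul ℝ ℝ).flip hst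
      (hp2 j).integrable ((hp1 j).continuousOn hst)
    exact i1.add i2
  refine ⟨intervalIntegrable_finset_sum hi, ?_⟩
  rw [intervalIntegral.integral_finsetSum fun j _ => hi j, ← Finset.sum_add_distrib]
  exact Finset.sum_congr rfl fun j _ => (hp1 j).bilin (ContinuousLinearMap.mul ℝ ℝ) hst (hp2 j)

/-- Three facts combine: the energy `Q` drops exactly by half the dissipation, the dissipation over
any interval is at most `2 Q s`, and the cross term shows that the time integral of the surface
energy is at most a multiple of `Q s`. -/
theorem IsEvolution.decay [Countable J] [CompleteSpace V] [CompleteSpace H] [CompleteSpace S]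
    (hE : IsEvolution ι A e μ B C u h w m k) (hf : IsDecayFrame ι A e μ B C) :
    ∃ (U : ℝ → H) (η : ℝ → S), ContinuousOn U (Ici 0) ∧ ContinuousOn η (Ici 0) ∧
      (∀ᵐ t ∂volume.restrict (Ioi 0), U t = ι (u t)) ∧
      (∀ᵐ t ∂volume.restrict (Ioi 0), η t = h t) ∧
      ((Summable fun j => μ j * e j (η 0) ^ 2) → ∀ t, 0 ≤ t →
        (Summable fun j => μ j * e j (η t) ^ 2) ∧
        1 / 2 * ‖U t‖ ^ 2 + 1 / 2 * ∑' j, μ j * e j (η t) ^ 2 ≤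
          2 * Real.exp (-(Real.log 2 / (2 * decayConst C)) * t) *
            (1 / 2 * ‖U 0‖ ^ 2 + 1 / 2 * ∑' j, μ j * e j (η 0) ^ 2)) := by
  obtain ⟨U, hUc, hUae, hUn, hUi⟩ :=
    exists_continuousOn_energy_identity ι hE.memU hE.memW hE.derivU
  obtain ⟨c, hc⟩ := exists_ae_eq_add_integral hE.memH.locInt hE.memK.locInt hE.derivH
  have hC := hf.pos
  have he := hf.parseval
  set η : ℝ → S := fun t => c + ∫ y in (0 : ℝ)..t, k y with hη
  have hηae : ∀ᵐ t ∂volume.restrict (Ioi 0), η t = h t := hc.mono fun t ht => ht.symm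
  have hmul : ∀ᵐ t ∂volume.restrict (Ioi 0), ∀ j, e j (m t) = μ j * e j (η t) := by
    filter_upwards [hηae, hE.multiplier] with t h1 h2 j
    rw [h1, h2]
  have hηc : ContinuousOn η (Ici 0) := fun t ht => by
    have ht0 : (0 : ℝ) ≤ t := ht
    have h1 := (hE.memK.locInt.isPrimitiveOn c le_rfl (by linarith : 0 ≤ t + 1)).continuousOn
      (by linarith) t ⟨ht0, by linarith⟩
    refine h1.mono_of_mem_nhdsWithin ?_
    filter_upwards [self_mem_nhdsWithin, mem_nhdsWithin_of_mem_nhds (Iio_mem_nhds (lt_add_one t))]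
      with x (h1 : 0 ≤ x) (h2 : x < t + 1)
    exact ⟨h1, h2.le⟩
  refine ⟨U, η, hUc, hηc, hUae, hηae, fun hsum => ?_⟩
  -- Finite surface energy is assumed at time `0` only; the balance of surface energy propagates it
  -- to every later time, not just almost every one.
  have hsum' : ∀ t, 0 ≤ t → Summable fun j => μ j * e j (η t) ^ 2 := fun t ht =>
    (hasSum_surface he hE.memM hE.memK hmul le_rfl ht hsum.hasSum).summable
  intro t ht
  refine ⟨hsum' t ht, ?_⟩
  set P : ℝ → ℝ := fun t => ∑' j, μ j * e j (η t) ^ 2 with hP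
  set Q : ℝ → ℝ := fun t => 1 / 2 * ‖U t‖ ^ 2 + 1 / 2 * P t with hQ
  have hP0 : ∀ t, 0 ≤ P t := fun t => tsum_nonneg fun j =>
    mul_nonneg (hf.symbol_nonneg j) (sq_nonneg _)
  have hPstep : ∀ s t, 0 ≤ s → s ≤ t →
      P t = P s + 2 * ∫ x in s..t, inner ℝ (m x) (k x) := fun s t hs hst =>
    (hasSum_surface he hE.memM hE.memK hmul hs hst (hsum' s hs).hasSum).tsum_eq
  have hAi : ∀ s t, 0 ≤ s → s ≤ t → IntervalIntegrable (fun x => ‖A (u x)‖ ^ 2) volume s t :=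
    fun s t hs hst => by
      have := ((hE.memU.comp_clm A).inner (hE.memU.comp_clm A)).intervalIntegrable hs (hs.trans hst)
      simpa only [real_inner_self_eq_norm_sq] using this
  have hmki : ∀ s t, 0 ≤ s → s ≤ t →
      IntervalIntegrable (fun x => (inner ℝ (m x) (k x) : ℝ)) volume s t :=
    fun s t hs hst => (hE.memM.inner hE.memK).intervalIntegrable hs (hs.trans hst)
  -- The power `⟪m, k⟫` leaves the kinetic energy and enters the surface energy, so it cancels in
  -- the sum.
  have hstep : ∀ s t, 0 ≤ s → s ≤ t → Q t = Q s - 1 / 2 * ∫ x in s..t, ‖A (u x)‖ ^ 2 := by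
    intro s t hs hst
    have e1 : ∫ x in s..t, w x (u x) =
        -(1 / 2 * ∫ x in s..t, ‖A (u x)‖ ^ 2) - ∫ x in s..t, inner ℝ (m x) (k x) := by
      rw [← neg_mul, ← intervalIntegral.integral_const_mul,
        ← intervalIntegral.integral_sub ((hAi s t hs hst).const_mul _) (hmki s t hs hst)]
      refine intervalIntegral.integral_congr_ae ?_
      filter_upwards [ae_uIoc_of_ae_Ioi hE.energy_eq hs hst] with x hx hx2
      linarith [hx hx2]
    simp only [hQ]
    rw [hUn s t hs hst, hPstep s t hs hst, e1]
    ring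
  have hD0 : ∀ s t, s ≤ t → 0 ≤ ∫ x in s..t, ‖A (u x)‖ ^ 2 := fun s t hst =>
    intervalIntegral.integral_nonneg hst fun x _ => sq_nonneg _
  have hQ0 : ∀ t, 0 ≤ t → 0 ≤ Q t := fun t _ => by
    have := hP0 t
    positivity
  have hanti : ∀ s t, 0 ≤ s → s ≤ t → Q t ≤ Q s := fun s t hs hst => by
    rw [hstep s t hs hst]
    linarith [hD0 s t hst]
  have hD : ∀ s t, 0 ≤ s → s ≤ t → ∫ x in s..t, ‖A (u x)‖ ^ 2 ≤ 2 * Q s := fun s t hs hst => by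
    have := hstep s t hs hst
    linarith [hQ0 t (hs.trans hst)]
  have hX : ∀ (F : Finset J) t, 0 ≤ t →
      |∑ j ∈ F, e j (η t) * inner ℝ (U t) (ι (B j))| ≤ (1 + C ^ 2) * Q t := fun F t ht => by
    have e1 : ∑ j ∈ F, e j (η t) * inner ℝ (U t) (ι (B j)) =
        inner ℝ (U t) (ι (∑ j ∈ F, e j (η t) • B j)) := by
      simp only [map_sum, map_smul, inner_sum, inner_smul_right]
    have h1 := hf.lift_energy F (fun j => e j (η t))
    have h2 : ∑ j ∈ F, e j (η t) ^ 2 ≤ C * P t := by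
      calc ∑ j ∈ F, e j (η t) ^ 2 ≤ ∑ j ∈ F, C * (μ j * e j (η t) ^ 2) :=
            Finset.sum_le_sum fun j _ => by
              nlinarith [mul_le_mul_of_nonneg_right (hf.one_le j) (sq_nonneg (e j (η t)))]
        _ = C * ∑ j ∈ F, μ j * e j (η t) ^ 2 := by rw [Finset.mul_sum]
        _ ≤ C * P t := mul_le_mul_of_nonneg_left (sum_le_hasSum F (fun j _ =>
            mul_nonneg (hf.symbol_nonneg j) (sq_nonneg _)) (hsum' t ht).hasSum) hC.le
    rw [e1]
    refine (abs_real_inner_le_norm _ _).trans ?_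
    have h3 : ‖ι (∑ j ∈ F, e j (η t) • B j)‖ ^ 2 ≤ C * (C * P t) :=
      h1.trans (mul_le_mul_of_nonneg_left h2 hC.le)
    simp only [hQ]
    nlinarith [sq_nonneg (‖U t‖ - ‖ι (∑ j ∈ F, e j (η t) • B j)‖), hP0 t,
      mul_nonneg (sq_nonneg C) (sq_nonneg ‖U t‖)]
  refine exp_decay_of_antitone (C := decayConst C) (by unfold decayConst; positivity) hQ0 hanti
    (fun s t hs hst => ?_) ht
  -- Only finite truncations of the lift are used as test fields; as the bound does not depend on
  -- `F`, it passes to the full sum.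
  have hPF : ∀ F : Finset J, ∑ j ∈ F, ∫ x in Ioo s t, e j (m x) * e j (h x) ≤
      2 * ((1 + C ^ 2) * (2 * Q s) + (1 / 2 * (C + C ^ 2) + C / 8) * (2 * Q s)) := by
    intro F
    obtain ⟨hci, hcross⟩ := cross_identity (c := c) ι B e hE.memW hE.memK hUi hs hst F
    have i1 : ∀ j, IntervalIntegrable (fun x => e j (m x) * e j (h x)) volume s t := fun j => by
      have := ((hE.memM.comp_clm (e j)).inner (hE.memH.comp_clm (e j))).intervalIntegrable hs
        (hs.trans hst)
      simpa [mul_comm] using this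
    have i2 : IntervalIntegrable (fun x => ∑ j ∈ F, e j (m x) * e j (h x)) volume s t :=
      intervalIntegrable_finset_sum i1
    have i3 := ((hAi s t hs hst).const_mul (1 / 2 * (C + C ^ 2) + C / 8)).sub (i2.const_mul (1 / 2))
    have hle := intervalIntegral.integral_mono_ae_restrict (μ := volume) hst hci i3 (by
      rw [EventuallyLE, ← restrict_Ioo_eq_restrict_Icc]
      filter_upwards [ae_restrict_Ioo_of_Ioi hUae hs, ae_restrict_Ioo_of_Ioi hηae hs,
        ae_restrict_Ioo_of_Ioi hE.multiplier hs, ae_restrict_Ioo_of_Ioi hE.lift_eq hs,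
        ae_restrict_Ioo_of_Ioi hE.trace_le hs] with x h1 h2 h3 h4 h5
      have := hf.cross_le h3 h4 h5 F
      rw [← h1, ← h2] at this
      rw [← h2]
      exact this)
    rw [intervalIntegral.integral_sub ((hAi s t hs hst).const_mul _) (i2.const_mul _),
      intervalIntegral.integral_const_mul, intervalIntegral.integral_const_mul,
      intervalIntegral.integral_finsetSum fun j _ => i1 j] at hle
    simp_rw [← intervalIntegral_eq_integral_Ioo _ hst]
    have hXs := hX F s hs
    have hXt := hX F t (hs.trans hst)
    have h1 := hanti s t hs hst
    have h2 : (1 + C ^ 2) * Q t ≤ (1 + C ^ 2) * Q s := by gcongr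
    have h3 : (1 / 2 * (C + C ^ 2) + C / 8) * ∫ x in s..t, ‖A (u x)‖ ^ 2 ≤
        (1 / 2 * (C + C ^ 2) + C / 8) * (2 * Q s) := by
      gcongr; exact hD s t hs hst
    rw [abs_le] at hXs hXt
    linarith [hXs.2, hXt.1]
  have hPint : ∫ x in s..t, inner ℝ (m x) (h x) ≤
      2 * ((1 + C ^ 2) * (2 * Q s) + (1 / 2 * (C + C ^ 2) + C / 8) * (2 * Q s)) := by
    rw [intervalIntegral_eq_integral_Ioo _ hst]
    exact hasSum_le_of_sum_le (he.hasSum_integral_mul (hE.memM.mono hs) (hE.memH.mono hs)) hPF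
  have i4 : IntervalIntegrable (fun x => C / 2 * ‖A (u x)‖ ^ 2 + 1 / 2 * inner ℝ (m x) (h x))
      volume s t := ((hAi s t hs hst).const_mul _).add
        (((hE.memM.inner hE.memH).intervalIntegrable hs (hs.trans hst)).const_mul _)
  -- By monotonicity `Q t` is below `Q x` for all `x < t`, and almost everywhere `Q x` is below the
  -- dissipation plus half the surface pairing. Integration produces `(t - s) * Q t`.
  have hlow := intervalIntegral.integral_mono_ae_restrict (μ := volume) hst
    (intervalIntegrable_const (c := Q t)) i4 (by
      rw [EventuallyLE, ← restrict_Ioo_eq_restrict_Icc]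
      filter_upwards [ae_restrict_Ioo_of_Ioi hUae hs, ae_restrict_Ioo_of_Ioi hηae hs,
        ae_restrict_Ioo_of_Ioi hE.multiplier hs, ae_restrict_mem measurableSet_Ioo] with x h1 h2 h3 h4
      refine (hanti x t (hs.trans h4.1.le) h4.2.le).trans ?_
      have h5 : P x = inner ℝ (m x) (h x) := by
        rw [← (he.hasSum_mul (m x) (h x)).tsum_eq]
        refine tsum_congr fun j => ?_
        rw [h2, h3 j]; ring
      simp only [hQ]
      rw [h5, h1]
      linarith [hf.korn (u x)])
  rw [intervalIntegral.integral_const, smul_eq_mul, intervalIntegral.integral_add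
    ((hAi s t hs hst).const_mul _)
      (((hE.memM.inner hE.memH).intervalIntegrable hs (hs.trans hst)).const_mul _),
    intervalIntegral.integral_const_mul, intervalIntegral.integral_const_mul] at hlow
  have h1 : C / 2 * ∫ x in s..t, ‖A (u x)‖ ^ 2 ≤ C / 2 * (2 * Q s) := by
    gcongr; exact hD s t hs hst
  unfold decayConst
  linarith

end Decay

/-! ### Calculus on the slab -/

section SlabCalculus

variable {d : ℕ} {ℓ : ℝ}

theorem cover_single_last (s : ℝ) : cover d (Pi.single (Fin.last d) s) = (0, s) := by
  ext j
  · simp [cover]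
  · simp [cover]

theorem cover_single_castSucc (i : Fin d) (s : ℝ) :
    cover d (Pi.single i.castSucc s) = (Pi.single i (s : UnitAddCircle), 0) := by
  ext j
  · rcases eq_or_ne j i with rfl | h
    · simp [cover]
    · simp [cover, h]
  · simp [cover]

theorem hasDerivAt_line {φ : UnitAddTorus (Fin d) × ℝ → ℝ} (h : IsSmooth φ) (i : Fin (d + 1))
    (p : UnitAddTorus (Fin d) × ℝ) (t : ℝ) :
    HasDerivAt (fun s : ℝ => φ (p + cover d (Pi.single i s)))
      (pd i φ (p + cover d (Pi.single i t))) t := by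
  have h0 : ∀ q, HasDerivAt (fun s : ℝ => φ (q + cover d (Pi.single i s))) (pd i φ q) 0 := by
    intro q
    obtain ⟨z, rfl⟩ := (isOpenQuotientMap_cover d).surjective q
    have h4 : (fun s : ℝ => φ (cover d z + cover d (Pi.single i s))) =
        fun s : ℝ => (φ ∘ cover d) (z + s • Pi.single i (1 : ℝ)) := by
      ext s
      rw [Function.comp_apply, cover_add, ← Pi.single_smul]
      simp
    have hd : DifferentiableAt ℝ (φ ∘ cover d) z := (ContDiff.differentiable h (by simp)) z
    have h3 := hd.hasFDerivAt.hasLineDerivAt (Pi.single i 1)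
    refine DifferentiableAt.hasDerivAt ?_
    rw [h4]
    exact HasDerivAt.differentiableAt h3
  have h1 := h0 (p + cover d (Pi.single i t))
  have h2 : HasDerivAt (fun s : ℝ => s - t) 1 t := (hasDerivAt_id t).sub_const t
  rw [show (0 : ℝ) = t - t by ring] at h1
  have h3 := HasDerivAt.comp (h := fun s : ℝ => s - t) t h1 h2
  rw [mul_one] at h3
  refine h3.congr_of_eventuallyEq (Eventually.of_forall fun s => ?_)
  simp only [Function.comp_apply]
  rw [add_assoc, ← cover_add, ← Pi.single_add]
  congr 4
  ring

theorem IsSmooth.mul {φ ψ : UnitAddTorus (Fin d) × ℝ → ℝ} (hφ : IsSmooth φ) (hψ : IsSmooth ψ) :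
    IsSmooth fun p => φ p * ψ p := ContDiff.mul hφ hψ

theorem pd_mul {φ ψ : UnitAddTorus (Fin d) × ℝ → ℝ} (hφ : IsSmooth φ) (hψ : IsSmooth ψ)
    (i : Fin (d + 1)) (p : UnitAddTorus (Fin d) × ℝ) :
    pd i (fun p => φ p * ψ p) p = pd i φ p * ψ p + φ p * pd i ψ p := by
  have h := (hasDerivAt_line hφ i p 0).mul (hasDerivAt_line hψ i p 0)
  have e0 : cover d (Pi.single i 0) = 0 := by
    rw [Pi.single_zero]; ext <;> simp [cover]
  simp only [e0, add_zero] at h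
  exact h.deriv

theorem exists_ae_bound_slab {ψ : UnitAddTorus (Fin d) × ℝ → ℝ} (hψ : Continuous ψ) (ℓ : ℝ) :
    ∃ C, ∀ᵐ p ∂slabMeasure d ℓ, ‖ψ p‖ ≤ C := by
  have hK : IsCompact ((univ : Set (UnitAddTorus (Fin d))) ×ˢ Icc (0 : ℝ) ℓ) :=
    isCompact_univ.prod isCompact_Icc
  obtain ⟨C, hC⟩ := hK.exists_bound_of_continuousOn hψ.continuousOn
  refine ⟨C, ?_⟩
  have hm : slabMeasure d ℓ = ((torusMeasure d).prod volume).restrict (univ ×ˢ Ioo 0 ℓ) := by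
    rw [← Measure.prod_restrict, Measure.restrict_univ]
  rw [hm]
  filter_upwards [ae_restrict_mem (MeasurableSet.univ.prod measurableSet_Ioo)] with p hp
  exact hC p ⟨hp.1, Ioo_subset_Icc_self hp.2⟩

theorem memLp_slab_of_continuous {ψ : UnitAddTorus (Fin d) × ℝ → ℝ} (hψ : Continuous ψ)
    (q : ℝ≥0∞) : MemLp ψ q (slabMeasure d ℓ) := by
  obtain ⟨C, hC⟩ := exists_ae_bound_slab hψ ℓ
  exact MemLp.of_bound hψ.aestronglyMeasurable C hC

theorem integrable_slab_of_continuous {ψ : UnitAddTorus (Fin d) × ℝ → ℝ} (hψ : Continuous ψ) :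
    Integrable ψ (slabMeasure d ℓ) :=
  memLp_one_iff_integrable.1 (memLp_slab_of_continuous hψ 1)

theorem continuous_pd {φ : UnitAddTorus (Fin d) × ℝ → ℝ} (h : IsSmooth φ) (i : Fin (d + 1)) :
    Continuous (pd i φ) := (h.pd i).continuous

theorem integrable_torus_of_continuous {ψ : UnitAddTorus (Fin d) → ℝ} (hψ : Continuous ψ) :
    Integrable ψ (torusMeasure d) :=
  hψ.integrable_of_hasCompactSupport (HasCompactSupport.of_compactSpace ψ)

theorem integral_pd_last (hℓ : 0 < ℓ) {φ : UnitAddTorus (Fin d) × ℝ → ℝ} (h : IsSmooth φ) :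
    ∫ p, pd (Fin.last d) φ p ∂slabMeasure d ℓ =
      ∫ x, φ (x, ℓ) ∂torusMeasure d - ∫ x, φ (x, 0) ∂torusMeasure d := by
  have hc := h.continuous
  rw [integral_prod _ (integrable_slab_of_continuous (continuous_pd h _)), ← integral_sub
    (integrable_torus_of_continuous (by fun_prop)) (integrable_torus_of_continuous (by fun_prop))]
  refine integral_congr_ae (Eventually.of_forall fun x => ?_)
  have hd : ∀ y : ℝ, HasDerivAt (fun y => φ (x, y)) (pd (Fin.last d) φ (x, y)) y := fun y => by
    have := hasDerivAt_line h (Fin.last d) (x, 0) y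
    simpa [cover_single_last] using this
  have hcd := continuous_pd h (Fin.last d)
  have := intervalIntegral.integral_eq_sub_of_hasDerivAt (a := 0) (b := ℓ) (fun y _ => hd y)
    (Continuous.intervalIntegrable (by fun_prop) _ _)
  rw [intervalIntegral_eq_integral_Ioo _ hℓ.le] at this
  exact this

/-- The integral is translation invariant, so it equals its average over translations by `s ∈ (0,
1)` in direction `i`. After Fubini the integral in `s` is a difference of values at the two ends of
a period. -/
theorem integral_torus_pd {φ : UnitAddTorus (Fin d) × ℝ → ℝ} (h : IsSmooth φ) (i : Fin d) (y : ℝ) :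
    ∫ x, pd i.castSucc φ (x, y) ∂torusMeasure d = 0 := by
  have hcd := continuous_pd h i.castSucc
  have hc := h.continuous
  let τ : ℝ → UnitAddTorus (Fin d) := fun s => Pi.single i (s : UnitAddCircle)
  have hτ : Continuous τ := (continuous_single i).comp (AddCircle.continuous_mk' 1)
  have e1 : ∀ s : ℝ, ∫ x, pd i.castSucc φ (x + τ s, y) ∂torusMeasure d =
      ∫ x, pd i.castSucc φ (x, y) ∂torusMeasure d := fun s =>
    integral_add_right_eq_self (fun x => pd i.castSucc φ (x, y)) (τ s)
  have e2 : ∫ x, pd i.castSucc φ (x, y) ∂torusMeasure d =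
      ∫ s in Ioo (0 : ℝ) 1, ∫ x, pd i.castSucc φ (x + τ s, y) ∂torusMeasure d := by
    simp only [e1]
    simp
  have hi : Integrable (fun q : UnitAddTorus (Fin d) × ℝ => pd i.castSucc φ (q.1 + τ q.2, y))
      (slabMeasure d 1) := integrable_slab_of_continuous (by fun_prop)
  rw [e2, ← integral_integral_swap (f := fun x s => pd i.castSucc φ (x + τ s, y)) hi]
  have e3 : ∀ x, ∫ s in Ioo (0 : ℝ) 1, pd i.castSucc φ (x + τ s, y) = 0 := fun x => by
    rw [← intervalIntegral_eq_integral_Ioo _ zero_le_one]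
    have hd : ∀ s : ℝ, HasDerivAt (fun s => φ (x + τ s, y)) (pd i.castSucc φ (x + τ s, y)) s :=
      fun s => by
        have := hasDerivAt_line h i.castSucc (x, y) s
        simpa [cover_single_castSucc] using this
    rw [intervalIntegral.integral_eq_sub_of_hasDerivAt (fun s _ => hd s)
      (Continuous.intervalIntegrable (by fun_prop) _ _)]
    have : τ 1 = τ 0 := by
      simp only [τ]
      congr 1
      rw [AddCircle.coe_period 1, QuotientAddGroup.mk_zero]
    rw [this, sub_self]
  simp [e3]

theorem integral_pd_castSucc {φ : UnitAddTorus (Fin d) × ℝ → ℝ} (h : IsSmooth φ) (i : Fin d) :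
    ∫ p, pd i.castSucc φ p ∂slabMeasure d ℓ = 0 := by
  rw [integral_prod_symm _ (integrable_slab_of_continuous (continuous_pd h _))]
  simp [integral_torus_pd h]

/-! ### Fourier modes on the slab -/

theorem mFourier_cover (ξ : Fin d → ℤ) (z : Fin (d + 1) → ℝ) :
    UnitAddTorus.mFourier ξ (cover d z).1 =
      Complex.exp (2 * Real.pi * Complex.I * ∑ j, (ξ j * z j.castSucc : ℂ)) := by
  simp only [UnitAddTorus.mFourier, cover, ContinuousMap.coe_mk, fourier_coe_apply]
  rw [← Complex.exp_sum, Finset.mul_sum]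
  congr 1
  refine Finset.sum_congr rfl fun j _ => ?_
  push_cast
  ring

theorem mFourier_add_single (ξ : Fin d → ℤ) (x : UnitAddTorus (Fin d)) (i : Fin d) (s : ℝ) :
    UnitAddTorus.mFourier ξ (x + Pi.single i (s : UnitAddCircle)) =
      UnitAddTorus.mFourier ξ x * Complex.exp (2 * Real.pi * Complex.I * ξ i * s) := by
  obtain ⟨z, hz⟩ := (isOpenQuotientMap_cover d).surjective (x, 0)
  have h1 : x = (cover d z).1 := by rw [hz]
  have h2 : x + Pi.single i (s : UnitAddCircle) = (cover d (z + Pi.single i.castSucc s)).1 := by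
    rw [cover_add, cover_single_castSucc, Prod.fst_add, ← h1]
  rw [h2, h1, mFourier_cover, mFourier_cover, ← Complex.exp_add]
  congr 1
  simp only [Pi.add_apply, Complex.ofReal_add, mul_add, Finset.sum_add_distrib]
  congr 1
  rw [Finset.sum_eq_single i]
  · simp; ring
  · intro j _ hj; simp [hj]
  · simp

/-- The real function `Re (ζ e^{2πi ξ·x}) χ(y)`. -/
def mode (ξ : Fin d → ℤ) (ζ : ℂ) (χ : ℝ → ℝ) (p : UnitAddTorus (Fin d) × ℝ) : ℝ :=
  (ζ * UnitAddTorus.mFourier ξ p.1).re * χ p.2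

theorem isSmooth_mode (ξ : Fin d → ℤ) (ζ : ℂ) {χ : ℝ → ℝ} (hχ : ContDiff ℝ ∞ χ) :
    IsSmooth (mode ξ ζ χ) := by
  have e : mode ξ ζ χ ∘ cover d = fun z => (ζ * Complex.exp
      (2 * Real.pi * Complex.I * ∑ j, ξ j * (z j.castSucc : ℂ))).re * χ (z (Fin.last d)) := by
    ext z
    rw [Function.comp_apply, mode, mFourier_cover]
    rfl
  unfold IsSmooth
  rw [e]
  refine ContDiff.mul (Complex.reCLM.contDiff.comp (contDiff_const.mul ?_))
    (hχ.comp (contDiff_apply _ _ _))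
  refine Complex.contDiff_exp.comp (contDiff_const.mul (ContDiff.sum fun j _ => ?_))
  exact contDiff_const.mul (Complex.ofRealCLM.contDiff.comp (contDiff_apply _ _ _))

theorem pd_last_mode (ξ : Fin d → ℤ) (ζ : ℂ) (χ : ℝ → ℝ) :
    pd (Fin.last d) (mode ξ ζ χ) = mode ξ ζ (deriv χ) := by
  ext p
  simp only [pd, cover_single_last, mode, Prod.fst_add, add_zero, Prod.snd_add]
  rw [deriv_const_mul_field, deriv_comp_const_add, add_zero]

theorem pd_castSucc_mode (ξ : Fin d → ℤ) (ζ : ℂ) (χ : ℝ → ℝ) (i : Fin d) :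
    pd i.castSucc (mode ξ ζ χ) = mode ξ (ζ * (2 * Real.pi * Complex.I * ξ i)) χ := by
  ext p
  simp only [pd, cover_single_castSucc, mode, Prod.fst_add, Prod.snd_add, add_zero,
    mFourier_add_single]
  rw [deriv_mul_const_field]
  congr 1
  have h1 : HasDerivAt (fun s : ℝ => Complex.exp (2 * Real.pi * Complex.I * ξ i * s))
      (2 * Real.pi * Complex.I * ξ i) 0 := by
    have h2 : HasDerivAt (fun s : ℝ => 2 * Real.pi * Complex.I * ξ i * (s : ℂ))
        (2 * Real.pi * Complex.I * ξ i) 0 := by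
      simpa using (Complex.ofRealCLM.hasDerivAt (x := (0 : ℝ))).const_mul
        (2 * Real.pi * Complex.I * (ξ i : ℂ))
    simpa using h2.cexp
  have h3 := (h1.const_mul (ζ * UnitAddTorus.mFourier ξ p.1))
  have h4 := (Complex.reCLM.hasFDerivAt.comp_hasDerivAt 0 h3).deriv
  simp only [Function.comp_def, Complex.reCLM_apply] at h4
  simp only [mul_assoc] at h4 ⊢
  rw [h4]
  congr 2
  ring

end SlabCalculus

/-! ### Smooth fields as elements of the solenoidal space -/

section SmoothFields

variable {d : ℕ} {ℓ : ℝ}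

theorem norm_sq_eq_integral_sum {α ι : Type*} [MeasurableSpace α] {ν : Measure α} [Fintype ι]
    (f : Lp (EuclideanSpace ℝ ι) 2 ν) : ‖f‖ ^ 2 = ∫ p, ∑ i, f p i ^ 2 ∂ν := by
  rw [← real_inner_self_eq_norm_sq, L2.inner_def]
  refine integral_congr_ae (Eventually.of_forall fun p => ?_)
  simp only [real_inner_self_eq_norm_sq, EuclideanSpace.norm_sq_eq, Real.norm_eq_abs, sq_abs]

theorem memLp_coord {α ι : Type*} [MeasurableSpace α] {ν : Measure α} [Fintype ι]
    (f : Lp (EuclideanSpace ℝ ι) 2 ν) (i : ι) : MemLp (fun p => f p i) 2 ν :=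
  (Lp.memLp f).eval_piLp i

theorem norm_sq_eq_sum_integral {α ι : Type*} [MeasurableSpace α] {ν : Measure α} [Fintype ι]
    (f : Lp (EuclideanSpace ℝ ι) 2 ν) : ‖f‖ ^ 2 = ∑ i, ∫ p, f p i ^ 2 ∂ν := by
  rw [norm_sq_eq_integral_sum, integral_finsetSum _ fun i _ => (memLp_coord f i).integrable_sq]

/-- The class in `L²(Ω)` of a vector field with continuous components. -/
def fieldL2 {ι : Type} [Fintype ι] (ℓ : ℝ) (f : ι → UnitAddTorus (Fin d) × ℝ → ℝ)
    (hf : ∀ i, Continuous (f i)) : Lp (EuclideanSpace ℝ ι) 2 (slabMeasure d ℓ) :=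
  MemLp.toLp (fun p => WithLp.toLp 2 fun i => f i p)
    (MemLp.of_eval_piLp fun i => memLp_slab_of_continuous (hf i) 2)

theorem fieldL2_ae {ι : Type} [Fintype ι] (f : ι → UnitAddTorus (Fin d) × ℝ → ℝ)
    (hf : ∀ i, Continuous (f i)) :
    ∀ᵐ p ∂slabMeasure d ℓ, ∀ i, fieldL2 ℓ f hf p i = f i p := by
  have h : fieldL2 ℓ f hf =ᵐ[slabMeasure d ℓ] _ := MemLp.coeFn_toLp _
  filter_upwards [h] with p hp i
  rw [hp]

theorem integral_fieldL2_mul {ι : Type} [Fintype ι] (f : ι → UnitAddTorus (Fin d) × ℝ → ℝ)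
    (hf : ∀ i, Continuous (f i)) (i : ι) (ψ : UnitAddTorus (Fin d) × ℝ → ℝ) :
    ∫ p, fieldL2 ℓ f hf p i * ψ p ∂slabMeasure d ℓ = ∫ p, f i p * ψ p ∂slabMeasure d ℓ := by
  refine integral_congr_ae ?_
  filter_upwards [fieldL2_ae (ℓ := ℓ) f hf] with p hp
  rw [hp]

theorem integral_pd_mul_add {f φ : UnitAddTorus (Fin d) × ℝ → ℝ} (hf : IsSmooth f)
    (hφ : IsSmooth φ) (i : Fin (d + 1)) :
    (∫ p, pd i f p * φ p ∂slabMeasure d ℓ) + ∫ p, f p * pd i φ p ∂slabMeasure d ℓ =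
      ∫ p, pd i (fun p => f p * φ p) p ∂slabMeasure d ℓ := by
  rw [← integral_add]
  · simp_rw [pd_mul hf hφ]
  · exact integrable_slab_of_continuous ((continuous_pd hf i).mul hφ.continuous)
  · exact integrable_slab_of_continuous (hf.continuous.mul (continuous_pd hφ i))

/-- The class in `L²(Ω)` of the gradient of a smooth field. -/
def gradientL2 (ℓ : ℝ) (v : Fin (d + 1) → UnitAddTorus (Fin d) × ℝ → ℝ)
    (hv : ∀ j, IsSmooth (v j)) : GradientL2 d ℓ :=
  fieldL2 ℓ (fun q : Fin (d + 1) × Fin (d + 1) => pd q.1 (v q.2))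
    fun q => continuous_pd (hv q.2) q.1

/-- A smooth solenoidal field vanishing at the bottom, as an element of `Solenoidal d ℓ`. -/
def smoothSolenoidal (hℓ : 0 < ℓ) (v : Fin (d + 1) → UnitAddTorus (Fin d) × ℝ → ℝ)
    (hv : ∀ j, IsSmooth (v j)) (hdiv : ∀ p, ∑ i, pd i (v i) p = 0) (h0 : ∀ j x, v j (x, 0) = 0) :
    Solenoidal d ℓ :=
  ⟨WithLp.toLp 2 (fieldL2 ℓ v fun j => (hv j).continuous,
    gradientL2 ℓ v hv), by
    refine ⟨fun φ hφ hs i j => ?_, fun j φ hφ hφℓ => ?_, ?_⟩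
    · change ∫ p, fieldL2 ℓ v (fun j => (hv j).continuous) p j * pd i φ p ∂slabMeasure d ℓ =
        -∫ p, gradientL2 ℓ v hv p (i, j) * φ p
          ∂slabMeasure d ℓ
      rw [integral_fieldL2_mul, gradientL2, integral_fieldL2_mul]
      have h1 := integral_pd_mul_add (ℓ := ℓ) (hv j) hφ i
      have hb : ∀ x y, y ∉ Ioo 0 ℓ → φ (x, y) = 0 := fun x y hy =>
        image_eq_zero_of_notMem_tsupport fun h => hy (hs h).2
      have h2 : ∫ p, pd i (fun p => v j p * φ p) p ∂slabMeasure d ℓ = 0 := by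
        induction i using Fin.lastCases with
        | last =>
          rw [integral_pd_last hℓ ((hv j).mul hφ)]
          simp [hb _ 0 (by simp), hb _ ℓ (by simp)]
        | cast i => exact integral_pd_castSucc ((hv j).mul hφ) i
      dsimp only
      linarith
    · change (∫ p, gradientL2 ℓ v hv p
          (Fin.last d, j) * φ p ∂slabMeasure d ℓ) +
        ∫ p, fieldL2 ℓ v (fun j => (hv j).continuous) p j * pd (Fin.last d) φ p ∂slabMeasure d ℓ = _
      rw [integral_fieldL2_mul, gradientL2, integral_fieldL2_mul]
      dsimp only
      rw [integral_pd_mul_add (hv j) hφ, integral_pd_last hℓ ((hv j).mul hφ)]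
      simp [h0, hφℓ]
    · filter_upwards [fieldL2_ae (ℓ := ℓ) (fun q : Fin (d + 1) × Fin (d + 1) => pd q.1 (v q.2))
        fun q => continuous_pd (hv q.2) q.1] with p hp
      have e : ∀ i, gradientL2 ℓ v hv p (i, i) = pd i (v i) p := fun i => hp (i, i)
      exact (Finset.sum_congr rfl fun i _ => e i).trans (hdiv p)⟩

section

variable (hℓ : 0 < ℓ) (v : Fin (d + 1) → UnitAddTorus (Fin d) × ℝ → ℝ)
    (hv : ∀ j, IsSmooth (v j)) (hdiv : ∀ p, ∑ i, pd i (v i) p = 0) (h0 : ∀ j x, v j (x, 0) = 0)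

theorem velocity_smoothSolenoidal_ae : ∀ᵐ p ∂slabMeasure d ℓ, ∀ j,
    velocity (smoothSolenoidal hℓ v hv hdiv h0) p j = v j p :=
  fieldL2_ae v fun j => (hv j).continuous

theorem velocityGradient_smoothSolenoidal_ae : ∀ᵐ p ∂slabMeasure d ℓ,
    ∀ q, velocityGradient (smoothSolenoidal hℓ v hv hdiv h0) p q = pd q.1 (v q.2) p :=
  fieldL2_ae (fun q : Fin (d + 1) × Fin (d + 1) => pd q.1 (v q.2))
    fun q => continuous_pd (hv q.2) q.1

theorem isTopNormalTrace_smoothSolenoidal {g : SurfaceL2 d}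
    (hg : ∀ᵐ x ∂torusMeasure d, g x = v (Fin.last d) (x, ℓ)) :
    IsTopNormalTrace (smoothSolenoidal hℓ v hv hdiv h0) g := by
  intro φ hφ hφ0
  change (∫ p, gradientL2 ℓ v hv p
      (Fin.last d, Fin.last d) * φ p ∂slabMeasure d ℓ) +
    ∫ p, fieldL2 ℓ v (fun j => (hv j).continuous) p (Fin.last d) * pd (Fin.last d) φ p ∂slabMeasure d ℓ = _
  rw [integral_fieldL2_mul, gradientL2, integral_fieldL2_mul]
  dsimp only
  rw [integral_pd_mul_add (hv _) hφ, integral_pd_last hℓ ((hv _).mul hφ)]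
  simp only [hφ0, mul_zero, integral_zero, sub_zero]
  refine integral_congr_ae ?_
  filter_upwards [hg] with x hx
  rw [hx]

end

/-! ### Orthogonality of the modes -/

theorem integral_norm_sq_sum_mFourier (F : Finset (Fin d → ℤ)) (z : (Fin d → ℤ) → ℂ) :
    ∫ x, ‖∑ ξ ∈ F, z ξ * UnitAddTorus.mFourier ξ x‖ ^ 2 ∂torusMeasure d = ∑ ξ ∈ F, ‖z ξ‖ ^ 2 := by
  have h := (UnitAddTorus.orthonormal_mFourier (d := Fin d)).inner_sum z z F
  rw [L2.inner_def] at h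
  have hc := Lp.coeFn_finsetSum F fun ξ => z ξ • UnitAddTorus.mFourierLp (d := Fin d) 2 ξ
  have h2 : ∀ ξ, (z ξ • UnitAddTorus.mFourierLp (d := Fin d) 2 ξ : Lp ℂ 2 (torusMeasure d))
      =ᵐ[torusMeasure d] fun x => z ξ * UnitAddTorus.mFourier ξ x := fun ξ => by
    filter_upwards [Lp.coeFn_smul (z ξ) (UnitAddTorus.mFourierLp (d := Fin d) 2 ξ),
      UnitAddTorus.coeFn_mFourierLp (d := Fin d) 2 ξ] with x h1 h2
    rw [h1, Pi.smul_apply, h2, smul_eq_mul]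
  have h3 : ∀ᵐ x ∂torusMeasure d, ∀ ξ ∈ F,
      (z ξ • UnitAddTorus.mFourierLp (d := Fin d) 2 ξ : Lp ℂ 2 (torusMeasure d)) x =
        z ξ * UnitAddTorus.mFourier ξ x :=
    (Finset.eventually_all F).2 fun ξ _ => h2 ξ
  apply Complex.ofReal_injective
  rw [← integral_complex_ofReal, Complex.ofReal_sum]
  refine Eq.trans ?_ (h.trans ?_)
  · refine integral_congr_ae ?_
    filter_upwards [hc, h3] with x h4 h5
    rw [h4, Finset.sum_apply, Finset.sum_congr rfl h5, inner_self_eq_norm_sq_to_K]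
    simp
  · refine Finset.sum_congr rfl fun ξ _ => ?_
    rw [Complex.conj_mul']
    simp

/-- The real waves of `ξ` and `-ξ` are not orthogonal, so the sum is viewed as the real part of a
complex trigonometric sum. Its modulus squared is computed on each slice by orthonormality of the
exponentials. -/
theorem integral_sq_sum_mode_le (F : Finset (Fin d → ℤ)) (a : (Fin d → ℤ) → ℂ)
    (ρ : (Fin d → ℤ) → ℝ → ℝ) (hρ : ∀ ξ, Continuous (ρ ξ)) :
    ∫ p, (∑ ξ ∈ F, mode ξ (a ξ) (ρ ξ) p) ^ 2 ∂slabMeasure d ℓ ≤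
      ∑ ξ ∈ F, ‖a ξ‖ ^ 2 * ∫ y in Ioo 0 ℓ, ρ ξ y ^ 2 := by
  have hmc : ∀ ξ, Continuous (mode ξ (a ξ) (ρ ξ)) := fun ξ => by
    have := hρ ξ
    unfold mode
    fun_prop
  have hcont : Continuous fun p => (∑ ξ ∈ F, mode ξ (a ξ) (ρ ξ) p) ^ 2 :=
    (continuous_finsetSum F fun ξ _ => hmc ξ).pow 2
  rw [integral_prod_symm _ (integrable_slab_of_continuous hcont)]
  have hi : ∀ ξ ∈ F, Integrable (fun y => ‖a ξ‖ ^ 2 * ρ ξ y ^ 2) (volume.restrict (Ioo 0 ℓ)) :=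
    fun ξ _ => ((((hρ ξ).pow 2).integrableOn_Icc).mono_set Ioo_subset_Icc_self).const_mul _
  simp_rw [← integral_const_mul]
  rw [← integral_finsetSum F hi]
  refine integral_mono (integrable_slab_of_continuous hcont).integral_prod_right
    (integrable_finsetSum F hi) fun y => ?_
  have h1 := integral_norm_sq_sum_mFourier F fun ξ => a ξ * ρ ξ y
  have e : ∀ ξ, ‖a ξ * (ρ ξ y : ℂ)‖ ^ 2 = ‖a ξ‖ ^ 2 * ρ ξ y ^ 2 := fun ξ => by
    rw [norm_mul, mul_pow, Complex.norm_real, Real.norm_eq_abs, sq_abs]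
  simp only [e] at h1
  rw [← h1]
  refine integral_mono (integrable_torus_of_continuous (by fun_prop))
    (integrable_torus_of_continuous (by fun_prop)) fun x => ?_
  have e2 : ∑ ξ ∈ F, mode ξ (a ξ) (ρ ξ) (x, y) =
      (∑ ξ ∈ F, a ξ * (ρ ξ y : ℂ) * UnitAddTorus.mFourier ξ x).re := by
    rw [Complex.re_sum]
    refine Finset.sum_congr rfl fun ξ _ => ?_
    rw [mode, mul_right_comm, Complex.re_mul_ofReal]
  simp only
  rw [e2, ← sq_abs]
  gcongr
  exact Complex.abs_re_le_norm _

/-- The phases of the real Fourier modes with frequency `ξ`; they vanish for `ξ = 0`. -/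
def phase (ξ : Fin d → ℤ) (b : Bool) : ℂ := if ξ = 0 then 0 else if b then Complex.I else 1

theorem mode_add (ξ : Fin d → ℤ) (a b : ℂ) (χ : ℝ → ℝ) (p : UnitAddTorus (Fin d) × ℝ) :
    mode ξ (a + b) χ p = mode ξ a χ p + mode ξ b χ p := by
  simp only [mode, add_mul, Complex.add_re]

theorem mode_smul (ξ : Fin d → ℤ) (c : ℝ) (a : ℂ) (χ : ℝ → ℝ) (p : UnitAddTorus (Fin d) × ℝ) :
    mode ξ (c * a) χ p = c * mode ξ a χ p := by
  simp only [mode, mul_assoc, Complex.re_ofReal_mul]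

/-- The two real phases of a frequency merge into one complex amplitude, reducing a sum over real
modes to the previous estimate. -/
theorem integral_sq_sum_phase_mode_le (F : Finset ((Fin d → ℤ) × Bool))
    (c : (Fin d → ℤ) × Bool → ℝ) (κ : (Fin d → ℤ) → ℂ) (ρ : (Fin d → ℤ) → ℝ → ℝ)
    (hρ : ∀ ξ, Continuous (ρ ξ)) (M : (Fin d → ℤ) → ℝ)
    (hM : ∀ ξ, ξ ≠ 0 → ‖κ ξ‖ ^ 2 * ∫ y in Ioo 0 ℓ, ρ ξ y ^ 2 ≤ M ξ) (hM0 : ∀ ξ, 0 ≤ M ξ) :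
    ∫ p, (∑ j ∈ F, c j * mode j.1 (phase j.1 j.2 * κ j.1) (ρ j.1) p) ^ 2 ∂slabMeasure d ℓ ≤
      ∑ j ∈ F, M j.1 * c j ^ 2 := by
  classical
  -- Extension by zero allows summation over complete pairs `(ξ, true)`, `(ξ, false)` even if `F`
  -- contains only one of the two.
  let c' : (Fin d → ℤ) × Bool → ℝ := fun j => if j ∈ F then c j else 0
  let G := F.image Prod.fst
  have hsub : F ⊆ G ×ˢ (Finset.univ : Finset Bool) := fun j hj =>
    Finset.mem_product.2 ⟨Finset.mem_image_of_mem _ hj, Finset.mem_univ _⟩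
  have red : ∀ g : (Fin d → ℤ) × Bool → ℝ → ℝ, (∀ j, g j 0 = 0) →
      ∑ j ∈ F, g j (c j) = ∑ ξ ∈ G, (g (ξ, true) (c' (ξ, true)) + g (ξ, false) (c' (ξ, false))) := by
    intro g hg
    have h1 : ∑ j ∈ F, g j (c j) = ∑ j ∈ F, g j (c' j) :=
      Finset.sum_congr rfl fun j hj => by simp [c', hj]
    rw [h1, Finset.sum_subset hsub fun j _ hj => by simp [c', hj, hg], Finset.sum_product]
    exact Finset.sum_congr rfl fun ξ _ => by rw [Fintype.sum_bool]
  let a : (Fin d → ℤ) → ℂ := fun ξ =>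
    (c' (ξ, true) * phase ξ true + c' (ξ, false) * phase ξ false) * κ ξ
  have e1 : ∀ p, ∑ j ∈ F, c j * mode j.1 (phase j.1 j.2 * κ j.1) (ρ j.1) p =
      ∑ ξ ∈ G, mode ξ (a ξ) (ρ ξ) p := fun p => by
    rw [red (fun j x => x * mode j.1 (phase j.1 j.2 * κ j.1) (ρ j.1) p) (by simp)]
    refine Finset.sum_congr rfl fun ξ _ => ?_
    simp only [a, add_mul, mode_add, mul_assoc, mode_smul]
  simp_rw [e1]
  refine (integral_sq_sum_mode_le G a ρ hρ).trans ?_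
  rw [red (fun j x => M j.1 * x ^ 2) (by simp)]
  refine Finset.sum_le_sum fun ξ _ => ?_
  have hI : 0 ≤ ∫ y in Ioo 0 ℓ, ρ ξ y ^ 2 := integral_nonneg fun y => sq_nonneg _
  by_cases h0 : ξ = 0
  · have : a ξ = 0 := by simp [a, phase, h0]
    rw [this]
    have := hM0 ξ
    rw [norm_zero, zero_pow two_ne_zero, zero_mul]
    positivity
  -- The phases are `i` and `1`, so the two real coefficients are the imaginary and real part of the
  -- amplitude.
  · have h2 : ‖a ξ‖ ^ 2 = (c' (ξ, true) ^ 2 + c' (ξ, false) ^ 2) * ‖κ ξ‖ ^ 2 := by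
      simp only [a, norm_mul, mul_pow, phase, h0, if_false, if_true, Bool.false_eq_true]
      congr 1
      rw [← Complex.normSq_eq_norm_sq, Complex.normSq_apply]
      simp
      ring
    rw [h2, ← mul_add, mul_assoc, mul_comm (M ξ)]
    gcongr
    exact hM ξ h0

end SmoothFields

/-! ### Solenoidal lifts of the boundary modes -/

section Lift

variable {d : ℕ} {ℓ : ℝ}

/-- The length of the wave vector `2πξ`. -/
def waveNorm (ξ : Fin d → ℤ) : ℝ := 2 * Real.pi * freqNorm ξ

theorem waveNorm_nonneg (ξ : Fin d → ℤ) : 0 ≤ waveNorm ξ := by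
  unfold waveNorm freqNorm; positivity

theorem sum_wave_sq (ξ : Fin d → ℤ) : ∑ i, (2 * Real.pi * ξ i) ^ 2 = waveNorm ξ ^ 2 := by
  rw [waveNorm, freqNorm, mul_pow, Real.sq_sqrt (by positivity), Finset.mul_sum]
  exact Finset.sum_congr rfl fun i _ => by ring

theorem one_le_waveNorm {ξ : Fin d → ℤ} (h : ξ ≠ 0) : 1 ≤ waveNorm ξ := by
  obtain ⟨i, hi⟩ := Function.ne_iff.1 h
  have h1 : (1 : ℝ) ≤ ∑ i, (ξ i : ℝ) ^ 2 := by
    have h2 : (1 : ℝ) ≤ (ξ i : ℝ) ^ 2 := by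
      exact_mod_cast Int.one_le_abs (z := ξ i ^ 2) (pow_ne_zero 2 hi) |>.trans_eq (abs_sq _)
    exact h2.trans (Finset.single_le_sum (f := fun i => (ξ i : ℝ) ^ 2)
      (fun _ _ => sq_nonneg _) (Finset.mem_univ i))
  have h3 : 1 ≤ freqNorm ξ := Real.one_le_sqrt.2 h1
  unfold waveNorm
  nlinarith [Real.pi_gt_three]

/-- The degree of the vertical profile of a lift. -/
def liftDegree (ξ : Fin d → ℤ) : ℕ := ⌈waveNorm ξ⌉₊ + 2

/-- The vertical profile of the normal component of a lift. -/
def liftProfile (ℓ : ℝ) (ξ : Fin d → ℤ) (y : ℝ) : ℝ := (y / ℓ) ^ liftDegree ξ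

theorem waveNorm_le_liftDegree (ξ : Fin d → ℤ) : waveNorm ξ ≤ liftDegree ξ := by
  unfold liftDegree
  push_cast
  linarith [Nat.le_ceil (waveNorm ξ)]

theorem liftDegree_le {ξ : Fin d → ℤ} (h : ξ ≠ 0) : (liftDegree ξ : ℝ) ≤ 4 * waveNorm ξ := by
  unfold liftDegree
  push_cast
  linarith [Nat.ceil_lt_add_one (waveNorm_nonneg ξ), one_le_waveNorm h]

theorem contDiff_liftProfile (ℓ : ℝ) (ξ : Fin d → ℤ) : ContDiff ℝ ∞ (liftProfile ℓ ξ) := by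
  unfold liftProfile
  fun_prop

theorem deriv_div_pow (ℓ : ℝ) (n : ℕ) :
    deriv (fun y : ℝ => (y / ℓ) ^ (n + 1)) = fun y => ((n + 1 : ℕ) / ℓ) * (y / ℓ) ^ n := by
  ext y
  have h : HasDerivAt (fun y : ℝ => (y / ℓ) ^ (n + 1)) _ y :=
    ((hasDerivAt_id y).div_const ℓ).pow (n + 1)
  rw [h.deriv]
  simp only [id, Nat.add_sub_cancel]
  ring

theorem deriv_liftProfile (ℓ : ℝ) (ξ : Fin d → ℤ) :
    deriv (liftProfile ℓ ξ) =
      fun y => ((liftDegree ξ : ℝ) / ℓ) * (y / ℓ) ^ (⌈waveNorm ξ⌉₊ + 1) := by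
  have := deriv_div_pow ℓ (⌈waveNorm ξ⌉₊ + 1)
  exact this

theorem deriv_deriv_liftProfile (ℓ : ℝ) (ξ : Fin d → ℤ) :
    deriv (deriv (liftProfile ℓ ξ)) = fun y => ((liftDegree ξ : ℝ) / ℓ) *
      (((⌈waveNorm ξ⌉₊ + 1 : ℕ) / ℓ) * (y / ℓ) ^ ⌈waveNorm ξ⌉₊) := by
  rw [deriv_liftProfile]
  ext y
  rw [deriv_const_mul_field, deriv_div_pow]

theorem integral_div_pow_sq (hℓ : 0 < ℓ) (a : ℝ) (n : ℕ) :
    ∫ y in Ioo 0 ℓ, (a * (y / ℓ) ^ n) ^ 2 = a ^ 2 * (ℓ / (2 * n + 1)) := by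
  rw [← intervalIntegral_eq_integral_Ioo _ hℓ.le]
  have e : ∀ y : ℝ, (a * (y / ℓ) ^ n) ^ 2 = (a ^ 2 / ℓ ^ (2 * n)) * y ^ (2 * n) := fun y => by
    rw [mul_pow, ← pow_mul, div_pow, mul_comm n 2]; ring
  simp_rw [e]
  rw [intervalIntegral.integral_const_mul, integral_pow]
  push_cast
  field_simp
  ring

/-- The Fourier symbols of the components of a lift. -/
def liftCoeff (ξ : Fin d → ℤ) : Fin (d + 1) → ℂ :=
  Fin.lastCases 1 fun i => Complex.I * ((2 * Real.pi * ξ i / waveNorm ξ ^ 2 : ℝ) : ℂ)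

/-- The vertical profiles of the components of a lift. -/
def liftShape (ℓ : ℝ) (ξ : Fin d → ℤ) : Fin (d + 1) → ℝ → ℝ :=
  Fin.lastCases (liftProfile ℓ ξ) fun _ => deriv (liftProfile ℓ ξ)

/-- The Fourier symbol of a partial derivative. -/
def pdCoeff (ξ : Fin d → ℤ) : Fin (d + 1) → ℂ :=
  Fin.lastCases 1 fun i => 2 * Real.pi * Complex.I * ξ i

/-- The action of a partial derivative on vertical profiles. -/
def pdShape (i : Fin (d + 1)) (χ : ℝ → ℝ) : ℝ → ℝ :=
  Fin.lastCases (motive := fun _ => ℝ → ℝ) (deriv χ) (fun _ => χ) i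

theorem pd_mode (ξ : Fin d → ℤ) (ζ : ℂ) (χ : ℝ → ℝ) (i : Fin (d + 1)) :
    pd i (mode ξ ζ χ) = mode ξ (ζ * pdCoeff ξ i) (pdShape i χ) := by
  induction i using Fin.lastCases with
  | last => simp [pdCoeff, pdShape, pd_last_mode]
  | cast i => simp [pdCoeff, pdShape, pd_castSucc_mode]

/-- The components of the lift of the boundary mode `Re (ζ e^{2πi ξ·x})`. -/
def liftField (ℓ : ℝ) (ξ : Fin d → ℤ) (ζ : ℂ) (j : Fin (d + 1)) : UnitAddTorus (Fin d) × ℝ → ℝ :=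
  mode ξ (ζ * liftCoeff ξ j) (liftShape ℓ ξ j)

theorem contDiff_liftShape (ℓ : ℝ) (ξ : Fin d → ℤ) (j : Fin (d + 1)) :
    ContDiff ℝ ∞ (liftShape ℓ ξ j) := by
  induction j using Fin.lastCases with
  | last => simpa [liftShape] using contDiff_liftProfile ℓ ξ
  | cast j => simpa [liftShape] using (contDiff_infty_iff_deriv.1 (contDiff_liftProfile ℓ ξ)).2

theorem isSmooth_liftField (ℓ : ℝ) (ξ : Fin d → ℤ) (ζ : ℂ) (j : Fin (d + 1)) :
    IsSmooth (liftField ℓ ξ ζ j) := isSmooth_mode ξ _ (contDiff_liftShape ℓ ξ j)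

/-- The horizontal components are the gradient-type correction with symbol `2πiξ/|2πξ|²` and profile
`χ'`; their divergence has symbol `-1` and cancels `∂_y` of the vertical component. At `ξ = 0` no
correction is possible, and there the phase is zero. -/
theorem sum_pd_liftField (ℓ : ℝ) (ξ : Fin d → ℤ) (b : Bool) (p : UnitAddTorus (Fin d) × ℝ) :
    ∑ i, pd i (liftField ℓ ξ (phase ξ b) i) p = 0 := by
  have e : ∀ a : Fin d, pd a.castSucc (liftField ℓ ξ (phase ξ b) a.castSucc) p =
      -((2 * Real.pi * ξ a) ^ 2 / waveNorm ξ ^ 2) *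
        mode ξ (phase ξ b) (deriv (liftProfile ℓ ξ)) p := fun a => by
    rw [liftField, pd_mode, ← mode_smul]
    simp only [liftCoeff, liftShape, pdCoeff, pdShape, Fin.lastCases_castSucc]
    congr 1
    push_cast
    linear_combination (phase ξ b * (2 * Real.pi * ξ a) ^ 2 / (waveNorm ξ : ℂ) ^ 2) *
      Complex.I_mul_I
  have e2 : pd (Fin.last d) (liftField ℓ ξ (phase ξ b) (Fin.last d)) p =
      mode ξ (phase ξ b) (deriv (liftProfile ℓ ξ)) p := by
    rw [liftField, pd_mode]
    simp [liftCoeff, liftShape, pdCoeff, pdShape]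
  rw [Fin.sum_univ_castSucc, e2]
  simp_rw [e]
  by_cases h : ξ = 0
  · simp [phase, h, mode]
  · have h0 : waveNorm ξ ≠ 0 := by linarith [one_le_waveNorm h]
    rw [← Finset.sum_mul, Finset.sum_neg_distrib, ← Finset.sum_div, sum_wave_sq,
      div_self (pow_ne_zero 2 h0)]
    ring

/-- The profile has degree at least two, so both it and its derivative vanish at `y = 0`. -/
theorem liftField_bottom (ξ : Fin d → ℤ) (ζ : ℂ) (j : Fin (d + 1))
    (x : UnitAddTorus (Fin d)) : liftField ℓ ξ ζ j (x, 0) = 0 := by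
  have : liftShape ℓ ξ j 0 = 0 := by
    induction j using Fin.lastCases with
    | last => simp [liftShape, liftProfile, liftDegree]
    | cast j => simp [liftShape, deriv_liftProfile]
  rw [liftField, mode, this, mul_zero]

/-- The solenoidal lift of a boundary mode. -/
def lift (hℓ : 0 < ℓ) (j : (Fin d → ℤ) × Bool) : Solenoidal d ℓ :=
  smoothSolenoidal hℓ (liftField ℓ j.1 (phase j.1 j.2)) (isSmooth_liftField ℓ j.1 _)
    (sum_pd_liftField ℓ j.1 j.2) (liftField_bottom j.1 _)

theorem isTopNormalTrace_lift (hℓ : 0 < ℓ) (j : (Fin d → ℤ) × Bool) {g : SurfaceL2 d}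
    (hg : ∀ᵐ x ∂torusMeasure d, g x = (phase j.1 j.2 * UnitAddTorus.mFourier j.1 x).re) :
    IsTopNormalTrace (lift hℓ j) g := by
  refine isTopNormalTrace_smoothSolenoidal _ _ _ _ _ ?_
  filter_upwards [hg] with x hx
  rw [hx]
  simp [liftField, mode, liftCoeff, liftShape, liftProfile, hℓ.ne']

/-- The constant in the estimates of the lifts. -/
def liftConst (ℓ : ℝ) : ℝ := ℓ + 4 / ℓ + 64 / ℓ ^ 3

theorem norm_liftCoeff_sq_le {ξ : Fin d → ℤ} (h : ξ ≠ 0) (a : Fin d) :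
    ‖liftCoeff ξ a.castSucc‖ ^ 2 ≤ 1 / waveNorm ξ ^ 2 := by
  have h0 : 0 < waveNorm ξ := by linarith [one_le_waveNorm h]
  simp only [liftCoeff, Fin.lastCases_castSucc, norm_mul, Complex.norm_I, one_mul,
    Complex.norm_real, Real.norm_eq_abs, sq_abs]
  have h1 : (2 * Real.pi * ξ a) ^ 2 ≤ waveNorm ξ ^ 2 := by
    rw [← sum_wave_sq]
    exact Finset.single_le_sum (f := fun i => (2 * Real.pi * (ξ i : ℝ)) ^ 2)
      (fun _ _ => sq_nonneg _) (Finset.mem_univ a)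
  rw [div_pow, div_le_div_iff₀ (by positivity) (by positivity)]
  nlinarith [sq_nonneg (waveNorm ξ)]

theorem norm_pdCoeff_sq_le (ξ : Fin d → ℤ) (a : Fin d) :
    ‖pdCoeff ξ a.castSucc‖ ^ 2 ≤ waveNorm ξ ^ 2 := by
  have e : ‖pdCoeff ξ a.castSucc‖ ^ 2 = (2 * Real.pi * ξ a) ^ 2 := by
    simp only [pdCoeff, Fin.lastCases_castSucc, norm_mul, Complex.norm_I, mul_one,
      Complex.norm_real, Real.norm_eq_abs, mul_pow, sq_abs, Complex.norm_intCast,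
      Complex.norm_ofNat]
  rw [e, ← sum_wave_sq]
  exact Finset.single_le_sum (f := fun i => (2 * Real.pi * (ξ i : ℝ)) ^ 2)
      (fun _ _ => sq_nonneg _) (Finset.mem_univ a)

/-- A power of degree comparable to `|2πξ|` lives in a layer of thickness about `ℓ/|ξ|` below the
top, like the harmonic profile. Each vertical derivative then costs one factor of the order `|ξ|/ℓ`,
as in the two estimates that follow. -/
theorem integral_liftProfile_sq_le (hℓ : 0 < ℓ) {ξ : Fin d → ℤ} (h : ξ ≠ 0) :
    ∫ y in Ioo 0 ℓ, liftProfile ℓ ξ y ^ 2 ≤ ℓ / waveNorm ξ := by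
  have h1 := integral_div_pow_sq hℓ 1 (liftDegree ξ)
  simp only [one_mul, one_pow] at h1
  rw [show (∫ y in Ioo 0 ℓ, liftProfile ℓ ξ y ^ 2) = _ from h1]
  have := waveNorm_le_liftDegree ξ
  have := one_le_waveNorm h
  gcongr
  linarith

theorem integral_deriv_liftProfile_sq_le (hℓ : 0 < ℓ) {ξ : Fin d → ℤ} (h : ξ ≠ 0) :
    ∫ y in Ioo 0 ℓ, deriv (liftProfile ℓ ξ) y ^ 2 ≤ 4 / ℓ * waveNorm ξ := by
  rw [deriv_liftProfile]
  refine (integral_div_pow_sq hℓ _ _).trans_le ?_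
  have h1 := liftDegree_le h
  have h2 : ((⌈waveNorm ξ⌉₊ + 1 : ℕ) : ℝ) = liftDegree ξ - 1 := by
    unfold liftDegree; push_cast; ring
  have h3 : (2 : ℝ) ≤ liftDegree ξ := by unfold liftDegree; push_cast; linarith [Nat.cast_nonneg (α := ℝ) ⌈waveNorm ξ⌉₊]
  rw [h2]
  set n : ℝ := ((liftDegree ξ : ℕ) : ℝ)
  have e : (n / ℓ) ^ 2 * (ℓ / (2 * (n - 1) + 1)) = (n ^ 2 / (2 * n - 1)) / ℓ := by
    have : 2 * n - 1 ≠ 0 := by linarith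
    rw [show 2 * (n - 1) + 1 = 2 * n - 1 by ring]
    field_simp
  have h4 : n ^ 2 / (2 * n - 1) ≤ n := by rw [div_le_iff₀ (by linarith)]; nlinarith
  rw [e, div_mul_eq_mul_div]
  gcongr
  linarith

theorem integral_deriv_deriv_liftProfile_sq_le (hℓ : 0 < ℓ) {ξ : Fin d → ℤ} (h : ξ ≠ 0) :
    ∫ y in Ioo 0 ℓ, deriv (deriv (liftProfile ℓ ξ)) y ^ 2 ≤ 64 / ℓ ^ 3 * waveNorm ξ ^ 3 := by
  rw [deriv_deriv_liftProfile]
  simp_rw [← mul_assoc]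
  refine (integral_div_pow_sq hℓ _ _).trans_le ?_
  have h1 := liftDegree_le h
  have h2 : ((⌈waveNorm ξ⌉₊ + 1 : ℕ) : ℝ) = liftDegree ξ - 1 := by
    unfold liftDegree; push_cast; ring
  have h2' : (⌈waveNorm ξ⌉₊ : ℝ) = liftDegree ξ - 2 := by
    unfold liftDegree; push_cast; ring
  have h3 : (2 : ℝ) ≤ liftDegree ξ := by unfold liftDegree; push_cast; linarith [Nat.cast_nonneg (α := ℝ) ⌈waveNorm ξ⌉₊]
  rw [h2, h2']
  set n : ℝ := ((liftDegree ξ : ℕ) : ℝ)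
  have e : (n / ℓ * ((n - 1) / ℓ)) ^ 2 * (ℓ / (2 * (n - 2) + 1)) =
      (n ^ 2 * (n - 1) ^ 2 / (2 * n - 3)) / ℓ ^ 3 := by
    have : 2 * n - 3 ≠ 0 := by linarith
    rw [show 2 * (n - 2) + 1 = 2 * n - 3 by ring]
    field_simp
  have h4 : n ^ 2 * (n - 1) ^ 2 / (2 * n - 3) ≤ n ^ 3 := by
    rw [div_le_iff₀ (by linarith)]
    have : (n - 1) ^ 2 ≤ n * (2 * n - 3) := by nlinarith
    nlinarith [mul_le_mul_of_nonneg_left this (sq_nonneg n)]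
  have h5 : n ^ 3 ≤ (4 * waveNorm ξ) ^ 3 := by gcongr
  rw [e, div_mul_eq_mul_div]
  gcongr
  linarith [h4, h5, mul_pow 4 (waveNorm ξ) 3]

theorem liftConst_nonneg (hℓ : 0 < ℓ) : 0 ≤ liftConst ℓ := by unfold liftConst; positivity

theorem lift_velocity_bound (hℓ : 0 < ℓ) {ξ : Fin d → ℤ} (h : ξ ≠ 0) (j : Fin (d + 1)) :
    ‖liftCoeff ξ j‖ ^ 2 * ∫ y in Ioo 0 ℓ, liftShape ℓ ξ j y ^ 2 ≤ liftConst ℓ := by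
  have h1 := one_le_waveNorm h
  have h0 : 0 < waveNorm ξ := by linarith
  have p1 : 0 < 4 / ℓ := by positivity
  have p2 : 0 < 64 / ℓ ^ 3 := by positivity
  induction j using Fin.lastCases with
  | last =>
    simp only [liftCoeff, liftShape, Fin.lastCases_last, norm_one, one_pow, one_mul]
    have h2 : ℓ / waveNorm ξ ≤ ℓ := div_le_self hℓ.le h1
    have := integral_liftProfile_sq_le hℓ h
    unfold liftConst
    linarith
  | cast j =>
    have h2 := norm_liftCoeff_sq_le h j
    have h3 := integral_deriv_liftProfile_sq_le hℓ h
    simp only [liftShape, Fin.lastCases_castSucc]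
    calc _ ≤ 1 / waveNorm ξ ^ 2 * (4 / ℓ * waveNorm ξ) := by
          gcongr
      _ = 4 / ℓ / waveNorm ξ := by field_simp
      _ ≤ 4 / ℓ := div_le_self p1.le h1
      _ ≤ liftConst ℓ := by unfold liftConst; linarith

/-- The thin layer gains one power of `|ξ|` against the two lost by differentiating, so the lift
maps `H^{1/2}(Σ)` to `H¹(Ω)`; this linear growth is what `μ` has to dominate. -/
theorem lift_gradient_bound (hℓ : 0 < ℓ) {ξ : Fin d → ℤ} (h : ξ ≠ 0) (i j : Fin (d + 1)) :
    ‖liftCoeff ξ j * pdCoeff ξ i‖ ^ 2 * ∫ y in Ioo 0 ℓ, pdShape i (liftShape ℓ ξ j) y ^ 2 ≤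
      liftConst ℓ * waveNorm ξ := by
  have h1 := one_le_waveNorm h
  have h0 : 0 < waveNorm ξ := by linarith
  have p1 : 0 < 4 / ℓ := by positivity
  have p2 : 0 < 64 / ℓ ^ 3 := by positivity
  have i0 := integral_liftProfile_sq_le hℓ h
  have i1 := integral_deriv_liftProfile_sq_le hℓ h
  have i2 := integral_deriv_deriv_liftProfile_sq_le hℓ h
  rw [norm_mul, mul_pow]
  have fin : ∀ c, c ≤ liftConst ℓ → c * waveNorm ξ ≤ liftConst ℓ * waveNorm ξ := fun c hc => by
    gcongr
  induction j using Fin.lastCases with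
  | last =>
    induction i using Fin.lastCases with
    | last =>
      simp only [liftCoeff, liftShape, pdCoeff, pdShape, Fin.lastCases_last, norm_one, one_pow,
        one_mul]
      exact i1.trans (fin _ (by unfold liftConst; linarith))
    | cast i =>
      have h2 := norm_pdCoeff_sq_le ξ i
      simp only [liftCoeff, liftShape, pdShape, Fin.lastCases_last, Fin.lastCases_castSucc,
        norm_one, one_pow, one_mul]
      calc _ ≤ waveNorm ξ ^ 2 * (ℓ / waveNorm ξ) := by gcongr
        _ = ℓ * waveNorm ξ := by field_simp
        _ ≤ _ := fin _ (by unfold liftConst; linarith)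
  | cast j =>
    have h3 := norm_liftCoeff_sq_le h j
    induction i using Fin.lastCases with
    | last =>
      simp only [liftShape, pdCoeff, pdShape, Fin.lastCases_last, Fin.lastCases_castSucc,
        norm_one, one_pow, mul_one]
      calc _ ≤ 1 / waveNorm ξ ^ 2 * (64 / ℓ ^ 3 * waveNorm ξ ^ 3) := by gcongr
        _ = 64 / ℓ ^ 3 * waveNorm ξ := by field_simp
        _ ≤ _ := fin _ (by unfold liftConst; linarith)
    | cast i =>
      have h2 := norm_pdCoeff_sq_le ξ i
      simp only [liftShape, pdShape, Fin.lastCases_castSucc]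
      calc _ ≤ 1 / waveNorm ξ ^ 2 * waveNorm ξ ^ 2 * (4 / ℓ * waveNorm ξ) := by gcongr
        _ = 4 / ℓ * waveNorm ξ := by field_simp
        _ ≤ _ := fin _ (by unfold liftConst; linarith)

theorem sum_smul_coe_ae {ι : Type} [Fintype ι] {J : Type} (F : Finset J) (c : J → ℝ)
    (f : J → Lp (EuclideanSpace ℝ ι) 2 (slabMeasure d ℓ))
    (g : J → ι → UnitAddTorus (Fin d) × ℝ → ℝ)
    (h : ∀ j, ∀ᵐ p ∂slabMeasure d ℓ, ∀ i, f j p i = g j i p) :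
    ∀ᵐ p ∂slabMeasure d ℓ, ∀ i, (∑ j ∈ F, c j • f j : Lp (EuclideanSpace ℝ ι) 2 (slabMeasure d ℓ)) p i =
      ∑ j ∈ F, c j * g j i p := by
  have h1 : ∀ᵐ p ∂slabMeasure d ℓ, ∀ j ∈ F,
      (c j • f j : Lp (EuclideanSpace ℝ ι) 2 (slabMeasure d ℓ)) p = c j • f j p ∧
        ∀ i, f j p i = g j i p :=
    (Finset.eventually_all F).2 fun j _ => (Lp.coeFn_smul (c j) (f j)).and (h j)
  filter_upwards [Lp.coeFn_finsetSum F fun j => c j • f j, h1] with p hp hp1 i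
  rw [hp, Finset.sum_apply]
  simp only [WithLp.ofLp_sum, Finset.sum_apply]
  refine Finset.sum_congr rfl fun j hj => ?_
  rw [(hp1 j hj).1, PiLp.smul_apply, (hp1 j hj).2, smul_eq_mul]

theorem norm_sq_sum_lift_velocity_le (hℓ : 0 < ℓ) (F : Finset ((Fin d → ℤ) × Bool))
    (c : (Fin d → ℤ) × Bool → ℝ) :
    ‖∑ j ∈ F, c j • velocity (lift hℓ j)‖ ^ 2 ≤
      ((d : ℝ) + 1) * liftConst ℓ * ∑ j ∈ F, c j ^ 2 := by
  have hae := sum_smul_coe_ae F c (fun j => velocity (lift hℓ j))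
    (fun j i => liftField ℓ j.1 (phase j.1 j.2) i) fun j => velocity_smoothSolenoidal_ae _ _ _ _ _
  rw [norm_sq_eq_sum_integral]
  have h1 : ∀ i : Fin (d + 1), ∫ p, (∑ j ∈ F, c j • velocity (lift hℓ j) : VelocityL2 d ℓ) p i ^ 2
      ∂slabMeasure d ℓ ≤ liftConst ℓ * ∑ j ∈ F, c j ^ 2 := fun i => by
    rw [Finset.mul_sum]
    refine le_trans (le_of_eq ?_) (integral_sq_sum_phase_mode_le F c (fun ξ => liftCoeff ξ i)
      (fun ξ => liftShape ℓ ξ i) (fun ξ => (contDiff_liftShape ℓ ξ i).continuous)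
      (fun _ => liftConst ℓ) (fun ξ hξ => lift_velocity_bound hℓ hξ i)
      (fun _ => liftConst_nonneg hℓ))
    refine integral_congr_ae ?_
    filter_upwards [hae] with p hp
    rw [hp i]; rfl
  refine (Finset.sum_le_sum fun i _ => h1 i).trans (le_of_eq ?_)
  rw [Finset.sum_const, Finset.card_univ, Fintype.card_fin, nsmul_eq_mul]
  push_cast; ring

theorem norm_sq_sum_lift_gradient_le (hℓ : 0 < ℓ) (F : Finset ((Fin d → ℤ) × Bool))
    (c : (Fin d → ℤ) × Bool → ℝ) :
    ‖∑ j ∈ F, c j • velocityGradient (lift hℓ j)‖ ^ 2 ≤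
      ((d : ℝ) + 1) ^ 2 * liftConst ℓ * ∑ j ∈ F, waveNorm j.1 * c j ^ 2 := by
  have hae := sum_smul_coe_ae F c (fun j => velocityGradient (lift hℓ j))
    (fun j q => pd q.1 (liftField ℓ j.1 (phase j.1 j.2) q.2))
    fun j => velocityGradient_smoothSolenoidal_ae _ _ _ _ _
  rw [norm_sq_eq_sum_integral]
  have h1 : ∀ q : Fin (d + 1) × Fin (d + 1),
      ∫ p, (∑ j ∈ F, c j • velocityGradient (lift hℓ j) : GradientL2 d ℓ) p q ^ 2
      ∂slabMeasure d ℓ ≤ liftConst ℓ * ∑ j ∈ F, waveNorm j.1 * c j ^ 2 := fun q => by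
    simp_rw [Finset.mul_sum, ← mul_assoc]
    have hc : ∀ ξ : Fin d → ℤ, Continuous (pdShape q.1 (liftShape ℓ ξ q.2)) := fun ξ => by
      rcases q with ⟨i, j⟩
      induction i using Fin.lastCases with
      | last =>
        simpa [pdShape] using
          (contDiff_infty_iff_deriv.1 (contDiff_liftShape ℓ ξ j)).2.continuous
      | cast i => simpa [pdShape] using (contDiff_liftShape ℓ ξ j).continuous
    refine le_trans (le_of_eq ?_) (integral_sq_sum_phase_mode_le F c
      (fun ξ => liftCoeff ξ q.2 * pdCoeff ξ q.1) (fun ξ => pdShape q.1 (liftShape ℓ ξ q.2)) hc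
      (fun ξ => liftConst ℓ * waveNorm ξ) (fun ξ hξ => lift_gradient_bound hℓ hξ q.1 q.2)
      (fun ξ => mul_nonneg (liftConst_nonneg hℓ) (waveNorm_nonneg ξ)))
    refine integral_congr_ae ?_
    filter_upwards [hae] with p hp
    simp only [hp q, liftField, pd_mode, mul_assoc]
  refine (Finset.sum_le_sum fun i _ => h1 i).trans (le_of_eq ?_)
  rw [Finset.sum_const, Finset.card_univ, Fintype.card_prod, Fintype.card_fin, nsmul_eq_mul]
  push_cast; ring

end Lift

/-! ### Fourier coefficients on horizontal slices -/

section Slices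

variable {d : ℕ} {ℓ : ℝ}

/-- The Fourier coefficient in the horizontal variable on the slice at height `y`. -/
def sliceCoeff (f : UnitAddTorus (Fin d) × ℝ → ℝ) (ξ : Fin d → ℤ) (y : ℝ) : ℂ :=
  surfaceCoeff (fun x => f (x, y)) ξ

theorem integrable_slab_smul {f : UnitAddTorus (Fin d) × ℝ → ℝ} (hf : MemLp f 2 (slabMeasure d ℓ))
    (ξ : Fin d → ℤ) {χ : ℝ → ℝ} (hχ : Continuous χ) :
    Integrable (fun p => χ p.2 • (UnitAddTorus.mFourier (-ξ) p.1 * (f p : ℂ))) (slabMeasure d ℓ) := by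
  have h1 : Integrable (fun p => χ p.2 * f p) (slabMeasure d ℓ) :=
    (memLp_slab_of_continuous (hχ.comp continuous_snd) 2).integrable_mul hf
  refine (h1.ofReal (𝕜 := ℂ)).norm.mono' ?_ (Eventually.of_forall fun p => ?_)
  · have : Continuous fun p : UnitAddTorus (Fin d) × ℝ => UnitAddTorus.mFourier (-ξ) p.1 := by
      fun_prop
    exact (hχ.comp continuous_snd).aestronglyMeasurable.smul
      (this.aestronglyMeasurable.mul (Complex.continuous_ofReal.comp_aestronglyMeasurable
        hf.aestronglyMeasurable))
  · rw [norm_smul, norm_mul]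
    have h2 : ‖UnitAddTorus.mFourier (-ξ) p.1‖ ≤ 1 :=
      (ContinuousMap.norm_coe_le_norm _ _).trans_eq (UnitAddTorus.mFourier_norm)
    have e : ‖((χ p.2 * f p : ℝ) : ℂ)‖ = ‖χ p.2‖ * ‖(f p : ℂ)‖ := by
      rw [Complex.norm_real, Complex.norm_real, norm_mul]
    rw [show (RCLike.ofReal (χ p.2 * f p) : ℂ) = ((χ p.2 * f p : ℝ) : ℂ) from rfl, e]
    gcongr
    exact mul_le_of_le_one_left (norm_nonneg _) h2

theorem integral_smul_sliceCoeff {f : UnitAddTorus (Fin d) × ℝ → ℝ}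
    (hf : MemLp f 2 (slabMeasure d ℓ)) (ξ : Fin d → ℤ) {χ : ℝ → ℝ} (hχ : Continuous χ) :
    ∫ y in Ioo 0 ℓ, χ y • sliceCoeff f ξ y =
      ∫ p, χ p.2 • (UnitAddTorus.mFourier (-ξ) p.1 * (f p : ℂ)) ∂slabMeasure d ℓ := by
  rw [integral_prod_symm _ (integrable_slab_smul hf ξ hχ)]
  simp only [integral_smul]
  rfl

/-- Translates real test functions into complex slice coefficients; letting `ζ` range over `ℂ`
recovers the whole complex number. -/
theorem integral_mul_mode {f : UnitAddTorus (Fin d) × ℝ → ℝ}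
    (hf : MemLp f 2 (slabMeasure d ℓ)) (ξ : Fin d → ℤ) (ζ : ℂ) {χ : ℝ → ℝ} (hχ : Continuous χ) :
    ∫ p, f p * mode ξ ζ χ p ∂slabMeasure d ℓ =
      (ζ * (starRingEnd ℂ) (∫ y in Ioo 0 ℓ, χ y • sliceCoeff f ξ y)).re := by
  rw [integral_smul_sliceCoeff hf ξ hχ, ← integral_conj, ← integral_const_mul]
  have hi : Integrable (fun p => ζ * (starRingEnd ℂ)
      (χ p.2 • (UnitAddTorus.mFourier (-ξ) p.1 * (f p : ℂ)))) (slabMeasure d ℓ) := by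
    refine Integrable.const_mul ?_ ζ
    have := Complex.conjCLE.toContinuousLinearMap.integrable_comp (integrable_slab_smul hf ξ hχ)
    simpa using this
  have := Complex.reCLM.integral_comp_comm hi
  simp only [Complex.reCLM_apply] at this
  rw [← this]
  refine integral_congr_ae (Eventually.of_forall fun p => ?_)
  simp only [Complex.real_smul, map_mul, Complex.conj_ofReal, UnitAddTorus.mFourier_neg,
    Complex.conj_conj, mode]
  rw [show ζ * ((χ p.2 : ℂ) * (UnitAddTorus.mFourier ξ p.1 * (f p : ℂ))) =
    ((χ p.2 * f p : ℝ) : ℂ) * (ζ * UnitAddTorus.mFourier ξ p.1) by push_cast; ring,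
    Complex.re_ofReal_mul]
  ring

theorem eq_of_forall_re_mul_conj {z w : ℂ}
    (h : ∀ ζ : ℂ, (ζ * (starRingEnd ℂ) z).re = (ζ * (starRingEnd ℂ) w).re) : z = w := by
  apply Complex.ext
  · simpa using h 1
  · simpa using h Complex.I

theorem ae_memLp_slice {f : UnitAddTorus (Fin d) × ℝ → ℝ} (hf : MemLp f 2 (slabMeasure d ℓ)) :
    ∀ᵐ y ∂volume.restrict (Ioo 0 ℓ), MemLp (fun x => f (x, y)) 2 (torusMeasure d) := by
  have h1 : Integrable (fun p => f p ^ 2) (slabMeasure d ℓ) := hf.integrable_sq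
  filter_upwards [h1.prod_left_ae, hf.aestronglyMeasurable.prod_swap.prodMk_left] with y h2 h3
  exact (memLp_two_iff_integrable_sq h3).2 h2

theorem hasSum_surfaceCoeff {f : UnitAddTorus (Fin d) → ℝ} (hf : MemLp f 2 (torusMeasure d)) :
    HasSum (fun ξ => ‖surfaceCoeff f ξ‖ ^ 2) (∫ x, f x ^ 2 ∂torusMeasure d) := by
  have hc : MemLp (fun x => (f x : ℂ)) 2 (torusMeasure d) := hf.ofReal
  have h := UnitAddTorus.hasSum_sq_mFourierCoeff (hc.toLp _)
  have hcoe : hc.toLp _ =ᵐ[torusMeasure d] fun x => (f x : ℂ) := hc.coeFn_toLp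
  have e : ∀ ξ, UnitAddTorus.mFourierCoeff (hc.toLp _) ξ = surfaceCoeff f ξ := fun ξ =>
    integral_congr_ae (by
      filter_upwards [hcoe] with x hx
      rw [hx])
  have e2 : ∫ x, ‖hc.toLp _ x‖ ^ 2 ∂torusMeasure d = ∫ x, f x ^ 2 ∂torusMeasure d :=
    integral_congr_ae (by
      filter_upwards [hcoe] with x hx
      rw [hx, Complex.norm_real, Real.norm_eq_abs, sq_abs])
  rw [← e2]
  simp only [e] at h
  exact h

theorem ae_hasSum_sliceCoeff {f : UnitAddTorus (Fin d) × ℝ → ℝ}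
    (hf : MemLp f 2 (slabMeasure d ℓ)) :
    ∀ᵐ y ∂volume.restrict (Ioo 0 ℓ),
      HasSum (fun ξ => ‖sliceCoeff f ξ y‖ ^ 2) (∫ x, f (x, y) ^ 2 ∂torusMeasure d) := by
  filter_upwards [ae_memLp_slice hf] with y hy
  exact hasSum_surfaceCoeff hy

/-- Measurability comes from Fubini, and on almost every slice Parseval dominates the coefficient by
the `L²` norm of the slice. -/
theorem memLp_sliceCoeff {f : UnitAddTorus (Fin d) × ℝ → ℝ}
    (hf : MemLp f 2 (slabMeasure d ℓ)) (ξ : Fin d → ℤ) :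
    MemLp (sliceCoeff f ξ) 2 (volume.restrict (Ioo 0 ℓ)) := by
  have hm : AEStronglyMeasurable (sliceCoeff f ξ) (volume.restrict (Ioo 0 ℓ)) := by
    have h := (integrable_slab_smul hf ξ (continuous_const (y := (1 : ℝ)))).swap.integral_prod_left
    simp only [one_smul] at h
    exact h.aestronglyMeasurable
  rw [memLp_two_iff_integrable_sq_norm hm]
  have h1 : Integrable (fun p => f p ^ 2) (slabMeasure d ℓ) := hf.integrable_sq
  refine h1.integral_prod_right.mono' (hm.norm.pow 2) ?_
  filter_upwards [ae_hasSum_sliceCoeff hf] with y hy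
  rw [Real.norm_of_nonneg (by positivity)]
  exact le_hasSum hy ξ fun _ _ => by positivity

theorem sum_integral_sliceCoeff_le {f : UnitAddTorus (Fin d) × ℝ → ℝ}
    (hf : MemLp f 2 (slabMeasure d ℓ)) (F : Finset (Fin d → ℤ)) :
    ∑ ξ ∈ F, ∫ y in Ioo 0 ℓ, ‖sliceCoeff f ξ y‖ ^ 2 ≤ ∫ p, f p ^ 2 ∂slabMeasure d ℓ := by
  have h1 : Integrable (fun p => f p ^ 2) (slabMeasure d ℓ) := hf.integrable_sq
  have hi : ∀ ξ ∈ F, Integrable (fun y => ‖sliceCoeff f ξ y‖ ^ 2) (volume.restrict (Ioo 0 ℓ)) :=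
    fun ξ _ => (memLp_sliceCoeff hf ξ).integrable_norm_pow (by norm_num)
  rw [integral_prod_symm _ h1, ← integral_finsetSum F hi]
  refine integral_mono_ae (integrable_finsetSum F hi) h1.integral_prod_right ?_
  filter_upwards [ae_hasSum_sliceCoeff hf] with y hy
  exact sum_le_hasSum F (fun _ _ => by positivity) hy

theorem integral_sq_le_of_ae_slice_le {f : UnitAddTorus (Fin d) × ℝ → ℝ}
    (hf : MemLp f 2 (slabMeasure d ℓ)) {b : ℝ → ℝ} (hb : Integrable b (volume.restrict (Ioo 0 ℓ)))
    (h : ∀ᵐ y ∂volume.restrict (Ioo 0 ℓ), ∫ x, f (x, y) ^ 2 ∂torusMeasure d ≤ b y) :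
    ∫ p, f p ^ 2 ∂slabMeasure d ℓ ≤ ∫ y in Ioo 0 ℓ, b y := by
  have h1 : Integrable (fun p => f p ^ 2) (slabMeasure d ℓ) := hf.integrable_sq
  rw [integral_prod_symm _ h1]
  exact integral_mono_ae h1.integral_prod_right hb h

theorem norm_integral_sq_le {E : Type*} [NormedAddCommGroup E] [NormedSpace ℝ E] {α : Type*}
    [MeasurableSpace α] {μ : Measure α} [IsFiniteMeasure μ] {f : α → E} (hf : MemLp f 2 μ) :
    ‖∫ x, f x ∂μ‖ ^ 2 ≤ μ.real univ * ∫ x, ‖f x‖ ^ 2 ∂μ := by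
  have h := enorm_integral_sq_le hf.aestronglyMeasurable
  have hi : Integrable (fun x => ‖f x‖ ^ 2) μ := hf.integrable_norm_pow (by norm_num)
  have e : ∫⁻ x, ‖f x‖ₑ ^ 2 ∂μ = ENNReal.ofReal (∫ x, ‖f x‖ ^ 2 ∂μ) := by
    rw [ofReal_integral_eq_lintegral_ofReal hi (Eventually.of_forall fun _ => by positivity)]
    refine lintegral_congr fun x => ?_
    rw [← ofReal_norm, ENNReal.ofReal_pow (norm_nonneg _)]
  rw [e, ← ofReal_norm, ← ENNReal.ofReal_pow (norm_nonneg _), ← ENNReal.ofReal_toReal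
    (measure_ne_top μ univ), ← ENNReal.ofReal_mul ENNReal.toReal_nonneg] at h
  exact (ENNReal.ofReal_le_ofReal_iff (mul_nonneg ENNReal.toReal_nonneg
    (integral_nonneg fun _ => by positivity))).1 h

end Slices

/-! ### Derivatives and traces on the Fourier side -/

section SliceDerivatives

variable {d : ℕ} {ℓ : ℝ}

theorem integrableOn_sliceCoeff {f : UnitAddTorus (Fin d) × ℝ → ℝ}
    (hf : MemLp f 2 (slabMeasure d ℓ)) (ξ : Fin d → ℤ) :
    IntegrableOn (sliceCoeff f ξ) (Ioo 0 ℓ) :=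
  (memLp_sliceCoeff hf ξ).integrable (by norm_num)

theorem integrable_smul_sliceCoeff {f : UnitAddTorus (Fin d) × ℝ → ℝ}
    (hf : MemLp f 2 (slabMeasure d ℓ)) (ξ : Fin d → ℤ) {χ : ℝ → ℝ} (hχ : Continuous χ) :
    IntegrableOn (fun y => χ y • sliceCoeff f ξ y) (Ioo 0 ℓ) := by
  have h := (integrable_slab_smul hf ξ hχ).integral_prod_right
  simp only [integral_smul] at h
  exact h

theorem ae_eq_zero_of_integral_smul {f : ℝ → ℂ} (hf : IntegrableOn f (Ioo 0 ℓ))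
    (h : ∀ χ : ℝ → ℝ, ContDiff ℝ ∞ χ → tsupport χ ⊆ Ioo 0 ℓ → ∫ y in Ioo 0 ℓ, χ y • f y = 0) :
    ∀ᵐ y ∂volume.restrict (Ioo 0 ℓ), f y = 0 := by
  rw [ae_restrict_iff' measurableSet_Ioo]
  refine isOpen_Ioo.ae_eq_zero_of_integral_contDiff_smul_eq_zero hf.locallyIntegrableOn
    fun χ hχ _ hs => ?_
  rw [← h χ hχ hs]
  refine (setIntegral_eq_integral_of_forall_compl_eq_zero fun y hy => ?_).symm
  rw [image_eq_zero_of_notMem_tsupport fun h' => hy (hs h'), zero_smul]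

theorem tsupport_mode_subset (ξ : Fin d → ℤ) (ζ : ℂ) {χ : ℝ → ℝ} (h : tsupport χ ⊆ Ioo 0 ℓ) :
    tsupport (mode ξ ζ χ) ⊆ univ ×ˢ Ioo 0 ℓ := by
  have h1 : tsupport (mode ξ ζ χ) ⊆ Prod.snd ⁻¹' tsupport χ := by
    refine closure_minimal (fun p hp => subset_closure fun h0 => hp ?_)
      ((isClosed_tsupport χ).preimage continuous_snd)
    rw [mode, h0, mul_zero]
  exact fun p hp => ⟨trivial, h (h1 hp)⟩

/-- Testing the weak gradient with a mode times a vertical cut-off moves the horizontal derivative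
onto the exponential; the vertical cut-off is arbitrary, so the identity localises in `y`. -/
theorem sliceCoeff_horizontal {u : VelocityL2 d ℓ} {G : GradientL2 d ℓ} (h : IsWeakGradient ℓ u G)
    (i : Fin d) (j : Fin (d + 1)) (ξ : Fin d → ℤ) :
    ∀ᵐ y ∂volume.restrict (Ioo 0 ℓ), sliceCoeff (fun p => G p (i.castSucc, j)) ξ y =
      2 * Real.pi * Complex.I * ξ i * sliceCoeff (fun p => u p j) ξ y := by
  have hG := memLp_coord G (i.castSucc, j)
  have hu := memLp_coord u j
  set c : ℂ := 2 * Real.pi * Complex.I * ξ i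
  have hc : (starRingEnd ℂ) c = -c := by
    have h2 : (starRingEnd ℂ) 2 = 2 := map_ofNat _ 2
    simp [c, h2]
  have key := ae_eq_zero_of_integral_smul (ℓ := ℓ)
    (f := fun y => sliceCoeff (fun p => G p (i.castSucc, j)) ξ y -
      c * sliceCoeff (fun p => u p j) ξ y)
    ((integrableOn_sliceCoeff hG ξ).sub ((integrableOn_sliceCoeff hu ξ).const_mul c)) ?_
  · filter_upwards [key] with y hy
    exact sub_eq_zero.1 hy
  intro χ hχ hs
  have h1 : ∀ ζ : ℂ, (ζ * (starRingEnd ℂ) (c * ∫ y in Ioo 0 ℓ, χ y • sliceCoeff (fun p => u p j) ξ y)).re =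
      (ζ * (starRingEnd ℂ) (∫ y in Ioo 0 ℓ, χ y • sliceCoeff (fun p => G p (i.castSucc, j)) ξ y)).re := by
    intro ζ
    have h2 := h (mode ξ ζ χ) (isSmooth_mode ξ ζ hχ) (tsupport_mode_subset ξ ζ hs) i.castSucc j
    rw [pd_castSucc_mode, integral_mul_mode hu ξ _ hχ.continuous,
      integral_mul_mode hG ξ _ hχ.continuous] at h2
    rw [map_mul, hc, ← neg_eq_iff_eq_neg.2 h2, ← Complex.neg_re]
    congr 1
    ring
  have h3 := eq_of_forall_re_mul_conj h1
  have e : ∀ y, χ y • (sliceCoeff (fun p => G p (i.castSucc, j)) ξ y -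
      c * sliceCoeff (fun p => u p j) ξ y) = χ y • sliceCoeff (fun p => G p (i.castSucc, j)) ξ y -
      c * (χ y • sliceCoeff (fun p => u p j) ξ y) := fun y => by
    rw [smul_sub, mul_smul_comm]
  simp_rw [e]
  rw [integral_sub (integrable_smul_sliceCoeff hG ξ hχ.continuous)
    ((integrable_smul_sliceCoeff hu ξ hχ.continuous).const_mul c), integral_const_mul, h3, sub_self]

theorem hasBottomTrace_mode {f fy : UnitAddTorus (Fin d) × ℝ → ℝ}
    (hf : MemLp f 2 (slabMeasure d ℓ)) (hfy : MemLp fy 2 (slabMeasure d ℓ))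
    (h : HasBottomTrace ℓ f fy 0) (ξ : Fin d → ℤ) {χ : ℝ → ℝ} (hχ : ContDiff ℝ ∞ χ)
    (hχℓ : χ ℓ = 0) :
    (∫ y in Ioo 0 ℓ, χ y • sliceCoeff fy ξ y) + ∫ y in Ioo 0 ℓ, deriv χ y • sliceCoeff f ξ y = 0 := by
  refine eq_of_forall_re_mul_conj fun ζ => ?_
  have h2 := h (mode ξ ζ χ) (isSmooth_mode ξ ζ hχ) fun x => by rw [mode, hχℓ, mul_zero]
  rw [pd_last_mode, integral_mul_mode hfy ξ _ hχ.continuous,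
    integral_mul_mode hf ξ _ (contDiff_infty_iff_deriv.1 hχ).2.continuous] at h2
  simpa [mul_add] using h2

/-- The zero bottom trace fixes the constant of integration, since test profiles need not vanish at
`y = 0`. -/
theorem sliceCoeff_vertical (hℓ : 0 < ℓ) {f fy : UnitAddTorus (Fin d) × ℝ → ℝ}
    (hf : MemLp f 2 (slabMeasure d ℓ)) (hfy : MemLp fy 2 (slabMeasure d ℓ))
    (h : HasBottomTrace ℓ f fy 0) (ξ : Fin d → ℤ) :
    ∀ᵐ y ∂volume.restrict (Ioo 0 ℓ), sliceCoeff f ξ y = ∫ s in (0 : ℝ)..y, sliceCoeff fy ξ s := by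
  have hp : IntervalIntegrable (sliceCoeff fy ξ) volume 0 ℓ := by
    rw [intervalIntegrable_iff_integrableOn_Ioo_of_le hℓ.le]
    exact integrableOn_sliceCoeff hfy ξ
  have hP : ContinuousOn (fun y => ∫ s in (0 : ℝ)..y, sliceCoeff fy ξ s) (Icc 0 ℓ) := by
    have h1 := intervalIntegral.continuousOn_primitive_interval' hp left_mem_uIcc
    rwa [uIcc_of_le hℓ.le] at h1
  have hPi : IntegrableOn (fun y => ∫ s in (0 : ℝ)..y, sliceCoeff fy ξ s) (Ioo 0 ℓ) :=
    (hP.integrableOn_Icc).mono_set Ioo_subset_Icc_self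
  have key := ae_eq_zero_of_integral_smul (ℓ := ℓ)
    (f := fun y => sliceCoeff f ξ y - ∫ s in (0 : ℝ)..y, sliceCoeff fy ξ s)
    ((integrableOn_sliceCoeff hf ξ).sub hPi) ?_
  · filter_upwards [key] with y hy
    exact sub_eq_zero.1 hy
  intro ζ hζ _
  -- The profile is the primitive of an arbitrary `ζ` that vanishes at `ℓ`, hence is admissible;
  -- exchanging the order of integration turns it into a test of the primitive of `fy` against `ζ`.
  have h1 := hasBottomTrace_mode hf hfy h ξ (contDiff_integral hζ ℓ) intervalIntegral.integral_same
  rw [deriv_integral_of_contDiff hζ] at h1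
  have h2 := integral_bilin_primitive_swap (ContinuousLinearMap.lsmul ℝ ℝ (E := ℂ)).flip hℓ.le hp
    (hζ.continuous.intervalIntegrable 0 ℓ)
  simp only [ContinuousLinearMap.flip_apply, ContinuousLinearMap.lsmul_apply] at h2
  rw [intervalIntegral_eq_integral_Ioo _ hℓ.le, intervalIntegral_eq_integral_Ioo _ hℓ.le] at h2
  have h3 : ∫ y in Ioo 0 ℓ, (∫ s in ℓ..y, ζ s) • sliceCoeff fy ξ y =
      -∫ y in Ioo 0 ℓ, (∫ s in y..ℓ, ζ s) • sliceCoeff fy ξ y := by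
    rw [← integral_neg]
    refine integral_congr_ae (Eventually.of_forall fun y => ?_)
    simp only
    rw [intervalIntegral.integral_symm, neg_smul]
  simp_rw [smul_sub]
  have hi : IntegrableOn (fun y => ζ y • ∫ s in (0 : ℝ)..y, sliceCoeff fy ξ s) (Ioo 0 ℓ) :=
    ((hζ.continuous.continuousOn.smul hP).integrableOn_Icc).mono_set Ioo_subset_Icc_self
  rw [integral_sub (integrable_smul_sliceCoeff hf ξ hζ.continuous) hi, ← h2]
  rw [h3] at h1
  linear_combination h1

theorem norm_sliceCoeff_sq_le (hℓ : 0 < ℓ) {f fy : UnitAddTorus (Fin d) × ℝ → ℝ}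
    (hf : MemLp f 2 (slabMeasure d ℓ)) (hfy : MemLp fy 2 (slabMeasure d ℓ))
    (h : HasBottomTrace ℓ f fy 0) (ξ : Fin d → ℤ) :
    ∀ᵐ y ∂volume.restrict (Ioo 0 ℓ),
      ‖sliceCoeff f ξ y‖ ^ 2 ≤ ℓ * ∫ s in Ioo 0 ℓ, ‖sliceCoeff fy ξ s‖ ^ 2 := by
  filter_upwards [sliceCoeff_vertical hℓ hf hfy h ξ, ae_restrict_mem measurableSet_Ioo] with y hy hm
  have hL := memLp_sliceCoeff hfy ξ
  have hsub : Ioo 0 y ⊆ Ioo 0 ℓ := Ioo_subset_Ioo_right hm.2.le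
  have hL' : MemLp (sliceCoeff fy ξ) 2 (volume.restrict (Ioo 0 y)) :=
    hL.mono_measure (Measure.restrict_mono hsub le_rfl)
  rw [hy, intervalIntegral_eq_integral_Ioo _ hm.1.le]
  refine (norm_integral_sq_le hL').trans ?_
  rw [measureReal_restrict_apply_univ, Real.volume_real_Ioo_of_le hm.1.le, sub_zero]
  refine mul_le_mul hm.2.le ?_ (integral_nonneg fun _ => by positivity) hℓ.le
  exact setIntegral_mono_set (hL.integrable_norm_pow (by norm_num))
    (Eventually.of_forall fun _ => by positivity) hsub.eventuallyLE

/-- Poincaré's inequality in the vertical direction, proved per mode. One factor `ℓ` comes from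
Cauchy–Schwarz, the other from integrating over the height. -/
theorem integral_sq_le_of_hasBottomTrace (hℓ : 0 < ℓ) {f fy : UnitAddTorus (Fin d) × ℝ → ℝ}
    (hf : MemLp f 2 (slabMeasure d ℓ)) (hfy : MemLp fy 2 (slabMeasure d ℓ))
    (h : HasBottomTrace ℓ f fy 0) :
    ∫ p, f p ^ 2 ∂slabMeasure d ℓ ≤ ℓ ^ 2 * ∫ p, fy p ^ 2 ∂slabMeasure d ℓ := by
  refine (integral_sq_le_of_ae_slice_le hf
    (b := fun _ => ℓ * ∫ p, fy p ^ 2 ∂slabMeasure d ℓ) (integrable_const _) ?_).trans_eq ?_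
  · filter_upwards [ae_hasSum_sliceCoeff hf, ae_all_iff.2 fun ξ => norm_sliceCoeff_sq_le hℓ hf hfy h ξ]
      with y hy hy2
    refine hasSum_le_of_sum_le hy fun F => (Finset.sum_le_sum fun ξ _ => hy2 ξ).trans ?_
    rw [← Finset.mul_sum]
    exact mul_le_mul_of_nonneg_left (sum_integral_sliceCoeff_le hfy F) hℓ.le
  · rw [integral_const, measureReal_restrict_apply_univ, Real.volume_real_Ioo_of_le hℓ.le,
      sub_zero, smul_eq_mul]
    ring

theorem integrable_mFourier_mul {g : UnitAddTorus (Fin d) → ℝ} (hg : MemLp g 2 (torusMeasure d))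
    (ξ : Fin d → ℤ) :
    Integrable (fun x => UnitAddTorus.mFourier (-ξ) x * (g x : ℂ)) (torusMeasure d) := by
  have h1 : Integrable g (torusMeasure d) := hg.integrable (by norm_num)
  refine h1.ofReal.bdd_mul (c := 1) (by fun_prop) (Eventually.of_forall fun x => ?_)
  exact (ContinuousMap.norm_coe_le_norm _ _).trans_eq (UnitAddTorus.mFourier_norm)

theorem integral_mul_mFourier {g : UnitAddTorus (Fin d) → ℝ} (hg : MemLp g 2 (torusMeasure d))
    (ξ : Fin d → ℤ) (ζ : ℂ) :
    ∫ x, g x * (ζ * UnitAddTorus.mFourier ξ x).re ∂torusMeasure d =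
      (ζ * (starRingEnd ℂ) (surfaceCoeff g ξ)).re := by
  have hi := integrable_mFourier_mul hg ξ
  have hi2 : Integrable (fun x => ζ * (starRingEnd ℂ)
      (UnitAddTorus.mFourier (-ξ) x * (g x : ℂ))) (torusMeasure d) := by
    refine Integrable.const_mul ?_ ζ
    have := Complex.conjCLE.toContinuousLinearMap.integrable_comp hi
    simpa using this
  have e : surfaceCoeff g ξ = ∫ x, UnitAddTorus.mFourier (-ξ) x * (g x : ℂ) ∂torusMeasure d := rfl
  rw [e, ← integral_conj, ← integral_const_mul]
  have := Complex.reCLM.integral_comp_comm hi2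
  simp only [Complex.reCLM_apply] at this
  rw [← this]
  refine integral_congr_ae (Eventually.of_forall fun x => ?_)
  simp only [map_mul, Complex.conj_ofReal, UnitAddTorus.mFourier_neg, Complex.conj_conj]
  rw [← mul_assoc, mul_comm _ (g x : ℂ), Complex.re_ofReal_mul]

/-- The profiles `y/ℓ` and `1 - y/ℓ` are admissible for the top and bottom trace respectively. They
add up to `1`, so the terms in `f` cancel and those in `fy` combine. -/
theorem surfaceCoeff_topTrace (hℓ : 0 < ℓ) {f fy : UnitAddTorus (Fin d) × ℝ → ℝ}
    (hf : MemLp f 2 (slabMeasure d ℓ)) (hfy : MemLp fy 2 (slabMeasure d ℓ))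
    (h : HasBottomTrace ℓ f fy 0) {g : UnitAddTorus (Fin d) → ℝ} (hg : MemLp g 2 (torusMeasure d))
    (ht : HasTopTrace ℓ f fy g) (ξ : Fin d → ℤ) :
    surfaceCoeff g ξ = ∫ y in Ioo 0 ℓ, sliceCoeff fy ξ y := by
  have hc : ContDiff ℝ ∞ fun y : ℝ => y / ℓ := by fun_prop
  have hb := hasBottomTrace_mode hf hfy h ξ (χ := fun y => 1 - y / ℓ) (by fun_prop)
    (by simp [hℓ.ne'])
  have e1 : deriv (fun y : ℝ => y / ℓ) = fun _ => 1 / ℓ := by ext y; simp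
  have e2 : deriv (fun y : ℝ => 1 - y / ℓ) = fun _ => -(1 / ℓ) := by
    ext y; rw [deriv_const_sub]; simp
  have htop : (∫ y in Ioo 0 ℓ, (y / ℓ) • sliceCoeff fy ξ y) +
      ∫ y in Ioo 0 ℓ, (1 / ℓ) • sliceCoeff f ξ y = surfaceCoeff g ξ := by
    refine eq_of_forall_re_mul_conj fun ζ => ?_
    have h2 := ht (mode ξ ζ fun y => y / ℓ) (isSmooth_mode ξ ζ hc) fun x => by simp [mode]
    rw [pd_last_mode, integral_mul_mode hfy ξ _ hc.continuous, e1,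
      integral_mul_mode hf ξ _ continuous_const] at h2
    simp only [mode, div_self hℓ.ne', mul_one, integral_mul_mFourier hg] at h2
    rw [map_add, mul_add, Complex.add_re]
    exact h2
  rw [e2] at hb
  simp only [sub_smul, one_smul, neg_smul, integral_neg] at hb
  rw [integral_sub (integrableOn_sliceCoeff hfy ξ)
    (integrable_smul_sliceCoeff hfy ξ hc.continuous)] at hb
  rw [← htop]
  linear_combination -hb

/-- Cauchy–Schwarz for each coefficient, then summation. An `L²` bound is enough, because the trace
is only lifted back into `L²(Ω)`. -/
theorem integral_topTrace_sq_le (hℓ : 0 < ℓ) {f fy : UnitAddTorus (Fin d) × ℝ → ℝ}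
    (hf : MemLp f 2 (slabMeasure d ℓ)) (hfy : MemLp fy 2 (slabMeasure d ℓ))
    (h : HasBottomTrace ℓ f fy 0) {g : UnitAddTorus (Fin d) → ℝ} (hg : MemLp g 2 (torusMeasure d))
    (ht : HasTopTrace ℓ f fy g) :
    ∫ x, g x ^ 2 ∂torusMeasure d ≤ ℓ * ∫ p, fy p ^ 2 ∂slabMeasure d ℓ := by
  refine hasSum_le_of_sum_le (hasSum_surfaceCoeff hg) fun F => ?_
  refine le_trans (Finset.sum_le_sum fun ξ _ => ?_)
    ((Finset.mul_sum F _ ℓ).symm.trans_le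
      (mul_le_mul_of_nonneg_left (sum_integral_sliceCoeff_le hfy F) hℓ.le))
  rw [surfaceCoeff_topTrace hℓ hf hfy h hg ht ξ]
  refine (norm_integral_sq_le (memLp_sliceCoeff hfy ξ)).trans_eq ?_
  rw [measureReal_restrict_apply_univ, Real.volume_real_Ioo_of_le hℓ.le, sub_zero]

end SliceDerivatives

/-! ### Korn's inequality for fields vanishing at the bottom -/

section Korn

variable {d : ℕ} {ℓ : ℝ}

/-- The right side exceeds the left by `2 (∑ xᵢpᵢ)²`. This is the algebra behind Korn: the
symmetrised product of two vectors controls the product of their lengths. -/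
theorem two_mul_sum_sq_mul_le {ι : Type*} (s : Finset ι) (x p : ι → ℝ) :
    2 * (∑ i ∈ s, x i ^ 2) * ∑ j ∈ s, p j ^ 2 ≤ ∑ i ∈ s, ∑ j ∈ s, (x i * p j + x j * p i) ^ 2 := by
  have e : ∑ i ∈ s, ∑ j ∈ s, (x i * p j + x j * p i) ^ 2 =
      2 * (∑ i ∈ s, x i ^ 2) * (∑ j ∈ s, p j ^ 2) + 2 * (∑ i ∈ s, x i * p i) ^ 2 := by
    have h1 : ∀ i j, (x i * p j + x j * p i) ^ 2 =
        x i ^ 2 * p j ^ 2 + p i ^ 2 * x j ^ 2 + 2 * ((x i * p i) * (x j * p j)) := fun i j => by ring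
    simp_rw [h1, Finset.sum_add_distrib, ← Finset.mul_sum, ← Finset.sum_mul]
    ring
  rw [e]
  nlinarith [sq_nonneg (∑ i ∈ s, x i * p i)]

theorem two_mul_sum_sq_mul_norm_le {ι : Type*} (s : Finset ι) (x : ι → ℝ) (a : ι → ℂ) :
    2 * (∑ i ∈ s, x i ^ 2) * ∑ j ∈ s, ‖a j‖ ^ 2 ≤
      ∑ i ∈ s, ∑ j ∈ s, ‖x i * a j + x j * a i‖ ^ 2 := by
  have h1 := two_mul_sum_sq_mul_le s x fun j => (a j).re
  have h2 := two_mul_sum_sq_mul_le s x fun j => (a j).im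
  have e : ∀ z : ℂ, ‖z‖ ^ 2 = z.re ^ 2 + z.im ^ 2 := fun z => by
    rw [Complex.sq_norm, Complex.normSq_apply]; ring
  simp only [e, Finset.sum_add_distrib, Complex.add_re, Complex.add_im, Complex.re_ofReal_mul,
    Complex.im_ofReal_mul]
  linarith

/-- The transposition of matrices, as an isometry. -/
def transpose (n : ℕ) : EuclideanSpace ℝ (Fin n × Fin n) ≃ₗᵢ[ℝ] EuclideanSpace ℝ (Fin n × Fin n) :=
  LinearIsometryEquiv.piLpCongrLeft 2 ℝ ℝ (Equiv.prodComm (Fin n) (Fin n))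

/-- The symmetrisation `G ↦ G + Gᵀ` of matrices. -/
def symmetrize (n : ℕ) : EuclideanSpace ℝ (Fin n × Fin n) →L[ℝ] EuclideanSpace ℝ (Fin n × Fin n) :=
  ContinuousLinearMap.id ℝ _ + (transpose n).toContinuousLinearEquiv.toContinuousLinearMap

theorem symmetrize_apply (n : ℕ) (G : EuclideanSpace ℝ (Fin n × Fin n)) (i j : Fin n) :
    symmetrize n G (i, j) = G (i, j) + G (j, i) := by
  simp [symmetrize, transpose]

theorem norm_symmetrize_le (n : ℕ) : ‖symmetrize n‖ ≤ 2 := by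
  refine ContinuousLinearMap.opNorm_le_bound _ (by norm_num) fun G => ?_
  refine (norm_add_le G (transpose n G)).trans (le_of_eq ?_)
  rw [LinearIsometryEquiv.norm_map, two_mul]

/-- The velocity field, as a bounded operator. -/
def velocityCLM (d : ℕ) (ℓ : ℝ) : Solenoidal d ℓ →L[ℝ] VelocityL2 d ℓ :=
  (WithLp.fstL 2 ℝ (VelocityL2 d ℓ) (GradientL2 d ℓ)).comp (Solenoidal d ℓ).subtypeL

/-- The gradient, as a bounded operator. -/
def gradientCLM (d : ℕ) (ℓ : ℝ) : Solenoidal d ℓ →L[ℝ] GradientL2 d ℓ :=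
  (WithLp.sndL 2 ℝ (VelocityL2 d ℓ) (GradientL2 d ℓ)).comp (Solenoidal d ℓ).subtypeL

/-- The symmetrised gradient `𝔻v`, as a bounded operator. -/
def symGrad (d : ℕ) (ℓ : ℝ) : Solenoidal d ℓ →L[ℝ] GradientL2 d ℓ :=
  ((symmetrize (d + 1)).compLpL 2 (slabMeasure d ℓ)).comp (gradientCLM d ℓ)

theorem velocityCLM_apply (v : Solenoidal d ℓ) : velocityCLM d ℓ v = velocity v := rfl

theorem gradientCLM_apply (v : Solenoidal d ℓ) : gradientCLM d ℓ v = velocityGradient v := rfl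

theorem symGrad_ae (v : Solenoidal d ℓ) : ∀ᵐ p ∂slabMeasure d ℓ, ∀ i j,
    symGrad d ℓ v p (i, j) = velocityGradient v p (i, j) + velocityGradient v p (j, i) := by
  filter_upwards [(symmetrize (d + 1)).coeFn_compLp (velocityGradient v)] with p hp i j
  rw [← symmetrize_apply]
  exact congrArg (fun G : EuclideanSpace ℝ (Fin (d + 1) × Fin (d + 1)) => G (i, j)) hp

theorem norm_symGrad_sq_le (v : Solenoidal d ℓ) : ‖symGrad d ℓ v‖ ^ 2 ≤ 4 * ‖velocityGradient v‖ ^ 2 := by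
  have h : ‖symGrad d ℓ v‖ ≤ 2 * ‖velocityGradient v‖ :=
    ((symmetrize (d + 1)).norm_compLp_le (velocityGradient v)).trans
      (mul_le_mul_of_nonneg_right (norm_symmetrize_le _) (norm_nonneg _))
  calc _ ≤ (2 * ‖velocityGradient v‖) ^ 2 := by gcongr
    _ = _ := by ring

theorem symGradInner_eq (u v : Solenoidal d ℓ) :
    symGradInner u v = inner ℝ (symGrad d ℓ u) (symGrad d ℓ v) := by
  rw [L2.inner_def]
  refine integral_congr_ae ?_
  filter_upwards [symGrad_ae u, symGrad_ae v] with p hu hv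
  rw [PiLp.inner_apply, Fintype.sum_prod_type]
  refine Finset.sum_congr rfl fun i _ => Finset.sum_congr rfl fun j _ => ?_
  rw [← hu, ← hv, RCLike.inner_apply, conj_trivial, mul_comm]

theorem ae_sliceCoeff_congr {f f' : UnitAddTorus (Fin d) × ℝ → ℝ} (h : f =ᵐ[slabMeasure d ℓ] f') :
    ∀ᵐ y ∂volume.restrict (Ioo 0 ℓ), ∀ ξ, sliceCoeff f ξ y = sliceCoeff f' ξ y := by
  have h1 : ∀ᵐ q ∂(volume.restrict (Ioo 0 ℓ)).prod (torusMeasure d), f q.swap = f' q.swap :=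
    Measure.measurePreserving_swap.quasiMeasurePreserving.ae h
  filter_upwards [Measure.ae_ae_of_ae_prod h1] with y hy ξ
  refine integral_congr_ae ?_
  filter_upwards [hy] with x hx
  simp only [Prod.swap_prod_mk] at hx
  rw [hx]

theorem surfaceCoeff_add {f g : UnitAddTorus (Fin d) → ℝ} (hf : MemLp f 2 (torusMeasure d))
    (hg : MemLp g 2 (torusMeasure d)) (ξ : Fin d → ℤ) :
    surfaceCoeff (fun x => f x + g x) ξ = surfaceCoeff f ξ + surfaceCoeff g ξ := by
  refine Eq.trans ?_ (integral_add (integrable_mFourier_mul hf ξ) (integrable_mFourier_mul hg ξ))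
  refine integral_congr_ae (Eventually.of_forall fun x => ?_)
  simp only [smul_eq_mul, Complex.ofReal_add, mul_add]

theorem ae_sliceCoeff_symGrad (v : Solenoidal d ℓ) (i j : Fin (d + 1)) :
    ∀ᵐ y ∂volume.restrict (Ioo 0 ℓ), ∀ ξ, sliceCoeff (fun p => symGrad d ℓ v p (i, j)) ξ y =
      sliceCoeff (fun p => velocityGradient v p (i, j)) ξ y +
        sliceCoeff (fun p => velocityGradient v p (j, i)) ξ y := by
  have h : (fun p => symGrad d ℓ v p (i, j)) =ᵐ[slabMeasure d ℓ]
      fun p => velocityGradient v p (i, j) + velocityGradient v p (j, i) := by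
    filter_upwards [symGrad_ae v] with p hp
    exact hp i j
  filter_upwards [ae_sliceCoeff_congr h, ae_memLp_slice (memLp_coord (velocityGradient v) (i, j)),
    ae_memLp_slice (memLp_coord (velocityGradient v) (j, i))] with y h1 h2 h3 ξ
  rw [h1]
  exact surfaceCoeff_add h2 h3 ξ

theorem integral_symGrad_coord_le (v : Solenoidal d ℓ) (q : Fin (d + 1) × Fin (d + 1)) :
    ∫ p, symGrad d ℓ v p q ^ 2 ∂slabMeasure d ℓ ≤ ‖symGrad d ℓ v‖ ^ 2 := by
  rw [norm_sq_eq_sum_integral]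
  exact Finset.single_le_sum (f := fun q => ∫ p, symGrad d ℓ v p q ^ 2 ∂slabMeasure d ℓ)
    (fun _ _ => integral_nonneg fun _ => sq_nonneg _) (Finset.mem_univ q)

theorem integral_dz_vertical_le (v : Solenoidal d ℓ) :
    ∫ p, velocityGradient v p (Fin.last d, Fin.last d) ^ 2 ∂slabMeasure d ℓ ≤
      ‖symGrad d ℓ v‖ ^ 2 := by
  refine le_trans ?_ (integral_symGrad_coord_le v (Fin.last d, Fin.last d))
  refine integral_mono_ae (memLp_coord _ _).integrable_sq (memLp_coord _ _).integrable_sq ?_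
  filter_upwards [symGrad_ae v] with p hp
  rw [hp]
  nlinarith [sq_nonneg (velocityGradient v p (Fin.last d, Fin.last d))]

theorem integral_vertical_le (hℓ : 0 < ℓ) (v : Solenoidal d ℓ) :
    ∫ p, velocity v p (Fin.last d) ^ 2 ∂slabMeasure d ℓ ≤ ℓ ^ 2 * ‖symGrad d ℓ v‖ ^ 2 :=
  (integral_sq_le_of_hasBottomTrace hℓ (memLp_coord _ _) (memLp_coord _ _)
    (v.2.2.1 (Fin.last d))).trans
    (mul_le_mul_of_nonneg_left (integral_dz_vertical_le v) (sq_nonneg ℓ))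

/-- For `ξ ≠ 0` the horizontal block of `𝔻v` alone controls the mode, with no vertical derivatives.
The mode `ξ = 0` is invisible to that block and is recovered from the mixed entries by Poincaré. -/
theorem norm_sliceCoeff_horizontal_le (hℓ : 0 < ℓ) (v : Solenoidal d ℓ) (j : Fin d) :
    ∀ᵐ y ∂volume.restrict (Ioo 0 ℓ), ∀ ξ, ‖sliceCoeff (fun p => velocity v p j.castSucc) ξ y‖ ^ 2 ≤
      ∑ q, ‖sliceCoeff (fun p => symGrad d ℓ v p q) ξ y‖ ^ 2 +
        if ξ = 0 then ℓ * ‖symGrad d ℓ v‖ ^ 2 else 0 := by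
  have hw : IsWeakGradient ℓ (velocity v) (velocityGradient v) := v.2.1
  have hA := ae_all_iff.2 fun i => ae_all_iff.2 fun k => ae_sliceCoeff_symGrad v i k
  have hG := ae_all_iff.2 fun i => ae_all_iff.2 fun k => ae_all_iff.2 fun ξ =>
    sliceCoeff_horizontal hw i k ξ
  -- The horizontal derivative of `v_N` has no zero mode, so the zero mode of the mixed entry is
  -- that of `∂_y vⱼ` alone.
  have hzero : ∀ᵐ y ∂volume.restrict (Ioo 0 ℓ),
      sliceCoeff (fun p => symGrad d ℓ v p (Fin.last d, j.castSucc)) 0 y =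
        sliceCoeff (fun p => velocityGradient v p (Fin.last d, j.castSucc)) 0 y := by
    filter_upwards [hA, hG] with y hA hG
    rw [hA, hG]
    simp
  have hint : ∫ y in Ioo 0 ℓ,
      ‖sliceCoeff (fun p => velocityGradient v p (Fin.last d, j.castSucc)) 0 y‖ ^ 2 ≤
      ‖symGrad d ℓ v‖ ^ 2 := by
    have h1 := sum_integral_sliceCoeff_le
      (memLp_coord (symGrad d ℓ v) (Fin.last d, j.castSucc)) {0}
    rw [Finset.sum_singleton] at h1
    refine le_trans (le_of_eq ?_) (h1.trans (integral_symGrad_coord_le v _))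
    refine integral_congr_ae ?_
    filter_upwards [hzero] with y hy
    rw [hy]
  filter_upwards [hA, hG, norm_sliceCoeff_sq_le hℓ (memLp_coord (velocity v) j.castSucc)
    (memLp_coord (velocityGradient v) (Fin.last d, j.castSucc)) (v.2.2.1 j.castSucc) 0]
    with y hA hG h0 ξ
  have hn : 0 ≤ ∑ q, ‖sliceCoeff (fun p => symGrad d ℓ v p q) ξ y‖ ^ 2 :=
    Finset.sum_nonneg fun _ _ => sq_nonneg _
  by_cases hξ : ξ = 0
  · subst hξ
    rw [if_pos rfl]
    have := h0.trans (mul_le_mul_of_nonneg_left hint hℓ.le)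
    linarith
  · rw [if_neg hξ, add_zero]
    set a : Fin d → ℂ := fun k => sliceCoeff (fun p => velocity v p k.castSucc) ξ y
    -- After removing a factor `i`, the horizontal block is the symmetrised product of the real
    -- vector `2πξ` with the vector `a` of coefficients.
    have e : ∀ i k : Fin d, ‖sliceCoeff (fun p => symGrad d ℓ v p (i.castSucc, k.castSucc)) ξ y‖ ^ 2 =
        ‖((2 * Real.pi * ξ i : ℝ) : ℂ) * a k + ((2 * Real.pi * ξ k : ℝ) : ℂ) * a i‖ ^ 2 := fun i k => by
      have e1 : sliceCoeff (fun p => symGrad d ℓ v p (i.castSucc, k.castSucc)) ξ y = Complex.I *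
          (((2 * Real.pi * ξ i : ℝ) : ℂ) * a k + ((2 * Real.pi * ξ k : ℝ) : ℂ) * a i) := by
        rw [hA, hG, hG]
        push_cast
        ring
      rw [e1, norm_mul, Complex.norm_I, one_mul]
    have h1 := two_mul_sum_sq_mul_norm_le Finset.univ (fun i : Fin d => 2 * Real.pi * (ξ i : ℝ)) a
    rw [sum_wave_sq] at h1
    have h2 : ∑ i : Fin d, ∑ k : Fin d,
        ‖sliceCoeff (fun p => symGrad d ℓ v p (i.castSucc, k.castSucc)) ξ y‖ ^ 2 ≤
        ∑ q, ‖sliceCoeff (fun p => symGrad d ℓ v p q) ξ y‖ ^ 2 := by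
      rw [Fintype.sum_prod_type, Fin.sum_univ_castSucc (n := d)]
      refine le_add_of_le_of_nonneg (Finset.sum_le_sum fun i _ => ?_)
        (Finset.sum_nonneg fun _ _ => sq_nonneg _)
      rw [Fin.sum_univ_castSucc (n := d)]
      exact le_add_of_nonneg_right (sq_nonneg _)
    simp only [e] at h2
    have h3 : ‖a j‖ ^ 2 ≤ ∑ k, ‖a k‖ ^ 2 :=
      Finset.single_le_sum (f := fun k => ‖a k‖ ^ 2) (fun _ _ => sq_nonneg _) (Finset.mem_univ j)
    have h4 := one_le_waveNorm hξ
    have h5 : 0 ≤ ∑ k, ‖a k‖ ^ 2 := Finset.sum_nonneg fun _ _ => sq_nonneg _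
    have h6 : (1 : ℝ) ≤ waveNorm ξ ^ 2 := one_le_pow₀ h4
    nlinarith [mul_le_mul_of_nonneg_right h6 h5]

theorem integral_horizontal_le (hℓ : 0 < ℓ) (v : Solenoidal d ℓ) (j : Fin d) :
    ∫ p, velocity v p j.castSucc ^ 2 ∂slabMeasure d ℓ ≤ (1 + ℓ ^ 2) * ‖symGrad d ℓ v‖ ^ 2 := by
  have hsq : ∀ q, Integrable (fun p => symGrad d ℓ v p q ^ 2) (slabMeasure d ℓ) := fun q =>
    (memLp_coord _ q).integrable_sq
  have hi : Integrable (fun y => ∑ q, ∫ x, symGrad d ℓ v (x, y) q ^ 2 ∂torusMeasure d)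
      (volume.restrict (Ioo 0 ℓ)) :=
    integrable_finsetSum _ fun q _ => (hsq q).integral_prod_right
  refine (integral_sq_le_of_ae_slice_le (memLp_coord (velocity v) j.castSucc)
    (b := fun y => ∑ q, ∫ x, symGrad d ℓ v (x, y) q ^ 2 ∂torusMeasure d + ℓ * ‖symGrad d ℓ v‖ ^ 2)
    (hi.add (integrable_const _)) ?_).trans_eq ?_
  · filter_upwards [norm_sliceCoeff_horizontal_le hℓ v j,
      ae_hasSum_sliceCoeff (memLp_coord (velocity v) j.castSucc),
      ae_all_iff.2 fun q => ae_hasSum_sliceCoeff (memLp_coord (symGrad d ℓ v) q)] with y h1 h2 h3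
    exact hasSum_le h1 h2 ((hasSum_sum fun q _ => h3 q).add
      (hasSum_ite_eq (0 : Fin d → ℤ) (ℓ * ‖symGrad d ℓ v‖ ^ 2)))
  · rw [integral_add hi (integrable_const _), integral_const, measureReal_restrict_apply_univ,
      Real.volume_real_Ioo_of_le hℓ.le, sub_zero, smul_eq_mul,
      integral_finsetSum _ fun q _ => (hsq q).integral_prod_right]
    have e : ∑ q, ∫ y in Ioo 0 ℓ, ∫ x, symGrad d ℓ v (x, y) q ^ 2 ∂torusMeasure d =
        ‖symGrad d ℓ v‖ ^ 2 := by
      rw [norm_sq_eq_sum_integral]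
      exact Finset.sum_congr rfl fun q _ => (integral_prod_symm _ (hsq q)).symm
    rw [e]
    ring

/-- Korn's inequality in the solenoidal space. -/
theorem norm_velocity_sq_le (hℓ : 0 < ℓ) (v : Solenoidal d ℓ) :
    ‖velocity v‖ ^ 2 ≤ ((d : ℝ) + 1) * (1 + ℓ ^ 2) * ‖symGrad d ℓ v‖ ^ 2 := by
  rw [norm_sq_eq_sum_integral, Fin.sum_univ_castSucc]
  have h1 := Finset.sum_le_sum fun j (_ : j ∈ Finset.univ) => integral_horizontal_le hℓ v j
  have h2 := integral_vertical_le hℓ v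
  rw [Finset.sum_const, Finset.card_univ, Fintype.card_fin, nsmul_eq_mul] at h1
  nlinarith [sq_nonneg ‖symGrad d ℓ v‖]

/-- Only `∂_y v_N` is needed, and it is half of a diagonal entry of `𝔻v`; Korn's inequality plays no
role here. -/
theorem norm_topTrace_sq_le (hℓ : 0 < ℓ) (v : Solenoidal d ℓ) {g : SurfaceL2 d}
    (hg : IsTopNormalTrace v g) : ‖g‖ ^ 2 ≤ ℓ * ‖symGrad d ℓ v‖ ^ 2 := by
  have e : ‖g‖ ^ 2 = ∫ x, g x ^ 2 ∂torusMeasure d := by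
    rw [← real_inner_self_eq_norm_sq, L2.inner_def]
    refine integral_congr_ae (Eventually.of_forall fun x => ?_)
    simp only [real_inner_self_eq_norm_sq, Real.norm_eq_abs, sq_abs]
  rw [e]
  exact (integral_topTrace_sq_le hℓ (memLp_coord _ _) (memLp_coord _ _)
    (v.2.2.1 (Fin.last d)) (Lp.memLp g) hg).trans
    (mul_le_mul_of_nonneg_left (integral_dz_vertical_le v) hℓ.le)

end Korn

/-! ### Completeness of the solenoidal space -/

section Completeness

variable {d : ℕ} {ℓ : ℝ}

/-- On the slab the functional is the inner product with a fixed `L²` field whose only nonzero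
component is `ψ`. -/
theorem continuous_integral_coord_mul {ι : Type} [Fintype ι] (i : ι)
    {ψ : UnitAddTorus (Fin d) × ℝ → ℝ} (hψ : Continuous ψ) :
    Continuous fun f : Lp (EuclideanSpace ℝ ι) 2 (slabMeasure d ℓ) =>
      ∫ p, f p i * ψ p ∂slabMeasure d ℓ := by
  classical
  have hc : ∀ k, Continuous ((fun k => if k = i then ψ else 0 : ι → UnitAddTorus (Fin d) × ℝ → ℝ) k) :=
    fun k => by
      simp only
      split_ifs
      · exact hψ
      · exact continuous_zero
  have e : ∀ f : Lp (EuclideanSpace ℝ ι) 2 (slabMeasure d ℓ),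
      ∫ p, f p i * ψ p ∂slabMeasure d ℓ =
        inner ℝ (fieldL2 ℓ (fun k => if k = i then ψ else 0) hc) f := fun f => by
    rw [L2.inner_def]
    refine integral_congr_ae ?_
    filter_upwards [fieldL2_ae (ℓ := ℓ) _ hc] with p hp
    rw [PiLp.inner_apply, Finset.sum_eq_single i]
    · rw [hp, if_pos rfl, RCLike.inner_apply, conj_trivial]
    · intro k _ hk
      rw [hp, if_neg hk, Pi.zero_apply, inner_zero_left]
    · simp
  simp_rw [e]
  exact continuous_const.inner continuous_id

/-- The trace of a matrix. -/
def matrixTrace (n : ℕ) : EuclideanSpace ℝ (Fin n × Fin n) →L[ℝ] ℝ :=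
  ∑ i, EuclideanSpace.proj (i, i)

theorem divergence_free_iff (G : GradientL2 d ℓ) :
    (∀ᵐ p ∂slabMeasure d ℓ, ∑ i, G p (i, i) = 0) ↔
      (matrixTrace (d + 1)).compLpL 2 (slabMeasure d ℓ) G = 0 := by
  rw [Lp.eq_zero_iff_ae_eq_zero]
  have h := (matrixTrace (d + 1)).coeFn_compLp G
  have e : ∀ p, matrixTrace (d + 1) (G p) = ∑ i, G p (i, i) := fun p => by
    simp [matrixTrace]
  constructor
  · intro h0
    filter_upwards [h, h0] with p h1 h2
    exact h1.trans ((e p).trans h2)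
  · intro h0
    filter_upwards [h, h0] with p h1 h2
    exact (e p).symm.trans (h1.symm.trans h2)

/-- Each constraint equates continuous functions of the pair `(u, ∇u)`. The resulting completeness
is needed for Bochner integrals of curves in the solenoidal space. -/
theorem isClosed_solenoidal :
    IsClosed (Solenoidal d ℓ : Set (WithLp 2 (VelocityL2 d ℓ × GradientL2 d ℓ))) := by
  have hfst := (WithLp.fstL 2 ℝ (VelocityL2 d ℓ) (GradientL2 d ℓ)).continuous
  have hsnd := (WithLp.sndL 2 ℝ (VelocityL2 d ℓ) (GradientL2 d ℓ)).continuous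
  have h : (Solenoidal d ℓ : Set (WithLp 2 (VelocityL2 d ℓ × GradientL2 d ℓ))) =
      {v | IsWeakGradient ℓ v.fst v.snd} ∩
        ({v | ∀ j, HasBottomTrace ℓ (fun p => v.fst p j) (fun p => v.snd p (Fin.last d, j)) 0} ∩
        {v | (matrixTrace (d + 1)).compLpL 2 (slabMeasure d ℓ) v.snd = 0}) := by
    ext v
    simp only [mem_inter_iff, mem_ofPred_eq, ← divergence_free_iff]
    rfl
  rw [h]
  refine IsClosed.inter ?_ (IsClosed.inter ?_ ?_)
  · simp only [IsWeakGradient, ofPred_forall]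
    refine isClosed_iInter fun φ => isClosed_iInter fun hφ => isClosed_iInter fun _ =>
      isClosed_iInter fun i => isClosed_iInter fun j => isClosed_eq ?_ ?_
    · exact (continuous_integral_coord_mul j (continuous_pd hφ i)).comp hfst
    · exact ((continuous_integral_coord_mul (i, j) hφ.continuous).comp hsnd).neg
  · simp only [HasBottomTrace, ofPred_forall]
    refine isClosed_iInter fun j => isClosed_iInter fun φ => isClosed_iInter fun hφ =>
      isClosed_iInter fun _ => isClosed_eq (Continuous.add ?_ ?_) continuous_const
    · exact (continuous_integral_coord_mul (Fin.last d, j) hφ.continuous).comp hsnd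
    · exact (continuous_integral_coord_mul j (continuous_pd hφ (Fin.last d))).comp hfst
  · exact isClosed_eq (((matrixTrace (d + 1)).compLpL 2 (slabMeasure d ℓ)).continuous.comp hsnd)
      continuous_const

instance : CompleteSpace (Solenoidal d ℓ) := isClosed_solenoidal.completeSpace_coe

end Completeness

/-! ### Real Fourier coefficients on the surface -/

section SurfaceCoefficients

variable {d : ℕ}

/-- The real wave `Re (ζ e^{2πi ξ·x})` as an element of `L²(Σ)`. -/
def waveL2 (ζ : ℂ) (ξ : Fin d → ℤ) : SurfaceL2 d :=
  MemLp.toLp (fun x => (ζ * UnitAddTorus.mFourier ξ x).re)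
    ((show Continuous fun x => (ζ * UnitAddTorus.mFourier ξ x).re by fun_prop).memLp_of_hasCompactSupport
      (HasCompactSupport.of_compactSpace _))

theorem waveL2_ae (ζ : ℂ) (ξ : Fin d → ℤ) :
    ∀ᵐ x ∂torusMeasure d, waveL2 ζ ξ x = (ζ * UnitAddTorus.mFourier ξ x).re :=
  MemLp.coeFn_toLp _

theorem integral_mul_waveL2 (f : SurfaceL2 d) (ζ : ℂ) (ξ : Fin d → ℤ) :
    ∫ x, f x * waveL2 ζ ξ x ∂torusMeasure d = (ζ * (starRingEnd ℂ) (surfaceCoeff f ξ)).re := by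
  rw [← integral_mul_mFourier (Lp.memLp f)]
  refine integral_congr_ae ?_
  filter_upwards [waveL2_ae ζ ξ] with x hx
  rw [hx]

theorem inner_surface (f g : SurfaceL2 d) : inner ℝ f g = ∫ x, f x * g x ∂torusMeasure d := by
  rw [L2.inner_def]
  refine integral_congr_ae (Eventually.of_forall fun x => ?_)
  simp only [RCLike.inner_apply, conj_trivial, mul_comm]

/-- The real and the imaginary part of a Fourier coefficient. -/
def realCoeff (j : (Fin d → ℤ) × Bool) : SurfaceL2 d →L[ℝ] ℝ :=
  innerSL ℝ (waveL2 (if j.2 then Complex.I else 1) j.1)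

theorem realCoeff_apply (j : (Fin d → ℤ) × Bool) (f : SurfaceL2 d) :
    realCoeff j f =
      ((if j.2 then Complex.I else 1) * (starRingEnd ℂ) (surfaceCoeff f j.1)).re := by
  rw [← integral_mul_waveL2, ← inner_surface, real_inner_comm]
  rfl

theorem realCoeff_false (ξ : Fin d → ℤ) (f : SurfaceL2 d) :
    realCoeff (ξ, false) f = (surfaceCoeff f ξ).re := by
  simp [realCoeff_apply]

theorem realCoeff_true (ξ : Fin d → ℤ) (f : SurfaceL2 d) :
    realCoeff (ξ, true) f = (surfaceCoeff f ξ).im := by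
  simp [realCoeff_apply]

theorem norm_surfaceCoeff_sq (ξ : Fin d → ℤ) (f : SurfaceL2 d) :
    ‖surfaceCoeff f ξ‖ ^ 2 = realCoeff (ξ, false) f ^ 2 + realCoeff (ξ, true) f ^ 2 := by
  rw [realCoeff_false, realCoeff_true, Complex.sq_norm, Complex.normSq_apply]
  ring

theorem hasSum_prod_bool {Ξ : Type*} {a : Ξ × Bool → ℝ} (ha : ∀ j, 0 ≤ a j) {s : ℝ}
    (h : HasSum (fun ξ => a (ξ, false) + a (ξ, true)) s) : HasSum a s := by
  have e : ∀ ξ, ∑' b, a (ξ, b) = a (ξ, false) + a (ξ, true) := fun ξ => by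
    rw [tsum_fintype, Fintype.sum_bool, add_comm]
  have hs : Summable a := by
    rw [summable_prod_of_nonneg ha]
    refine ⟨fun ξ => .of_finite, ?_⟩
    simpa only [e] using h.summable
  have h2 := hs.tsum_prod
  simp only [e] at h2
  rw [← h.tsum_eq, ← h2]
  exact hs.hasSum

/-- Both `ξ` and `-ξ` are listed, so this is a redundant family rather than a basis; the squared
real and imaginary parts add up to the squared modulus of the complex coefficient. -/
theorem isParseval_realCoeff : IsParseval (realCoeff (d := d)) := fun f => by
  have e : ‖f‖ ^ 2 = ∫ x, f x ^ 2 ∂torusMeasure d := by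
    rw [← real_inner_self_eq_norm_sq, inner_surface]
    simp only [sq]
  rw [e]
  refine hasSum_prod_bool (fun _ => sq_nonneg _) ?_
  refine (hasSum_surfaceCoeff (Lp.memLp f)).congr_fun fun ξ => ?_
  exact (norm_surfaceCoeff_sq ξ f).symm

theorem surfaceCoeff_zero (f : SurfaceL2 d) :
    surfaceCoeff f 0 = ((∫ x, f x ∂torusMeasure d : ℝ) : ℂ) := by
  rw [← integral_complex_ofReal]
  refine integral_congr_ae (Eventually.of_forall fun x => ?_)
  simp [UnitAddTorus.mFourier_zero]

end SurfaceCoefficients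

/-! ### The symbol and the energy -/

section Energy

variable {d : ℕ} {ℓ g σ r : ℝ}

theorem le_symbol (hσ : 0 < σ) (ξ : Fin d → ℤ) : g ≤ symbol g σ r ξ := by
  have : 0 ≤ waveNorm ξ ^ (2 * r) := Real.rpow_nonneg (waveNorm_nonneg ξ) _
  have h : symbol g σ r ξ = g + σ * waveNorm ξ ^ (2 * r) := rfl
  rw [h]
  nlinarith

/-- The decisive use of `r ≥ ½`: a nonzero wave number is at least `1`, so its power `2r` dominates
it. Through this bound the surface energy pays for the gradient of the lift. -/
theorem waveNorm_le_symbol (hg : 0 < g) (hσ : 0 < σ) (hr : 1 / 2 ≤ r) (ξ : Fin d → ℤ) :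
    σ * waveNorm ξ ≤ symbol g σ r ξ := by
  have h : symbol g σ r ξ = g + σ * waveNorm ξ ^ (2 * r) := rfl
  by_cases hξ : ξ = 0
  · have h0 : waveNorm ξ = 0 := by simp [waveNorm, freqNorm, hξ]
    have := le_symbol (g := g) (r := r) hσ ξ
    rw [h0, mul_zero]
    linarith
  · have h1 := Real.rpow_le_rpow_of_exponent_le (one_le_waveNorm hξ) (by linarith : (1 : ℝ) ≤ 2 * r)
    rw [Real.rpow_one] at h1
    rw [h]
    nlinarith

theorem symbol_le (hg : 0 < g) (hσ : 0 < σ) (hr : 1 / 2 ≤ r) (ξ : Fin d → ℤ) :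
    symbol g σ r ξ ≤ (g + σ * (2 * Real.pi) ^ (2 * r)) * (1 + freqNorm ξ ^ 2) ^ r := by
  have hn : 0 ≤ freqNorm ξ := Real.sqrt_nonneg _
  have h1 : (1 : ℝ) ≤ (1 + freqNorm ξ ^ 2) ^ r :=
    Real.one_le_rpow (by nlinarith) (by linarith)
  have h2 : freqNorm ξ ^ (2 * r) ≤ (1 + freqNorm ξ ^ 2) ^ r := by
    rw [Real.rpow_mul hn, Real.rpow_two]
    exact Real.rpow_le_rpow (by positivity) (by linarith) (by linarith)
  have hp : (0 : ℝ) ≤ 2 * Real.pi := by positivity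
  rw [symbol, Real.mul_rpow hp hn, add_mul, ← mul_assoc]
  have h3 : 0 ≤ σ * (2 * Real.pi) ^ (2 * r) := by positivity
  nlinarith [mul_le_mul_of_nonneg_left h2 h3]

theorem summable_symbol_of_sobolev (hg : 0 < g) (hσ : 0 < σ) (hr : 1 / 2 ≤ r) {h : SurfaceL2 d}
    (hh : sobolevSq r h < ⊤) : Summable fun ξ => symbol g σ r ξ * ‖surfaceCoeff h ξ‖ ^ 2 := by
  have h1 : Summable fun ξ => (1 + freqNorm ξ ^ 2) ^ r * ‖surfaceCoeff h ξ‖ ^ 2 := by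
    have h2 := ENNReal.summable_toReal hh.ne
    refine h2.congr fun ξ => ?_
    rw [ENNReal.toReal_ofReal (by positivity)]
  refine Summable.of_nonneg_of_le (fun ξ => ?_) (fun ξ => ?_)
    (h1.mul_left (g + σ * (2 * Real.pi) ^ (2 * r)))
  · exact mul_nonneg (hg.le.trans (le_symbol hσ ξ)) (sq_nonneg _)
  · rw [← mul_assoc]
    exact mul_le_mul_of_nonneg_right (symbol_le hg hσ hr ξ) (sq_nonneg _)

theorem lintegral_norm_sq (u : VelocityL2 d ℓ) :
    ∫⁻ p, ENNReal.ofReal (‖u p‖ ^ 2) ∂slabMeasure d ℓ = ENNReal.ofReal (‖u‖ ^ 2) := by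
  rw [← ofReal_integral_eq_lintegral_ofReal]
  · rw [← real_inner_self_eq_norm_sq, L2.inner_def]
    simp only [real_inner_self_eq_norm_sq]
  · exact (Lp.memLp u).integrable_norm_pow (by norm_num)
  · exact Eventually.of_forall fun _ => sq_nonneg _

/-- Links the extended energy with the real one of the abstract frame. Summability matters, since a
divergent real `tsum` would be `0` while the energy is infinite. -/
theorem energy_eq {μ : (Fin d → ℤ) → ℝ} (hμ : ∀ ξ, 0 ≤ μ ξ) (u : VelocityL2 d ℓ) {h : SurfaceL2 d}
    (hs : Summable fun j : (Fin d → ℤ) × Bool => μ j.1 * realCoeff j h ^ 2) :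
    energy μ u h = ENNReal.ofReal (1 / 2 * ‖u‖ ^ 2 + 1 / 2 * ∑' j : (Fin d → ℤ) × Bool,
      μ j.1 * realCoeff j h ^ 2) := by
  have e : ∀ ξ, ∑' b, μ ξ * realCoeff (ξ, b) h ^ 2 = μ ξ * ‖surfaceCoeff h ξ‖ ^ 2 := fun ξ => by
    rw [tsum_fintype, Fintype.sum_bool, norm_surfaceCoeff_sq]
    ring
  have h1 := hs.tsum_prod
  have h2 := hs.prod
  simp only [e] at h1 h2
  have hn : ∀ ξ, 0 ≤ μ ξ * ‖surfaceCoeff h ξ‖ ^ 2 := fun ξ => mul_nonneg (hμ ξ) (sq_nonneg _)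
  have half : (1 / 2 : ℝ≥0∞) = ENNReal.ofReal (1 / 2) := by
    rw [ENNReal.ofReal_div_of_pos two_pos, ENNReal.ofReal_one, ENNReal.ofReal_ofNat]
  rw [energy, lintegral_norm_sq, ← ENNReal.ofReal_tsum_of_nonneg hn h2, h1, half,
    ← ENNReal.ofReal_mul (by norm_num), ← ENNReal.ofReal_mul (by norm_num),
    ← ENNReal.ofReal_add (by positivity)]
  exact mul_nonneg (by norm_num) (tsum_nonneg hn)

theorem summable_realCoeff {μ : (Fin d → ℤ) → ℝ} (hμ : ∀ ξ, 0 ≤ μ ξ) {h : SurfaceL2 d}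
    (hs : Summable fun ξ => μ ξ * ‖surfaceCoeff h ξ‖ ^ 2) :
    Summable fun j : (Fin d → ℤ) × Bool => μ j.1 * realCoeff j h ^ 2 := by
  refine (hasSum_prod_bool (fun j => mul_nonneg (hμ j.1) (sq_nonneg _))
    (hs.hasSum.congr_fun fun ξ => ?_)).summable
  rw [norm_surfaceCoeff_sq]
  ring

end Energy

/-! ### The decay frame of the slab -/

section Frame

variable {d : ℕ} {ℓ g σ r : ℝ}

/-- The constant of the spatial estimates. -/
def frameConst (d : ℕ) (ℓ g σ : ℝ) : ℝ :=
  1 / g + ((d : ℝ) + 1) * (1 + ℓ ^ 2) + ((d : ℝ) + 1) * liftConst ℓ +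
    4 * (((d : ℝ) + 1) ^ 2 * liftConst ℓ) / σ + ℓ

theorem isDecayFrame_slab (hℓ : 0 < ℓ) (hg : 0 < g) (hσ : 0 < σ) (hr : 1 / 2 ≤ r) :
    IsDecayFrame (velocityCLM d ℓ) (symGrad d ℓ) realCoeff (fun j => symbol g σ r j.1) (lift hℓ)
      (frameConst d ℓ g σ) := by
  have hL := liftConst_nonneg hℓ
  have h1 : 0 < 1 / g := by positivity
  have h2 : 0 ≤ ((d : ℝ) + 1) * (1 + ℓ ^ 2) := by positivity
  have h3 : 0 ≤ ((d : ℝ) + 1) * liftConst ℓ := by positivity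
  have h4 : 0 ≤ 4 * (((d : ℝ) + 1) ^ 2 * liftConst ℓ) / σ := by positivity
  refine ⟨isParseval_realCoeff, ?_, fun j => ?_, fun v => ?_, fun F c => ?_, fun F c => ?_⟩
  · unfold frameConst
    linarith
  · have hs := le_symbol (g := g) (r := r) hσ j.1
    have e : (1 : ℝ) = 1 / g * g := by field_simp
    rw [e]
    refine mul_le_mul ?_ hs hg.le ?_ <;> unfold frameConst <;> linarith
  · refine (norm_velocity_sq_le hℓ v).trans (mul_le_mul_of_nonneg_right ?_ (sq_nonneg _))
    unfold frameConst
    linarith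
  · rw [map_sum]
    simp only [map_smul, velocityCLM_apply]
    refine (norm_sq_sum_lift_velocity_le hℓ F c).trans (mul_le_mul_of_nonneg_right ?_
      (Finset.sum_nonneg fun _ _ => sq_nonneg _))
    unfold frameConst
    linarith
  · have hb := norm_sq_sum_lift_gradient_le hℓ F c
    have hG : velocityGradient (∑ j ∈ F, c j • lift hℓ j) =
        ∑ j ∈ F, c j • velocityGradient (lift hℓ j) := by
      rw [← gradientCLM_apply, map_sum]
      simp only [map_smul, gradientCLM_apply]
    refine (norm_symGrad_sq_le _).trans ?_
    rw [hG]
    have h5 : ∑ j ∈ F, σ * waveNorm j.1 * c j ^ 2 ≤ ∑ j ∈ F, symbol g σ r j.1 * c j ^ 2 :=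
      Finset.sum_le_sum fun j _ =>
        mul_le_mul_of_nonneg_right (waveNorm_le_symbol hg hσ hr j.1) (sq_nonneg _)
    have h6 : 0 ≤ ∑ j ∈ F, symbol g σ r j.1 * c j ^ 2 := Finset.sum_nonneg fun j _ =>
      mul_nonneg (hg.le.trans (le_symbol hσ j.1)) (sq_nonneg _)
    -- The factor `4` comes from symmetrising the gradient; dividing by `σ` exchanges the wave
    -- number for the symbol.
    calc _ ≤ 4 * (((d : ℝ) + 1) ^ 2 * liftConst ℓ * ∑ j ∈ F, waveNorm j.1 * c j ^ 2) := by gcongr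
      _ = 4 * (((d : ℝ) + 1) ^ 2 * liftConst ℓ) / σ * ∑ j ∈ F, σ * waveNorm j.1 * c j ^ 2 := by
        simp_rw [mul_assoc σ, ← Finset.mul_sum]
        field_simp
      _ ≤ 4 * (((d : ℝ) + 1) ^ 2 * liftConst ℓ) / σ * ∑ j ∈ F, symbol g σ r j.1 * c j ^ 2 :=
        mul_le_mul_of_nonneg_left h5 h4
      _ ≤ _ := by
        refine mul_le_mul_of_nonneg_right ?_ h6
        unfold frameConst
        linarith

theorem le_frameConst (hℓ : 0 < ℓ) (hg : 0 < g) (hσ : 0 < σ) : ℓ ≤ frameConst d ℓ g σ := by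
  have hL := liftConst_nonneg hℓ
  have h1 : 0 < 1 / g := by positivity
  have h2 : 0 ≤ ((d : ℝ) + 1) * (1 + ℓ ^ 2) := by positivity
  have h3 : 0 ≤ ((d : ℝ) + 1) * liftConst ℓ := by positivity
  have h4 : 0 ≤ 4 * (((d : ℝ) + 1) ^ 2 * liftConst ℓ) / σ := by positivity
  unfold frameConst
  linarith

theorem ae_restrict_Ioi_of_forall_Ioo {p : ℝ → Prop}
    (h : ∀ T > 0, ∀ᵐ t ∂volume.restrict (Ioo 0 T), p t) : ∀ᵐ t ∂volume.restrict (Ioi 0), p t := by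
  have e : Ioi (0 : ℝ) = ⋃ n : ℕ, Ioo 0 ((n : ℝ) + 1) := by
    ext t
    simp only [mem_Ioi, mem_iUnion, mem_Ioo]
    refine ⟨fun ht => ?_, fun ⟨_, h⟩ => h.1⟩
    obtain ⟨n, hn⟩ := exists_nat_gt t
    exact ⟨n, ht, by linarith⟩
  rw [e, ae_restrict_iUnion_iff]
  exact fun n => h _ (by positivity)

/-- The lift of the zero mode is zero, which is consistent with the mode equation only because `h`,
and with it `M(h)`, has zero average. -/
theorem realCoeff_eq_integral_lift {h m : SurfaceL2 d} {μ : (Fin d → ℤ) → ℝ}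
    (hm : IsMultiplier μ h m) (h0 : ∫ x, h x ∂torusMeasure d = 0) (j : (Fin d → ℤ) × Bool) :
    ∫ x, m x * waveL2 (phase j.1 j.2) j.1 x ∂torusMeasure d = realCoeff j m := by
  rw [integral_mul_waveL2, realCoeff_apply]
  by_cases hj : j.1 = 0
  · rw [hj, hm 0, surfaceCoeff_zero, h0]
    simp
  · rw [phase, if_neg hj]

theorem isEvolution_of_isWeakSolution (hℓ : 0 < ℓ) (hg : 0 < g) (hσ : 0 < σ)
    {u : ℝ → Solenoidal d ℓ} {h : ℝ → SurfaceL2 d} {u₀ : VelocityL2 d ℓ} {h₀ : SurfaceL2 d}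
    (hw : IsWeakSolution (symbol g σ r) u h u₀ h₀) :
    ∃ w m k, IsEvolution (velocityCLM d ℓ) (symGrad d ℓ) realCoeff (fun j => symbol g σ r j.1)
      (lift hℓ) (frameConst d ℓ g σ) u h w m k := by
  obtain ⟨memU, memH, w, m, k, memW, derivU, memM, hm, memK, -, derivH, heq, htr, h0, -, -⟩ := hw
  refine ⟨w, m, k, memU, memH, memW, memM, memK, derivU, derivH, ?_, ?_, ?_, ?_⟩
  · filter_upwards [hm] with t ht j
    have := ht j.1
    rw [realCoeff_apply, realCoeff_apply, this, map_mul, Complex.conj_ofReal, mul_left_comm,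
      Complex.re_ofReal_mul]
  · refine ae_restrict_Ioi_of_forall_Ioo fun T hT => ?_
    -- The solution is itself an admissible test field, and by the kinematic condition its trace is
    -- `∂ₜh`.
    filter_upwards [heq T hT u (memU T hT) k (ae_restrict_Ioo_of_Ioi htr le_rfl)] with t ht
    rwa [symGradInner_eq, real_inner_self_eq_norm_sq, ← inner_surface] at ht
  -- The exceptional null set of the weak equation depends on the test field; there are only
  -- countably many lifts.
  · rw [ae_all_iff]
    intro j
    refine ae_restrict_Ioi_of_forall_Ioo fun T hT => ?_
    filter_upwards [heq T hT (fun _ => lift hℓ j) (memLp_const _)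
      (fun _ => waveL2 (phase j.1 j.2) j.1)
      (Eventually.of_forall fun _ => isTopNormalTrace_lift hℓ j (waveL2_ae _ _)),
      ae_restrict_Ioo_of_Ioi hm le_rfl, ae_restrict_Ioo_of_Ioi h0 le_rfl] with t h1 h2 h3
    rwa [symGradInner_eq, realCoeff_eq_integral_lift h2 h3] at h1
  · filter_upwards [htr] with t ht
    exact (norm_topTrace_sq_le hℓ _ ht).trans
      (mul_le_mul_of_nonneg_right (le_frameConst hℓ hg hσ) (sq_nonneg _))

/-- Right neighbourhoods of `0` have positive measure, so limits along this filter are unique and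
the initial value is determined. -/
instance neBot_nhdsGT_inf_ae : (𝓝[>] (0 : ℝ) ⊓ ae volume).NeBot := by
  rw [inf_neBot_iff]
  intro s hs t ht
  obtain ⟨ε, hε, hsub⟩ := mem_nhdsGT_iff_exists_Ioo_subset.1 hs
  by_contra hne
  rw [not_nonempty_iff_eq_empty] at hne
  have h1 : Ioo 0 ε ⊆ tᶜ := fun x hx hxt => by
    have : x ∈ s ∩ t := ⟨hsub hx, hxt⟩
    rw [hne] at this
    exact this
  have h2 : volume (Ioo 0 ε) = 0 := measure_mono_null h1 ht
  rw [Real.volume_Ioo, ENNReal.ofReal_eq_zero, sub_zero] at h2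
  exact absurd hε (not_lt.2 h2)

theorem HasInitialValue.eq {X : Type} [TopologicalSpace X] [T2Space X] {f F : ℝ → X} {a : X}
    (hf : HasInitialValue f a) (hF : ContinuousOn F (Ici 0))
    (h : ∀ᵐ t ∂volume.restrict (Ioi 0), F t = f t) : F 0 = a := by
  have h1 : Tendsto F (𝓝[>] 0 ⊓ ae volume) (𝓝 (F 0)) :=
    ((hF 0 self_mem_Ici).mono_left (nhdsWithin_mono _ Ioi_subset_Ici_self)).mono_left inf_le_left
  refine tendsto_nhds_unique (h1.congr' ?_) hf
  rw [ae_restrict_iff' measurableSet_Ioi] at h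
  filter_upwards [(inf_le_right : 𝓝[>] (0 : ℝ) ⊓ ae volume ≤ _) h,
    (inf_le_left : 𝓝[>] (0 : ℝ) ⊓ ae volume ≤ _) self_mem_nhdsWithin] with t h1 h2
  exact h1 h2

end Frame

end ViscousSlab

end

theorem theorem4p1 (d : ℕ) (hd : 1 ≤ d) (ℓ g σ r : ℝ) (hℓ : 0 < ℓ) (hg : 0 < g) (hσ : 0 < σ)
    (hr : 1 / 2 ≤ r) :
    ∃ c > 0, ∃ K > 0,
      ∀ (u : ℝ → ViscousSlab.Solenoidal d ℓ) (h : ℝ → ViscousSlab.SurfaceL2 d)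
        (u₀ : ViscousSlab.VelocityL2 d ℓ) (h₀ : ViscousSlab.SurfaceL2 d),
        ViscousSlab.IsWeakSolution (ViscousSlab.symbol g σ r) u h u₀ h₀ →
        ViscousSlab.sobolevSq r h₀ < ⊤ →
        ∃ (U : ℝ → ViscousSlab.VelocityL2 d ℓ) (H : ℝ → ViscousSlab.SurfaceL2 d),
          ContinuousOn U (Ici 0) ∧ ContinuousOn H (Ici 0) ∧
          (∀ᵐ t ∂volume.restrict (Ioi (0 : ℝ)), U t = ViscousSlab.velocity (u t)) ∧
          (∀ᵐ t ∂volume.restrict (Ioi (0 : ℝ)), H t = h t) ∧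
          U 0 = u₀ ∧ H 0 = h₀ ∧
          ViscousSlab.energy (ViscousSlab.symbol g σ r) (U 0) (H 0) < ⊤ ∧
          ∀ t ≥ 0, ViscousSlab.energy (ViscousSlab.symbol g σ r) (U t) (H t) ≤
            ENNReal.ofReal (K * Real.exp (-c * t)) *
              ViscousSlab.energy (ViscousSlab.symbol g σ r) (U 0) (H 0) := by
  have hf := ViscousSlab.isDecayFrame_slab (d := d) hℓ hg hσ hr
  have hC := hf.pos
  -- The energy halves over each time span of `2 * decayConst`, which gives this rate and the
  -- prefactor `2`.
  refine ⟨Real.log 2 / (2 * ViscousSlab.decayConst (ViscousSlab.frameConst d ℓ g σ)), ?_, 2,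
    two_pos, fun u h u₀ h₀ hw hh => ?_⟩
  · have := Real.log_pos one_lt_two
    unfold ViscousSlab.decayConst
    positivity
  obtain ⟨w, m, k, hE⟩ := ViscousSlab.isEvolution_of_isWeakSolution hℓ hg hσ hw
  obtain ⟨U, η, hUc, hηc, hU, hη, hdecay⟩ := hE.decay hf
  obtain ⟨-, -, -, -, -, -, -, -, -, -, -, -, -, -, -, hu0, hh0⟩ := hw
  have hU0 : U 0 = u₀ := hu0.eq hUc hU
  have hη0 : η 0 = h₀ := hh0.eq hηc hη
  have hμ : ∀ ξ : Fin d → ℤ, 0 ≤ ViscousSlab.symbol g σ r ξ := fun ξ =>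
    hg.le.trans (ViscousSlab.le_symbol hσ ξ)
  have hs := ViscousSlab.summable_realCoeff hμ
    (ViscousSlab.summable_symbol_of_sobolev hg hσ hr hh)
  rw [← hη0] at hs
  refine ⟨U, η, hUc, hηc, hU, hη, hU0, hη0, ?_, fun t ht => ?_⟩
  · rw [ViscousSlab.energy_eq hμ _ hs]
    exact ENNReal.ofReal_lt_top
  · obtain ⟨hst, hle⟩ := hdecay hs t ht
    rw [ViscousSlab.energy_eq hμ _ hst, ViscousSlab.energy_eq hμ _ hs,
      ← ENNReal.ofReal_mul (by positivity)]
    exact ENNReal.ofReal_le_ofReal hle
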